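/- For $\gamma>-1$ put, on $-1<x<1$, $$\bar U^\gamma_\theta(x)=(1-x)\Big(1+\frac{2(\gamma+1)}{(\gamma+1)\ln\frac{1+x}{2}-2}\Big),\qquad U^{-\frac12,\gamma}=(\bar U^\gamma_\theta,0),$$ $$a_\gamma(x)=\int_0^x\frac{2s+\bar U^\gamma_\theta(s)}{1-s^2}\,ds,\qquad b_\gamma(x)=\int_0^x\frac{\bar U^\gamma_\theta(s)}{1-s^2}\,ds,$$ $$V^1_\gamma=\big(e^{-a_\gamma(x)},\,0\big),\qquad V^2_\gamma=\Big(0,\ \int_x^1e^{-b_\gamma(t)}\,dt\Big).$$ For a function $u$ on $(-1,1)$ let $$\psi[u](x)=\int_x^1\int_l^1\int_t^1\frac{2u(s)u'(s)}{1-s^2}\,ds\,dt\,dl .$$ Say that $U=(U_\theta,U_\phi)$, with $U_\theta\in C^1(-1,1)$ and $U_\phi\in C^2(-1,1)$, satisfies $(E_{\hat\mu})$, $\hat\mu\in\mathbb R$, if on $(-1,1)$ the integral $\psi[U_\phi]$ converges and $$(1-x^2)U_\theta'+2xU_\theta+\tfrac12U_\theta^2-\psi[U_\phi](x)=\hat\mu(1-x)^2,\qquad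 (1-x^2)U_\phi''+U_\theta U_\phi'=0 .$$ Fix $0<\epsilon<\frac12$. Let $\mathbf M_1$ be the space of all $f\in C([-1,1])\cap C^1((-1,1])\cap C^2((0,1))$ with $f(1)=f(-1)=0$ and finite norm $$\|f\|_{\mathbf M_1}=\big\|\ln\tfrac{1+x}{3}\,f\big\|_{L^\infty(-1,1)}+\big\|(1+x)\big(\ln\tfrac{1+x}{3}\big)^2f'\big\|_{L^\infty(-1,1)}+\|f''\|_{L^\infty(0,1)},$$ and let $\mathbf M_2$ be the space of all $f\in C^1((-1,1])\cap C^2((-1,1))$ with $f(1)=0$ and finite norm $$\|f\|_{\mathbf M_2}=\|(1+x)^{\epsilon}f\|_{L^\infty(-1,1)}+\|(1+x)^{1+\epsilon}f'\|_{L^\infty(-1,1)}+\|(1+x)^{2+\epsilon}f''\|_{L^\infty(-1,1)} .$$ Let $\mathbf X=\mathbf M_1\times\mathbf M_2$ with $\|(f,g)\|_{\mathbf X}=\|f\|_{\mathbf M_1}+\|g\|_{\mathbf M_2}$, and $\mathbf X_1=\{(f,g)\in\mathbf X: f(0)=g(0)=0\}$. **Theorem.** For every compact $K\subset(-1,\infty)$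 there exist $\delta>0$ and $V\in C^\infty(K\times B_\delta(0),\mathbf X_1)$, where $B_\delta(0)\subset\mathbb R^2$ is the Euclidean ball and smooth on $K\times B_\delta(0)$ means that $V$ extends to a smooth map on $O\times B_\delta(0)$ for some open $O\supset K$, such that $V(\gamma,0,0)=0$ and $\frac{\partial V}{\partial\beta_i}(\gamma,0,0)=0$ for $i=1,2$ and all $\gamma\in K$, and such that for all $\gamma\in K$ and $(\beta_1,\beta_2)\in B_\delta(0)$ the pair $$U=U^{-\frac12,\gamma}+\beta_1V^1_\gamma+\beta_2V^2_\gamma+V(\gamma,\beta_1,\beta_2)\qquad(*)$$ satisfies $(E_{\hat\mu})$ with $\hat\mu=-\frac12-\frac14\psi[U_\phi](-1)$, where the integral $\psi[U_\phi](-1)$ converges. Moreover there exists $\delta'>0$ such that, if $\gamma\in K$, $U-U^{-\frac12,\gamma}\in\mathbf X$, $\|U-U^{-\frac12,\gamma}\|_{\mathbf X}<\delta'$, and $U$ satisfies $(E_{\hat\mu})$ for some constant $\hat\mu$, then $(*)$ holds on $(-1,1)$ for some $(\beta_1,\beta_2)$ with $|(\beta_1,\beta_2)|<\delta$. -/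

import Mathlib

open Set Metric MeasureTheory
open scoped ContDiff

noncomputable section

namespace NSSwirl

/-- A pair `(U_θ, U_φ)` of functions of `x = cos θ`; the relevant range is `-1 < x < 1`. -/
abbrev Pair : Type := (ℝ → ℝ) × (ℝ → ℝ)

/-! ### Weighted sup norms -/

/-- `w · f^(k)` is bounded on `s`. -/
def WBdd (w : ℝ → ℝ) (k : ℕ) (s : Set ℝ) (f : ℝ → ℝ) : Prop :=
  BddAbove (range fun x : s => |w x * iteratedDeriv k f x|)

/-- `sup_s |w · f^(k)|`. It is only used where `w · f^(k)` is continuous on the open interval `s`,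
so that it is the `L^∞(s)` norm of `w · f^(k)`. -/
def wsup (w : ℝ → ℝ) (k : ℕ) (s : Set ℝ) (f : ℝ → ℝ) : ℝ :=
  ⨆ x : s, |w x * iteratedDeriv k f x|

section wsup

variable {w : ℝ → ℝ} {k : ℕ} {s : Set ℝ} {f g : ℝ → ℝ}

theorem wsup_nonneg : 0 ≤ wsup w k s f :=
  Real.iSup_nonneg fun _ => abs_nonneg _

theorem le_wsup (h : WBdd w k s f) {x : ℝ} (hx : x ∈ s) :
    |w x * iteratedDeriv k f x| ≤ wsup w k s f :=
  le_ciSup h (⟨x, hx⟩ : s)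

theorem wbdd_of {C : ℝ} (h : ∀ x ∈ s, |w x * iteratedDeriv k f x| ≤ C) : WBdd w k s f := by
  refine ⟨C, ?_⟩
  rintro _ ⟨x, rfl⟩
  exact h x x.2

theorem wsup_le {C : ℝ} (hC : 0 ≤ C) (h : ∀ x ∈ s, |w x * iteratedDeriv k f x| ≤ C) :
    wsup w k s f ≤ C :=
  Real.iSup_le (fun x => h x x.2) hC

theorem wterm_add (hf : ∀ x ∈ s, ContDiffAt ℝ k f x) (hg : ∀ x ∈ s, ContDiffAt ℝ k g x)
    (bf : WBdd w k s f) (bg : WBdd w k s g) (x : ℝ) (hx : x ∈ s) :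
    |w x * iteratedDeriv k (f + g) x| ≤ wsup w k s f + wsup w k s g := by
  rw [iteratedDeriv_add (hf x hx) (hg x hx), mul_add]
  exact (abs_add_le _ _).trans (add_le_add (le_wsup bf hx) (le_wsup bg hx))

theorem WBdd.add (hf : ∀ x ∈ s, ContDiffAt ℝ k f x) (hg : ∀ x ∈ s, ContDiffAt ℝ k g x)
    (bf : WBdd w k s f) (bg : WBdd w k s g) : WBdd w k s (f + g) :=
  wbdd_of (wterm_add hf hg bf bg)

theorem wsup_add_le (hf : ∀ x ∈ s, ContDiffAt ℝ k f x) (hg : ∀ x ∈ s, ContDiffAt ℝ k g x)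
    (bf : WBdd w k s f) (bg : WBdd w k s g) :
    wsup w k s (f + g) ≤ wsup w k s f + wsup w k s g :=
  wsup_le (add_nonneg wsup_nonneg wsup_nonneg) (wterm_add hf hg bf bg)

theorem wterm_smul (c : ℝ) (x : ℝ) :
    |w x * iteratedDeriv k (c • f) x| = |c| * |w x * iteratedDeriv k f x| := by
  rw [iteratedDeriv_const_smul_field, smul_eq_mul, ← abs_mul]
  congr 1
  ring

theorem WBdd.smul (c : ℝ) (bf : WBdd w k s f) : WBdd w k s (c • f) :=
  wbdd_of fun x hx => by
    rw [wterm_smul]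
    exact mul_le_mul_of_nonneg_left (le_wsup bf hx) (abs_nonneg c)

theorem wsup_smul (c : ℝ) : wsup w k s (c • f) = |c| * wsup w k s f := by
  unfold wsup
  simp_rw [wterm_smul]
  exact (Real.mul_iSup_of_nonneg (abs_nonneg c) _).symm

theorem wbdd_zero : WBdd w k s 0 :=
  wbdd_of (C := 0) fun x _ => by
    have h : iteratedDeriv k (0 : ℝ → ℝ) x = 0 := by
      simp
    simp [h]

theorem eq_zero_of_wsup_eq_zero (bf : WBdd w 0 s f) (h : wsup w 0 s f = 0) {x : ℝ} (hx : x ∈ s)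
    (hw : w x ≠ 0) : f x = 0 := by
  have h1 := le_wsup bf hx
  rw [h, iteratedDeriv_zero] at h1
  have h2 := abs_eq_zero.1 (le_antisymm h1 (abs_nonneg _))
  exact (mul_eq_zero.1 h2).resolve_left hw

end wsup

/-! ### The weights and the spaces `M₁`, `M₂`, `X`, `X₁`

An element of one of these spaces is represented by the function on `ℝ` that vanishes outside
`(-1, 1]`; this makes representatives unique. -/

/-- `ln ((1 + x) / 3)` -/
def wtLog (x : ℝ) : ℝ := Real.log ((1 + x) / 3)

/-- `(1 + x) (ln ((1 + x) / 3))²` -/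
def wtLogSq (x : ℝ) : ℝ := (1 + x) * Real.log ((1 + x) / 3) ^ 2

/-- `(1 + x) ^ r` -/
def wpow (r : ℝ) (x : ℝ) : ℝ := (1 + x) ^ r

theorem contDiffAt_of_Ioc {f : ℝ → ℝ} {n : WithTop ℕ∞} (h : ContDiffOn ℝ n f (Ioc (-1) 1)) {x : ℝ}
    (hx : x ∈ Ioo (-1 : ℝ) 1) : ContDiffAt ℝ n f x :=
  h.contDiffAt (Ioc_mem_nhds hx.1 hx.2)

theorem contDiffAt_of_Ioo {f : ℝ → ℝ} {n : WithTop ℕ∞} {a b : ℝ} (h : ContDiffOn ℝ n f (Ioo a b))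
    {x : ℝ} (hx : x ∈ Ioo a b) : ContDiffAt ℝ n f x :=
  h.contDiffAt (Ioo_mem_nhds hx.1 hx.2)

/-- The conditions defining `M₁`. -/
structure MemM₁ (f : ℝ → ℝ) : Prop where
  eq_zero : ∀ x ∉ Icc (-1 : ℝ) 1, f x = 0
  cont : ContinuousOn f (Icc (-1) 1)
  smooth₁ : ContDiffOn ℝ 1 f (Ioc (-1) 1)
  smooth₂ : ContDiffOn ℝ 2 f (Ioo 0 1)
  right : f 1 = 0
  left : f (-1) = 0
  bdd₀ : WBdd wtLog 0 (Ioo (-1) 1) f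
  bdd₁ : WBdd wtLogSq 1 (Ioo (-1) 1) f
  bdd₂ : WBdd 1 2 (Ioo 0 1) f

theorem MemM₁.at₀ {f : ℝ → ℝ} (h : MemM₁ f) : ∀ x ∈ Ioo (-1 : ℝ) 1, ContDiffAt ℝ (0 : ℕ) f x :=
  fun _ hx => (contDiffAt_of_Ioc h.smooth₁ hx).of_le (by norm_num)

theorem MemM₁.at₁ {f : ℝ → ℝ} (h : MemM₁ f) : ∀ x ∈ Ioo (-1 : ℝ) 1, ContDiffAt ℝ (1 : ℕ) f x :=
  fun _ hx => contDiffAt_of_Ioc h.smooth₁ hx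

theorem MemM₁.at₂ {f : ℝ → ℝ} (h : MemM₁ f) : ∀ x ∈ Ioo (0 : ℝ) 1, ContDiffAt ℝ (2 : ℕ) f x :=
  fun _ hx => contDiffAt_of_Ioo h.smooth₂ hx

/-- The conditions defining `M₂(ε)`. -/
structure MemM₂ (ε : ℝ) (f : ℝ → ℝ) : Prop where
  eq_zero : ∀ x ∉ Ioc (-1 : ℝ) 1, f x = 0
  smooth₁ : ContDiffOn ℝ 1 f (Ioc (-1) 1)
  smooth₂ : ContDiffOn ℝ 2 f (Ioo (-1) 1)
  right : f 1 = 0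
  bdd₀ : WBdd (wpow ε) 0 (Ioo (-1) 1) f
  bdd₁ : WBdd (wpow (1 + ε)) 1 (Ioo (-1) 1) f
  bdd₂ : WBdd (wpow (2 + ε)) 2 (Ioo (-1) 1) f

theorem MemM₂.at₀ {ε : ℝ} {f : ℝ → ℝ} (h : MemM₂ ε f) :
    ∀ x ∈ Ioo (-1 : ℝ) 1, ContDiffAt ℝ (0 : ℕ) f x :=
  fun _ hx => (contDiffAt_of_Ioc h.smooth₁ hx).of_le (by norm_num)

theorem MemM₂.at₁ {ε : ℝ} {f : ℝ → ℝ} (h : MemM₂ ε f) :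
    ∀ x ∈ Ioo (-1 : ℝ) 1, ContDiffAt ℝ (1 : ℕ) f x :=
  fun _ hx => contDiffAt_of_Ioc h.smooth₁ hx

theorem MemM₂.at₂ {ε : ℝ} {f : ℝ → ℝ} (h : MemM₂ ε f) :
    ∀ x ∈ Ioo (-1 : ℝ) 1, ContDiffAt ℝ (2 : ℕ) f x :=
  fun _ hx => contDiffAt_of_Ioo h.smooth₂ hx

/-- The vector space `M₁`. -/
def M₁ : Submodule ℝ (ℝ → ℝ) where
  carrier := {f | MemM₁ f}
  zero_mem' := ⟨fun _ _ => rfl, continuousOn_const, contDiffOn_const, contDiffOn_const, rfl, rfl,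
    wbdd_zero, wbdd_zero, wbdd_zero⟩
  add_mem' {f g} hf hg := ⟨fun x hx => by simp [hf.eq_zero x hx, hg.eq_zero x hx],
    hf.cont.add hg.cont, hf.smooth₁.add hg.smooth₁, hf.smooth₂.add hg.smooth₂,
    by simp [hf.right, hg.right], by simp [hf.left, hg.left],
    WBdd.add hf.at₀ hg.at₀ hf.bdd₀ hg.bdd₀, WBdd.add hf.at₁ hg.at₁ hf.bdd₁ hg.bdd₁,
    WBdd.add hf.at₂ hg.at₂ hf.bdd₂ hg.bdd₂⟩
  smul_mem' c f hf := ⟨fun x hx => by simp [hf.eq_zero x hx],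
    hf.cont.const_smul c, hf.smooth₁.const_smul c, hf.smooth₂.const_smul c,
    by simp [hf.right], by simp [hf.left],
    WBdd.smul c hf.bdd₀, WBdd.smul c hf.bdd₁, WBdd.smul c hf.bdd₂⟩

/-- The vector space `M₂(ε)`. -/
def M₂ (ε : ℝ) : Submodule ℝ (ℝ → ℝ) where
  carrier := {f | MemM₂ ε f}
  zero_mem' := ⟨fun _ _ => rfl, contDiffOn_const, contDiffOn_const, rfl,
    wbdd_zero, wbdd_zero, wbdd_zero⟩
  add_mem' {f g} hf hg := ⟨fun x hx => by simp [hf.eq_zero x hx, hg.eq_zero x hx],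
    hf.smooth₁.add hg.smooth₁, hf.smooth₂.add hg.smooth₂, by simp [hf.right, hg.right],
    WBdd.add hf.at₀ hg.at₀ hf.bdd₀ hg.bdd₀, WBdd.add hf.at₁ hg.at₁ hf.bdd₁ hg.bdd₁,
    WBdd.add hf.at₂ hg.at₂ hf.bdd₂ hg.bdd₂⟩
  smul_mem' c f hf := ⟨fun x hx => by simp [hf.eq_zero x hx],
    hf.smooth₁.const_smul c, hf.smooth₂.const_smul c, by simp [hf.right],
    WBdd.smul c hf.bdd₀, WBdd.smul c hf.bdd₁, WBdd.smul c hf.bdd₂⟩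

/-- The norm of `M₁`. -/
def normM₁ (f : ℝ → ℝ) : ℝ :=
  wsup wtLog 0 (Ioo (-1) 1) f + wsup wtLogSq 1 (Ioo (-1) 1) f + wsup 1 2 (Ioo 0 1) f

/-- The norm of `M₂(ε)`. -/
def normM₂ (ε : ℝ) (f : ℝ → ℝ) : ℝ :=
  wsup (wpow ε) 0 (Ioo (-1) 1) f + wsup (wpow (1 + ε)) 1 (Ioo (-1) 1) f
    + wsup (wpow (2 + ε)) 2 (Ioo (-1) 1) f

theorem normM₁_nonneg (f : ℝ → ℝ) : 0 ≤ normM₁ f :=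
  add_nonneg (add_nonneg wsup_nonneg wsup_nonneg) wsup_nonneg

theorem normM₂_nonneg (ε : ℝ) (f : ℝ → ℝ) : 0 ≤ normM₂ ε f :=
  add_nonneg (add_nonneg wsup_nonneg wsup_nonneg) wsup_nonneg

theorem normM₁_smul (c : ℝ) (f : ℝ → ℝ) : normM₁ (c • f) = |c| * normM₁ f := by
  simp only [normM₁, wsup_smul]
  ring

theorem normM₂_smul (ε c : ℝ) (f : ℝ → ℝ) : normM₂ ε (c • f) = |c| * normM₂ ε f := by
  simp only [normM₂, wsup_smul]
  ring

theorem normM₁_add_le {f g : ℝ → ℝ} (hf : MemM₁ f) (hg : MemM₁ g) :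
    normM₁ (f + g) ≤ normM₁ f + normM₁ g := by
  have h0 := wsup_add_le hf.at₀ hg.at₀ hf.bdd₀ hg.bdd₀
  have h1 := wsup_add_le hf.at₁ hg.at₁ hf.bdd₁ hg.bdd₁
  have h2 := wsup_add_le hf.at₂ hg.at₂ hf.bdd₂ hg.bdd₂
  unfold normM₁
  linarith

theorem normM₂_add_le {ε : ℝ} {f g : ℝ → ℝ} (hf : MemM₂ ε f) (hg : MemM₂ ε g) :
    normM₂ ε (f + g) ≤ normM₂ ε f + normM₂ ε g := by
  have h0 := wsup_add_le hf.at₀ hg.at₀ hf.bdd₀ hg.bdd₀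
  have h1 := wsup_add_le hf.at₁ hg.at₁ hf.bdd₁ hg.bdd₁
  have h2 := wsup_add_le hf.at₂ hg.at₂ hf.bdd₂ hg.bdd₂
  unfold normM₂
  linarith

theorem wtLog_ne_zero {x : ℝ} (hx : x ∈ Ioo (-1 : ℝ) 1) : wtLog x ≠ 0 :=
  (Real.log_neg (by linarith [hx.1]) (by linarith [hx.2])).ne

theorem wpow_ne_zero (r : ℝ) {x : ℝ} (hx : x ∈ Ioo (-1 : ℝ) 1) : wpow r x ≠ 0 :=
  (Real.rpow_pos_of_pos (by linarith [hx.1]) r).ne'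

theorem eq_zero_of_normM₁ {f : ℝ → ℝ} (hf : MemM₁ f) (h : normM₁ f = 0) : f = 0 := by
  have h0 : wsup wtLog 0 (Ioo (-1) 1) f = 0 := by
    have a0 := wsup_nonneg (w := wtLog) (k := 0) (s := Ioo (-1) 1) (f := f)
    have a1 := wsup_nonneg (w := wtLogSq) (k := 1) (s := Ioo (-1) 1) (f := f)
    have a2 := wsup_nonneg (w := 1) (k := 2) (s := Ioo 0 1) (f := f)
    unfold normM₁ at h
    linarith
  funext x
  by_cases hx : x ∈ Ioo (-1 : ℝ) 1
  · exact eq_zero_of_wsup_eq_zero hf.bdd₀ h0 hx (wtLog_ne_zero hx)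
  · by_cases h1 : x = 1
    · simpa [h1] using hf.right
    · by_cases h2 : x = -1
      · simpa [h2] using hf.left
      · exact hf.eq_zero x fun h3 =>
          hx ⟨lt_of_le_of_ne h3.1 (Ne.symm h2), lt_of_le_of_ne h3.2 h1⟩

theorem eq_zero_of_normM₂ {ε : ℝ} {f : ℝ → ℝ} (hf : MemM₂ ε f) (h : normM₂ ε f = 0) : f = 0 := by
  have h0 : wsup (wpow ε) 0 (Ioo (-1) 1) f = 0 := by
    have a0 := wsup_nonneg (w := wpow ε) (k := 0) (s := Ioo (-1) 1) (f := f)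
    have a1 := wsup_nonneg (w := wpow (1 + ε)) (k := 1) (s := Ioo (-1) 1) (f := f)
    have a2 := wsup_nonneg (w := wpow (2 + ε)) (k := 2) (s := Ioo (-1) 1) (f := f)
    unfold normM₂ at h
    linarith
  funext x
  by_cases hx : x ∈ Ioo (-1 : ℝ) 1
  · exact eq_zero_of_wsup_eq_zero hf.bdd₀ h0 hx (wpow_ne_zero ε hx)
  · by_cases h1 : x = 1
    · simpa [h1] using hf.right
    · exact hf.eq_zero x fun h3 => hx ⟨h3.1, lt_of_le_of_ne h3.2 h1⟩

/-- The space `X = M₁ × M₂(ε)`, normed by `‖U_θ‖_{M₁} + ‖U_φ‖_{M₂}`. -/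
def X (ε : ℝ) : Type := ↥(M₁.prod (M₂ ε))

instance (ε : ℝ) : AddCommGroup (X ε) := inferInstanceAs (AddCommGroup ↥(M₁.prod (M₂ ε)))

instance (ε : ℝ) : Module ℝ (X ε) := inferInstanceAs (Module ℝ ↥(M₁.prod (M₂ ε)))

/-- The underlying pair of functions of an element of `X`. -/
def X.pair {ε : ℝ} : X ε →ₗ[ℝ] Pair := (M₁.prod (M₂ ε)).subtype

theorem X.pair_injective {ε : ℝ} : Function.Injective (X.pair (ε := ε)) :=
  (M₁.prod (M₂ ε)).injective_subtype

theorem X.mem₁ {ε : ℝ} (U : X ε) : MemM₁ U.pair.1 := (Subtype.property U).1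

theorem X.mem₂ {ε : ℝ} (U : X ε) : MemM₂ ε U.pair.2 := (Subtype.property U).2

instance (ε : ℝ) : Norm (X ε) := ⟨fun U => normM₁ U.pair.1 + normM₂ ε U.pair.2⟩

theorem X.norm_def {ε : ℝ} (U : X ε) : ‖U‖ = normM₁ U.pair.1 + normM₂ ε U.pair.2 := rfl

theorem X.core (ε : ℝ) : NormedSpace.Core ℝ (X ε) where
  norm_nonneg U := add_nonneg (normM₁_nonneg _) (normM₂_nonneg _ _)
  norm_smul c U := by
    rw [X.norm_def, X.norm_def, map_smul, Prod.smul_fst, Prod.smul_snd, normM₁_smul, normM₂_smul,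
      Real.norm_eq_abs]
    ring
  norm_triangle U V := by
    rw [X.norm_def, X.norm_def, X.norm_def, map_add, Prod.fst_add, Prod.snd_add]
    have h1 := normM₁_add_le U.mem₁ V.mem₁
    have h2 := normM₂_add_le U.mem₂ V.mem₂
    linarith
  norm_eq_zero_iff U := by
    constructor
    · intro h
      rw [X.norm_def] at h
      have h1 := normM₁_nonneg U.pair.1
      have h2 := normM₂_nonneg ε U.pair.2
      apply X.pair_injective
      rw [map_zero]
      exact Prod.ext (eq_zero_of_normM₁ U.mem₁ (by linarith))
        (eq_zero_of_normM₂ U.mem₂ (by linarith))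
    · rintro rfl
      rw [X.norm_def, map_zero]
      have h1 := normM₁_smul 0 0
      have h2 := normM₂_smul ε 0 0
      simp only [zero_smul, abs_zero, zero_mul] at h1 h2
      simp [h1, h2]

instance (ε : ℝ) : NormedAddCommGroup (X ε) := NormedAddCommGroup.ofCore (X.core ε)

instance (ε : ℝ) : NormedSpace ℝ (X ε) := NormedSpace.ofCore (X.core ε)

/-- `l₁(V) = V_θ(0)` -/
def l₁ (ε : ℝ) : X ε →ₗ[ℝ] ℝ := LinearMap.proj 0 ∘ₗ LinearMap.fst ℝ _ _ ∘ₗ X.pair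

/-- `l₂(V) = V_φ(0)` -/
def l₂ (ε : ℝ) : X ε →ₗ[ℝ] ℝ := LinearMap.proj 0 ∘ₗ LinearMap.snd ℝ _ _ ∘ₗ X.pair

/-- `X₁ = ker l₁ ∩ ker l₂`, with the norm of `X`. -/
def X₁ (ε : ℝ) : Submodule ℝ (X ε) := LinearMap.ker (l₁ ε) ⊓ LinearMap.ker (l₂ ε)

/-! ### The no-swirl solution and the kernel elements, for `μ = -1/2`

Only the values on `(-1, 1)` are used. -/

/-- `U_θ^{-1/2,γ}` -/
def Ubarθ (γ x : ℝ) : ℝ :=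
  (1 - x) * (1 + 2 * (γ + 1) / ((γ + 1) * Real.log ((1 + x) / 2) - 2))

/-- `U^{-1/2,γ} = (U_θ^{-1/2,γ}, 0)` -/
def Ubar (γ : ℝ) : Pair := (Ubarθ γ, 0)

/-- `a_{-1/2,γ}` -/
def aFun (γ x : ℝ) : ℝ := ∫ s in (0 : ℝ)..x, (2 * s + Ubarθ γ s) / (1 - s ^ 2)

/-- `b_{-1/2,γ}` -/
def bFun (γ x : ℝ) : ℝ := ∫ s in (0 : ℝ)..x, Ubarθ γ s / (1 - s ^ 2)

/-- `V¹_{-1/2,γ}` -/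
def kerOne (γ : ℝ) : Pair := (fun x => Real.exp (-aFun γ x), 0)

/-- `V²_{-1/2,γ}` -/
def kerTwo (γ : ℝ) : Pair := (0, fun x => ∫ t in x..1, Real.exp (-bFun γ t))

/-! ### The reduced Navier-Stokes system -/

/-- `2 u u' / (1 - s²)` -/
def swirlDensity (u : ℝ → ℝ) (s : ℝ) : ℝ := 2 * u s * deriv u s / (1 - s ^ 2)

/-- `∫_l^1 ∫_t^1 2 u u' / (1 - s²) ds dt` -/
def psiInner (u : ℝ → ℝ) (l : ℝ) : ℝ := ∫ t in l..1, ∫ s in t..1, swirlDensity u s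

/-- `ψ[u](x) = ∫_x^1 ∫_l^1 ∫_t^1 2 u u' / (1 - s²) ds dt dl` -/
def psi (u : ℝ → ℝ) (x : ℝ) : ℝ := ∫ l in x..1, psiInner u l

/-- `U = (U_θ, U_φ)` solves on `(-1, 1)` the system
`(1-x²) U_θ' + 2x U_θ + U_θ²/2 - ψ[U_φ] = μ (1-x)²`, `(1-x²) U_φ'' + U_θ U_φ' = 0`.
The field `integrable` says that the iterated integral `ψ[U_φ](x)` converges for `-1 < x < 1`
(the two outer integrands are then continuous on `(-1, 1]`). -/
structure IsSolution (U : Pair) (μ : ℝ) : Prop where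
  smoothθ : ContDiffOn ℝ 1 U.1 (Ioo (-1) 1)
  smoothφ : ContDiffOn ℝ 2 U.2 (Ioo (-1) 1)
  integrable : ∀ t ∈ Ioo (-1 : ℝ) 1, IntervalIntegrable (swirlDensity U.2) volume t 1
  eqθ : ∀ x ∈ Ioo (-1 : ℝ) 1,
    (1 - x ^ 2) * deriv U.1 x + 2 * x * U.1 x + 1 / 2 * U.1 x ^ 2 - psi U.2 x = μ * (1 - x) ^ 2
  eqφ : ∀ x ∈ Ioo (-1 : ℝ) 1, (1 - x ^ 2) * deriv (deriv U.2) x + U.1 x * deriv U.2 x = 0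

/-- Two pairs of functions agree on `(-1, 1)`. -/
def AgreeOn (U W : Pair) : Prop := EqOn U.1 W.1 (Ioo (-1) 1) ∧ EqOn U.2 W.2 (Ioo (-1) 1)

/-- `U^{-1/2,γ} + β₁ V¹ + β₂ V² + W` -/
def family (γ : ℝ) (β : EuclideanSpace ℝ (Fin 2)) (W : Pair) : Pair :=
  Ubar γ + β 0 • kerOne γ + β 1 • kerTwo γ + W

end NSSwirl

end

noncomputable section

namespace NSSwirl

open Filter Topology
open scoped BoundedContinuousFunction

/-! Write U = U^{-1/2,γ} + v with v = (f, w), and put c = γ + 1, den = 2 - c ln((1+x)/2), so that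
the base flow is (1-x)(1 - 2c/den). In the unknowns g = f/(1-x) and p = (1+x)w' the system becomes
two copies of one scalar equation, (1+x)g' = (2c/den) g + r₁ + κ and (1+x)p' = (2c/den) p + r₂,
where r₁ = ψ/(1-x)² - ψ(-1)/4 - g²/2 and r₂ = -gp are quadratic in v, and κ = μ̂ + 1/2 + ψ(-1)/4
(`eqθ_iff`, `eqφ_iff`). All other terms of the first equation tend to 0 at x = -1, so κ = 0, which
is the stated value of μ̂ (`IsSolution.constant_eq`).

The integrating factor den² solves the scalar equation. Its homogeneous solutions A/den² produce
exactly V¹ and V², so a solution is determined by the right hand sides and the values of f and w at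
0 (`SolvesLinear.agreeOn`). This gives a solution operator `linSol` : (γ, β, y) ↦ v, where y encodes
the right hand sides and β the values at 0, and y = 0 returns β₁V¹ + β₂V² (`agreeOn_linSol_kernel`).
Solutions of the full system then correspond to fixed points y = quad(linSol(γ, β, y)) (`fixMap`).
Since `quad` is homogeneous of degree two, the derivative of this map vanishes at β = 0, y = 0, and
the inverse function theorem gives a unique small fixed point g(γ, β), smooth in (γ, β)
(`eventually_fixedPoint`); compactness of K makes the radii uniform (`exists_smooth_fixedPoint`).
The correction is V = linSol(γ, β, g(γ, β)) - linSol(γ, β, 0): both terms have the same values at 0,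
so V lies in X₁, and since g and its derivative vanish at β = 0, so do V and its derivative.

Two devices carry the analysis. The fixed point problem is posed for the right hand sides y in `Cb ×
Cb`, so completeness of X is never needed. And γ enters `linSol` only through scalars, the element
`denQuot` = den/lam of the Banach algebra `Cb`, which is affine in c, and its inverse; the integral
operators are fixed Volterra operators with weights in `lam` and powers of 1 + x. Smoothness in γ
thus reduces to smoothness of inversion in `Cb`, followed by one continuous linear map `reconstruct`
into X. The assumption ε < 1/2 makes (1+x)^{-2ε} integrable, hence ψ finite up to -1. -/

/-! ### Bounded continuous functions on `(-1, 1)` -/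

/-- Bounded continuous functions on `(-1, 1)`. -/
abbrev Cb : Type := ↥(Ioo (-1 : ℝ) 1) →ᵇ ℝ

/-- Extension by zero to `ℝ`. -/
def extZero (φ : Cb) (x : ℝ) : ℝ := if h : x ∈ Ioo (-1 : ℝ) 1 then φ ⟨x, h⟩ else 0

/-- A bounded continuous function on `(-1, 1)` given by a function on `ℝ`. -/
def Cb.mk (g : ℝ → ℝ) (C : ℝ) (hg : ContinuousOn g (Ioo (-1) 1))
    (hC : ∀ x ∈ Ioo (-1 : ℝ) 1, |g x| ≤ C) : Cb :=
  BoundedContinuousFunction.ofNormedAddCommGroup (fun x => g x) hg.domRestrict C fun x => hC x x.2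

section extZero

variable {φ ψ : Cb} {x : ℝ}

theorem extZero_of_mem (h : x ∈ Ioo (-1 : ℝ) 1) : extZero φ x = φ ⟨x, h⟩ := dif_pos h

theorem extZero_coe (x : ↥(Ioo (-1 : ℝ) 1)) : extZero φ x = φ x := dif_pos x.2

theorem extZero_mk {g : ℝ → ℝ} {C : ℝ} {hg : ContinuousOn g (Ioo (-1) 1)}
    {hC : ∀ x ∈ Ioo (-1 : ℝ) 1, |g x| ≤ C} (h : x ∈ Ioo (-1 : ℝ) 1) :
    extZero (Cb.mk g C hg hC) x = g x := by
  rw [extZero_of_mem h]; rfl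

theorem extZero_add : extZero (φ + ψ) x = extZero φ x + extZero ψ x := by
  unfold extZero; split_ifs <;> simp

theorem extZero_sub : extZero (φ - ψ) x = extZero φ x - extZero ψ x := by
  unfold extZero; split_ifs <;> simp

theorem extZero_neg : extZero (-φ) x = -extZero φ x := by
  unfold extZero; split_ifs <;> simp

theorem extZero_mul : extZero (φ * ψ) x = extZero φ x * extZero ψ x := by
  unfold extZero; split_ifs <;> simp

theorem extZero_smul (c : ℝ) : extZero (c • φ) x = c * extZero φ x := by
  unfold extZero; split_ifs <;> simp

theorem extZero_zero : extZero 0 x = 0 := by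
  unfold extZero; split_ifs <;> simp

theorem extZero_one (h : x ∈ Ioo (-1 : ℝ) 1) : extZero 1 x = 1 := by
  rw [extZero_of_mem h]; rfl

theorem extZero_pow (h : x ∈ Ioo (-1 : ℝ) 1) (n : ℕ) : extZero (φ ^ n) x = extZero φ x ^ n := by
  rw [extZero_of_mem h, extZero_of_mem h]; simp

theorem abs_extZero_le : |extZero φ x| ≤ ‖φ‖ := by
  unfold extZero
  split_ifs with h
  · exact φ.norm_coe_le_norm ⟨x, h⟩
  · simp

theorem continuousOn_extZero : ContinuousOn (extZero φ) (Ioo (-1) 1) := by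
  rw [continuousOn_iff_continuous_domRestrict]
  convert φ.continuous using 1
  ext x
  exact extZero_coe x

theorem measurable_extZero : Measurable (extZero φ) := by
  have h2 : Measurable fun x : ↥(Ioo (-1 : ℝ) 1) => φ x := φ.continuous.measurable
  exact Measurable.dite h2 measurable_const measurableSet_Ioo

theorem Cb.ext_on (h : ∀ x ∈ Ioo (-1 : ℝ) 1, extZero φ x = extZero ψ x) : φ = ψ := by
  ext x
  rw [← extZero_coe, ← extZero_coe]
  exact h x x.2

theorem Cb.norm_le {C : ℝ} (hC : 0 ≤ C) (h : ∀ x ∈ Ioo (-1 : ℝ) 1, |extZero φ x| ≤ C) :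
    ‖φ‖ ≤ C := by
  rw [BoundedContinuousFunction.norm_le hC]
  intro x
  rw [← extZero_coe]
  exact h x x.2

end extZero

/-! ### Calculus on `(-1, 1)` -/

theorem contDiffOn_one_of_hasDerivAt {s : Set ℝ} (hs : IsOpen s) {f f₁ : ℝ → ℝ}
    (h : ∀ x ∈ s, HasDerivAt f (f₁ x) x) (hc : ContinuousOn f₁ s) : ContDiffOn ℝ 1 f s := by
  rw [contDiffOn_one_iff_derivWithin hs.uniqueDiffOn]
  refine ⟨fun x hx => (h x hx).differentiableAt.differentiableWithinAt, hc.congr fun x hx => ?_⟩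
  rw [derivWithin_of_isOpen hs hx, (h x hx).deriv]

theorem contDiffOn_two_of_hasDerivAt {s : Set ℝ} (hs : IsOpen s) {f f₁ f₂ : ℝ → ℝ}
    (h : ∀ x ∈ s, HasDerivAt f (f₁ x) x) (h' : ∀ x ∈ s, HasDerivAt f₁ (f₂ x) x)
    (hc : ContinuousOn f₂ s) : ContDiffOn ℝ 2 f s := by
  rw [show (2 : WithTop ℕ∞) = 1 + 1 by norm_num, contDiffOn_succ_iff_deriv_of_isOpen hs]
  refine ⟨fun x hx => (h x hx).differentiableAt.differentiableWithinAt, by simp, ?_⟩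
  exact (contDiffOn_one_of_hasDerivAt hs h' hc).congr fun x hx => (h x hx).deriv

theorem iteratedDeriv_two_of_hasDerivAt {s : Set ℝ} (hs : IsOpen s) {f f₁ : ℝ → ℝ} {d : ℝ}
    (h : ∀ x ∈ s, HasDerivAt f (f₁ x) x) {x : ℝ} (hx : x ∈ s) (h' : HasDerivAt f₁ d x) :
    iteratedDeriv 2 f x = d := by
  rw [iteratedDeriv_succ, iteratedDeriv_one]
  refine (h'.congr_of_eventuallyEq ?_).deriv
  filter_upwards [hs.mem_nhds hx] with y hy using (h y hy).deriv

/-- The one-sided derivative at `1` exists because the interior derivative has a limit there.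
Two-sided differentiability is not available, since elements of the spaces are cut off beyond `1`.
-/
theorem contDiffOn_one_Ioc {f f₁ : ℝ → ℝ} (h : ∀ x ∈ Ioo (-1 : ℝ) 1, HasDerivAt f (f₁ x) x)
    (hf : ContinuousOn f (Ioc (-1) 1)) (hc : ContinuousOn f₁ (Ioc (-1) 1)) :
    ContDiffOn ℝ 1 f (Ioc (-1) 1) := by
  have key : ∀ x ∈ Ioc (-1 : ℝ) 1, HasDerivWithinAt f (f₁ x) (Ioc (-1) 1) x := by
    intro x hx
    rcases hx.2.lt_or_eq with h1 | rfl
    · exact (h x ⟨hx.1, h1⟩).hasDerivWithinAt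
    · refine (hasDerivWithinAt_Iic_of_tendsto_deriv (s := Ioo (-1 : ℝ) 1)
        (fun y hy => (h y hy).differentiableAt.differentiableWithinAt)
        ((hf 1 hx).mono Ioo_subset_Ioc_self) (Ioo_mem_nhdsLT (by norm_num)) ?_).mono
          (fun y hy => hy.2)
      have h2 : Tendsto f₁ (𝓝[<] 1) (𝓝 (f₁ 1)) := by
        refine (hc 1 hx).mono_left ?_
        rw [← nhdsWithin_Ioo_eq_nhdsLT (show (-1 : ℝ) < 1 by norm_num)]
        exact nhdsWithin_mono _ Ioo_subset_Ioc_self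
      refine h2.congr' ?_
      filter_upwards [Ioo_mem_nhdsLT (show (-1 : ℝ) < 1 by norm_num)] with y hy using
        (h y hy).deriv.symm
  rw [contDiffOn_one_iff_derivWithin (uniqueDiffOn_Ioc _ _)]
  refine ⟨fun x hx => (key x hx).differentiableWithinAt, hc.congr fun x hx => ?_⟩
  exact (key x hx).derivWithin (uniqueDiffOn_Ioc _ _ x hx)

theorem exists_const_of_hasDerivAt_zero {d : ℝ → ℝ}
    (h : ∀ x ∈ Ioo (-1 : ℝ) 1, HasDerivAt d 0 x) : ∃ C, ∀ x ∈ Ioo (-1 : ℝ) 1, d x = C :=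
  isOpen_Ioo.exists_is_const_of_deriv_eq_zero isPreconnected_Ioo
    (fun x hx => (h x hx).differentiableAt.differentiableWithinAt) fun x hx => (h x hx).deriv

/-- The recurring device for identifying two functions: equal derivatives inside, and difference
tending to zero at `-1`. -/
theorem eq_zero_of_hasDerivAt_zero {d : ℝ → ℝ} (h : ∀ x ∈ Ioo (-1 : ℝ) 1, HasDerivAt d 0 x)
    (hd : Tendsto d (𝓝[>] (-1)) (𝓝 0)) {x : ℝ} (hx : x ∈ Ioo (-1 : ℝ) 1) : d x = 0 := by
  obtain ⟨C, hC⟩ := exists_const_of_hasDerivAt_zero h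
  have h2 : Tendsto d (𝓝[>] (-1)) (𝓝 C) := by
    refine tendsto_const_nhds.congr' ?_
    filter_upwards [Ioo_mem_nhdsGT (show (-1 : ℝ) < 1 by norm_num)] with y hy using (hC y hy).symm
  rw [hC x hx, tendsto_nhds_unique h2 hd]

/-! ### Weighted Volterra operators -/

/-- The data of the operator `φ ↦ out(x) ∫_base^x ker φ`, bounded on `Cb`. -/
structure Volterra where
  base : ℝ
  out : ℝ → ℝ
  ker : ℝ → ℝ
  bound : ℝ
  out_cont : ContinuousOn out (Ioo (-1) 1)
  ker_cont : ContinuousOn ker (Ioo (-1) 1)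
  ker_int : ∀ x ∈ Ioc (-1 : ℝ) 1, IntervalIntegrable ker volume base x
  le_bound : ∀ x ∈ Ioo (-1 : ℝ) 1, |out x| * |(∫ s in base..x, |ker s|)| ≤ bound

theorem uIoo_subset_of_mem {a x : ℝ} (ha : a ∈ Icc (-1 : ℝ) 1) (hx : x ∈ Icc (-1 : ℝ) 1) :
    Ioo (min a x) (max a x) ⊆ Ioo (-1) 1 := by
  intro y hy
  exact ⟨(le_min ha.1 hx.1).trans_lt hy.1, hy.2.trans_le (max_le ha.2 hx.2)⟩

theorem ae_uIoc_of_forall_Ioo {a x : ℝ} (ha : a ∈ Icc (-1 : ℝ) 1) (hx : x ∈ Icc (-1 : ℝ) 1)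
    {p : ℝ → Prop} (h : ∀ s ∈ Ioo (-1 : ℝ) 1, p s) : ∀ᵐ s ∂volume, s ∈ uIoc a x → p s := by
  have h1 : ∀ᵐ s : ℝ ∂volume, s ≠ max a x := by
    simp [ae_iff, measure_singleton]
  filter_upwards [h1] with s hs hs'
  exact h s (uIoo_subset_of_mem ha hx ⟨hs'.1, lt_of_le_of_ne hs'.2 hs⟩)

/-- A nonnegative derivative of a continuous function is integrable up to a singular end point. Each
singular kernel therefore needs only an explicit dominating `G`, which also bounds its integral. -/
theorem intervalIntegrable_of_majorant {a x : ℝ} (ha : a ∈ Icc (-1 : ℝ) 1)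
    (hx : x ∈ Icc (-1 : ℝ) 1) {b G g : ℝ → ℝ} (hb : ContinuousOn b (Ioo (-1) 1))
    (hG : ContinuousOn G (uIcc a x)) (hG' : ∀ s ∈ Ioo (-1 : ℝ) 1, HasDerivAt G (g s) s)
    (hbg : ∀ s ∈ Ioo (-1 : ℝ) 1, |b s| ≤ g s) :
    IntervalIntegrable b volume a x ∧ |(∫ s in a..x, |b s|)| ≤ |G x - G a| := by
  have hsub := uIoo_subset_of_mem ha hx
  have hg : IntervalIntegrable g volume a x :=
    intervalIntegral.intervalIntegrable_deriv_of_nonneg hG (fun y hy => hG' y (hsub hy))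
      fun y hy => (abs_nonneg _).trans (hbg y (hsub hy))
  have hae := ae_uIoc_of_forall_Ioo ha hx hbg
  have hmeas : AEStronglyMeasurable b (volume.restrict (uIoc a x)) := by
    rw [uIoc, ← restrict_Ioo_eq_restrict_Ioc]
    exact (hb.mono hsub).aestronglyMeasurable measurableSet_Ioo
  have hbi : IntervalIntegrable b volume a x := by
    refine hg.mono_fun' hmeas ?_
    filter_upwards [ae_restrict_of_ae hae, ae_restrict_mem measurableSet_uIoc] with s h1 h2
      using h1 h2
  refine ⟨hbi, ?_⟩
  have h1 := intervalIntegral.integral_eq_sub_of_hasDeriv_right hG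
    (fun y hy => (hG' y (hsub hy)).hasDerivWithinAt) hg
  rw [← h1]
  refine intervalIntegral.norm_integral_le_abs_of_norm_le (f := fun s => |b s|) ?_ hg
  rw [ae_restrict_iff' measurableSet_uIoc]
  filter_upwards [hae] with s hs h2
  rw [Real.norm_eq_abs, abs_abs]
  exact hs h2

/-- A weighted Volterra operator whose kernel is dominated by the derivative of `G`. -/
def Volterra.ofMajorant (base : ℝ) (out ker : ℝ → ℝ) (bound : ℝ) (G g : ℝ → ℝ)
    (base_mem : base ∈ Icc (-1 : ℝ) 1) (out_cont : ContinuousOn out (Ioo (-1) 1))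
    (ker_cont : ContinuousOn ker (Ioo (-1) 1))
    (hG : ∀ x ∈ Ioc (-1 : ℝ) 1, ContinuousOn G (uIcc base x))
    (hG' : ∀ s ∈ Ioo (-1 : ℝ) 1, HasDerivAt G (g s) s)
    (hker : ∀ s ∈ Ioo (-1 : ℝ) 1, |ker s| ≤ g s)
    (hC : ∀ x ∈ Ioo (-1 : ℝ) 1, |out x| * |G x - G base| ≤ bound) : Volterra where
  base := base
  out := out
  ker := ker
  bound := bound
  out_cont := out_cont
  ker_cont := ker_cont
  ker_int x hx := (intervalIntegrable_of_majorant base_mem ⟨hx.1.le, hx.2⟩ ker_cont (hG x hx) hG'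
    hker).1
  le_bound x hx := by
    refine le_trans (mul_le_mul_of_nonneg_left ?_ (abs_nonneg _)) (hC x hx)
    exact (intervalIntegrable_of_majorant base_mem ⟨hx.1.le, hx.2.le⟩ ker_cont
      (hG x ⟨hx.1, hx.2.le⟩) hG' hker).2

namespace Volterra

variable (V : Volterra) (φ ψ : Cb) {x : ℝ}

/-- `∫_base^x ker φ` -/
def prim (x : ℝ) : ℝ := ∫ s in V.base..x, V.ker s * extZero φ s

theorem integrable_ker_mul (hx : x ∈ Ioc (-1 : ℝ) 1) :
    IntervalIntegrable (fun s => V.ker s * extZero φ s) volume V.base x := by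
  have h := V.ker_int x hx
  rw [intervalIntegrable_iff] at h ⊢
  refine h.mul_bdd (c := ‖φ‖) measurable_extZero.aestronglyMeasurable ?_
  exact Eventually.of_forall fun s => abs_extZero_le

theorem abs_prim_le (hx : x ∈ Ioc (-1 : ℝ) 1) :
    |V.prim φ x| ≤ |(∫ s in V.base..x, |V.ker s|)| * ‖φ‖ := by
  have h := V.ker_int x hx
  have h1 := intervalIntegral.norm_integral_le_abs_of_norm_le (a := V.base) (b := x) (μ := volume)
    (f := fun s => V.ker s * extZero φ s) (g := fun s => |V.ker s| * ‖φ‖)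
    (Eventually.of_forall fun s => by
      rw [norm_mul]
      exact mul_le_mul_of_nonneg_left abs_extZero_le (norm_nonneg _)) (h.abs.mul_const _)
  rw [intervalIntegral.integral_mul_const, abs_mul, abs_norm] at h1
  exact h1

theorem abs_out_mul_prim_le (hx : x ∈ Ioo (-1 : ℝ) 1) :
    |V.out x * V.prim φ x| ≤ V.bound * ‖φ‖ := by
  rw [abs_mul]
  calc |V.out x| * |V.prim φ x| ≤ |V.out x| * (|(∫ s in V.base..x, |V.ker s|)| * ‖φ‖) := by
        gcongr
        exact V.abs_prim_le φ ⟨hx.1, hx.2.le⟩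
    _ = (|V.out x| * |(∫ s in V.base..x, |V.ker s|)|) * ‖φ‖ := by ring
    _ ≤ V.bound * ‖φ‖ := by
        gcongr
        exact V.le_bound x hx

theorem hasDerivAt_prim (hx : x ∈ Ioo (-1 : ℝ) 1) :
    HasDerivAt (V.prim φ) (V.ker x * extZero φ x) x := by
  have hc : ContinuousOn (fun s => V.ker s * extZero φ s) (Ioo (-1) 1) :=
    V.ker_cont.mul continuousOn_extZero
  exact intervalIntegral.integral_hasDerivAt_right (V.integrable_ker_mul φ ⟨hx.1, hx.2.le⟩)
    (hc.stronglyMeasurableAtFilter isOpen_Ioo x hx) (hc.continuousAt (isOpen_Ioo.mem_nhds hx))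

theorem continuousOn_prim : ContinuousOn (V.prim φ) (Ioc (-1) 1) := by
  intro x hx
  -- The midpoint of `-1` and `x`. From there to `1` the integrand is integrable whatever the base,
  -- so continuity is read off from the primitive based at `1`.
  have hy : (x - 1) / 2 ∈ Ioc (-1 : ℝ) 1 := ⟨by linarith [hx.1], by linarith [hx.2]⟩
  have h1 : (1 : ℝ) ∈ Ioc (-1 : ℝ) 1 := by norm_num
  have hbi : IntervalIntegrable (fun s => V.ker s * extZero φ s) volume ((x - 1) / 2) 1 :=
    (V.integrable_ker_mul φ hy).symm.trans (V.integrable_ker_mul φ h1)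
  have h2 := intervalIntegral.continuousOn_primitive_interval' hbi (a := 1) right_mem_uIcc
  have h3 : ContinuousWithinAt (fun b => (∫ s in V.base..1, V.ker s * extZero φ s) +
      ∫ s in (1 : ℝ)..b, V.ker s * extZero φ s) (Ioc (-1) 1) x := by
    refine continuousWithinAt_const.add ?_
    refine (h2 x ?_).mono_of_mem_nhdsWithin ?_
    · rw [uIcc_of_le hy.2]
      exact ⟨by linarith [hx.2, hx.1], hx.2⟩
    · rw [uIcc_of_le hy.2]
      have : Ioi ((x - 1) / 2) ∈ 𝓝 x := Ioi_mem_nhds (by linarith [hx.2, hx.1])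
      filter_upwards [mem_nhdsWithin_of_mem_nhds this, self_mem_nhdsWithin] with z hz hz'
      exact ⟨le_of_lt hz, hz'.2⟩
  refine h3.congr_of_mem (fun y hy' => ?_) hx
  exact (intervalIntegral.integral_add_adjacent_intervals (V.integrable_ker_mul φ h1)
    ((V.integrable_ker_mul φ h1).symm.trans (V.integrable_ker_mul φ hy'))).symm

theorem prim_add (hx : x ∈ Ioc (-1 : ℝ) 1) : V.prim (φ + ψ) x = V.prim φ x + V.prim ψ x := by
  unfold prim
  rw [← intervalIntegral.integral_add (V.integrable_ker_mul φ hx) (V.integrable_ker_mul ψ hx)]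
  simp only [extZero_add, mul_add]

theorem prim_smul (c : ℝ) : V.prim (c • φ) x = c * V.prim φ x := by
  unfold prim
  rw [← intervalIntegral.integral_const_mul]
  simp only [extZero_smul, mul_left_comm]

theorem prim_base : V.prim φ V.base = 0 := by
  simp [prim]

/-- The operator `φ ↦ out(x) ∫_base^x ker φ`. -/
def op : Cb →L[ℝ] Cb :=
  LinearMap.mkContinuous
    { toFun := fun φ => Cb.mk (fun x => V.out x * V.prim φ x) (V.bound * ‖φ‖)
        (V.out_cont.mul ((V.continuousOn_prim φ).mono Ioo_subset_Ioc_self))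
        fun x hx => V.abs_out_mul_prim_le φ hx
      map_add' := fun φ ψ => Cb.ext_on fun x hx => by
        rw [extZero_add, extZero_mk hx, extZero_mk hx, extZero_mk hx,
          V.prim_add φ ψ ⟨hx.1, hx.2.le⟩, mul_add]
      map_smul' := fun c φ => Cb.ext_on fun x hx => by
        rw [RingHom.id_apply, extZero_smul, extZero_mk hx, extZero_mk hx, V.prim_smul]
        ring }
    V.bound fun φ => Cb.norm_le
      ((abs_nonneg _).trans (V.abs_out_mul_prim_le φ (x := 0) (by norm_num))) fun x hx => by
        rw [LinearMap.coe_mk, AddHom.coe_mk, extZero_mk hx]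
        exact V.abs_out_mul_prim_le φ hx

theorem op_apply (hx : x ∈ Ioo (-1 : ℝ) 1) : extZero (V.op φ) x = V.out x * V.prim φ x := by
  rw [op, LinearMap.mkContinuous_apply, LinearMap.coe_mk, AddHom.coe_mk, extZero_mk hx]

end Volterra

/-! ### The logarithmic weight and powers of `1 + x` -/

/-- `2 - ln ((1 + x) / 2)`, which is at least `2` on `(-1, 1]`. -/
def lam (x : ℝ) : ℝ := 2 - Real.log ((1 + x) / 2)

theorem hasDerivAt_lam {x : ℝ} (hx : -1 < x) : HasDerivAt lam (-(1 / (1 + x))) x := by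
  have h1 : HasDerivAt (fun y : ℝ => (1 + y) / 2) (1 / 2) x :=
    ((hasDerivAt_id x).const_add 1).div_const 2
  have h0 : 0 < 1 + x := by linarith
  have h2 := (h1.log (by positivity)).const_sub 2
  refine h2.congr_deriv ?_
  field_simp

theorem two_le_lam {x : ℝ} (hx : x ∈ Ioc (-1 : ℝ) 1) : 2 ≤ lam x := by
  have : Real.log ((1 + x) / 2) ≤ 0 :=
    Real.log_nonpos (by linarith [hx.1]) (by linarith [hx.2])
  unfold lam; linarith

theorem lam_pos {x : ℝ} (hx : x ∈ Ioc (-1 : ℝ) 1) : 0 < lam x := by linarith [two_le_lam hx]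

theorem continuousOn_lam : ContinuousOn lam (Ioi (-1)) := fun _ hx =>
  (hasDerivAt_lam hx).continuousAt.continuousWithinAt

theorem lam_le_three {x : ℝ} (hx : 0 ≤ x) : lam x ≤ 3 := by
  have h1 : Real.log (1 / 2) ≤ Real.log ((1 + x) / 2) :=
    Real.log_le_log (by norm_num) (by linarith)
  have h2 : Real.log (1 / 2) = - Real.log 2 := by rw [one_div, Real.log_inv]
  have := Real.log_two_lt_d9
  unfold lam; linarith

/-- A positive power of `1 + x` beats every power of the logarithm. With `u = (1 + x) / 2`, the
identity `u^s lam^n = (u^(s/n) lam)^n` reduces the claim to a single logarithm. -/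
theorem exists_rpow_mul_lam_pow_le {s : ℝ} (hs : 0 < s) {n : ℕ} (hn : 0 < n) :
    ∃ C, ∀ x ∈ Ioo (-1 : ℝ) 1, |(1 + x) ^ s * lam x ^ n| ≤ C := by
  have ht : 0 < s / n := by positivity
  refine ⟨2 ^ s * (2 + 1 / (s / n)) ^ n, fun x hx => ?_⟩
  set u := (1 + x) / 2 with hu
  have hu0 : 0 < u := by rw [hu]; linarith [hx.1]
  have hu1 : u ≤ 1 := by rw [hu]; linarith [hx.2]
  have hl := lam_pos ⟨hx.1, hx.2.le⟩
  have h1 := (Real.abs_log_mul_self_rpow_lt u (s / n) hu0 hu1 ht).le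
  have h2 : 0 ≤ u ^ (s / n) * lam x := mul_nonneg (Real.rpow_nonneg hu0.le _) hl.le
  have h3 : u ^ (s / n) * lam x ≤ 2 + 1 / (s / n) := by
    have h4 : u ^ (s / n) ≤ 1 := Real.rpow_le_one hu0.le hu1 ht.le
    have h5 : lam x = 2 - Real.log u := rfl
    have := neg_abs_le (Real.log u * u ^ (s / n))
    rw [h5]; nlinarith
  have h6 : (1 + x) ^ s * lam x ^ n = 2 ^ s * (u ^ (s / n) * lam x) ^ n := by
    have h7 : (1 + x) = 2 * u := by rw [hu]; ring
    have hn' : (n : ℝ) ≠ 0 := by positivity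
    rw [mul_pow, ← Real.rpow_natCast (u ^ (s / n)), ← Real.rpow_mul hu0.le,
      div_mul_cancel₀ _ hn', h7, Real.mul_rpow (by norm_num) hu0.le]
    ring
  rw [h6, abs_of_nonneg (by positivity)]
  gcongr

theorem tendsto_lam_inv : Tendsto (fun x => (lam x)⁻¹) (𝓝[>] (-1)) (𝓝 0) := by
  refine tendsto_inv_atTop_zero.comp ?_
  have h1 : Tendsto (fun x : ℝ => (1 + x) / 2) (𝓝[>] (-1)) (𝓝[>] 0) := by
    refine tendsto_nhdsWithin_iff.2 ⟨?_, ?_⟩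
    · have : Tendsto (fun x : ℝ => (1 + x) / 2) (𝓝 (-1)) (𝓝 ((1 + -1) / 2)) :=
        (tendsto_const_nhds.add tendsto_id).div_const 2
      rw [show ((1 : ℝ) + -1) / 2 = 0 by norm_num] at this
      exact this.mono_left nhdsWithin_le_nhds
    · filter_upwards [self_mem_nhdsWithin] with x hx
      have : -1 < x := hx
      exact show 0 < (1 + x) / 2 by linarith
  have h2 := (tendsto_neg_atBot_atTop.comp (Real.tendsto_log_nhdsGT_zero.comp h1))
  exact (tendsto_const_nhds (x := (2 : ℝ))).add_atTop h2

/-- `lam` tends to infinity at `-1`, so a weighted bound is a boundary condition there; this feeds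
`eq_zero_of_hasDerivAt_zero`. -/
theorem tendsto_zero_of_lam_mul_bdd {d : ℝ → ℝ} {C : ℝ}
    (h : ∀ x ∈ Ioo (-1 : ℝ) 1, |lam x * d x| ≤ C) : Tendsto d (𝓝[>] (-1)) (𝓝 0) := by
  have h1 : Tendsto (fun x => C * (lam x)⁻¹) (𝓝[>] (-1)) (𝓝 0) := by
    simpa using tendsto_lam_inv.const_mul C
  refine squeeze_zero_norm' ?_ h1
  filter_upwards [Ioo_mem_nhdsGT (show (-1 : ℝ) < 1 by norm_num)] with y hy
  have hl := lam_pos ⟨hy.1, hy.2.le⟩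
  have := h y hy
  rw [abs_mul, abs_of_pos hl] at this
  rw [Real.norm_eq_abs, ← div_eq_mul_inv, le_div_iff₀ hl]
  linarith

theorem hasDerivAt_onePlus_rpow (r : ℝ) {x : ℝ} (hx : -1 < x) :
    HasDerivAt (fun y : ℝ => (1 + y) ^ r) (r * (1 + x) ^ (r - 1)) x := by
  have h := ((hasDerivAt_id x).const_add 1).rpow_const (p := r)
    (Or.inl (show 1 + x ≠ 0 by linarith))
  simpa using h

theorem continuousOn_onePlus_rpow (r : ℝ) :
    ContinuousOn (fun y : ℝ => (1 + y) ^ r) (Ioi (-1)) := fun _ hx =>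
  (hasDerivAt_onePlus_rpow r hx).continuousAt.continuousWithinAt

theorem onePlus_rpow_pos (r : ℝ) {x : ℝ} (hx : -1 < x) : 0 < (1 + x) ^ r :=
  Real.rpow_pos_of_pos (by linarith) r

theorem onePlus_rpow_le_two {r : ℝ} (hr : 0 ≤ r) (hr' : r ≤ 1) {x : ℝ} (hx : x ∈ Icc (-1 : ℝ) 1) :
    (1 + x) ^ r ≤ 2 :=
  calc (1 + x) ^ r ≤ 2 ^ r := Real.rpow_le_rpow (by linarith [hx.1]) (by linarith [hx.2]) hr
    _ ≤ 2 ^ (1 : ℝ) := Real.rpow_le_rpow_of_exponent_le (by norm_num) hr'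
    _ = 2 := Real.rpow_one 2

theorem Ioc_sub_Ioi : Ioc (-1 : ℝ) 1 ⊆ Ioi (-1) := fun _ h => h.1

theorem Ioo_sub_Ioi : Ioo (-1 : ℝ) 1 ⊆ Ioi (-1) := fun _ h => h.1

theorem uIcc_sub_Ioi {a x : ℝ} (ha : -1 < a) (hx : -1 < x) : uIcc a x ⊆ Ioi (-1) := by
  intro y hy
  exact (lt_min ha hx).trans_le hy.1

/-! ### The Volterra operators of the problem -/

/-- `lam^{-k}`, extended continuously to `-1`. -/
theorem continuousOn_lam_inv_ext {k : ℕ} (hk : k ≠ 0) :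
    ContinuousOn (fun x => if x ≤ -1 then 0 else ((lam x)⁻¹) ^ k) (Icc (-1) 1) := by
  intro x hx
  rcases hx.1.eq_or_lt with rfl | h
  · rw [← Ioc_insert_left (by norm_num : (-1 : ℝ) ≤ 1), continuousWithinAt_insert_self]
    have h1 : Tendsto (fun x => ((lam x)⁻¹) ^ k) (𝓝[Ioc (-1) 1] (-1)) (𝓝 0) := by
      have := (tendsto_lam_inv.pow k).mono_left (nhdsWithin_mono (-1) Ioc_sub_Ioi)
      rwa [zero_pow hk] at this
    unfold ContinuousWithinAt
    beta_reduce
    rw [if_pos le_rfl]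
    refine h1.congr' ?_
    filter_upwards [self_mem_nhdsWithin] with y hy
    rw [if_neg (not_le.2 hy.1)]
  · have h1 : ContinuousAt (fun x => ((lam x)⁻¹) ^ k) x :=
      ((hasDerivAt_lam h).continuousAt.inv₀ (lam_pos ⟨h, hx.2⟩).ne').pow k
    refine (h1.congr ?_).continuousWithinAt
    filter_upwards [Ioi_mem_nhds h] with y hy
    rw [if_neg (not_le.2 hy)]

theorem hasDerivAt_lam_inv_pow (k : ℕ) {x : ℝ} (hx : x ∈ Ioo (-1 : ℝ) 1) :
    HasDerivAt (fun x => ((lam x)⁻¹) ^ (k + 1))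
      ((k + 1) * ((1 + x) * lam x ^ (k + 2))⁻¹) x := by
  have hl := lam_pos ⟨hx.1, hx.2.le⟩
  have h0 : 0 < 1 + x := by linarith [hx.1]
  have h := ((hasDerivAt_lam hx.1).inv hl.ne').pow (k + 1)
  refine h.congr_deriv ?_
  push_cast
  field_simp
  rw [Pi.inv_apply, inv_pow]
  field_simp
  ring

theorem mem_zero : (0 : ℝ) ∈ Ioo (-1 : ℝ) 1 := by norm_num

/-- `φ ↦ lam^{k+1} ∫_{-1}^x φ / ((1+s) lam^{k+2})` -/
def volLam (k : ℕ) : Volterra :=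
  Volterra.ofMajorant (-1) (fun x => lam x ^ (k + 1)) (fun s => ((1 + s) * lam s ^ (k + 2))⁻¹) 1
    -- As `Real.log 0 = 0`, the value `lam (-1)` is `2`. The correct limit at `-1` is put in by hand
    -- so that the majorant is continuous up to the base.
    (fun x => if x ≤ -1 then 0 else ((lam x)⁻¹) ^ (k + 1))
    (fun x => (k + 1) * ((1 + x) * lam x ^ (k + 2))⁻¹)
    (by norm_num) ((continuousOn_lam.mono Ioo_sub_Ioi).pow _)
    (by
      refine ContinuousOn.inv₀ ((continuousOn_const.add continuousOn_id).mul
        ((continuousOn_lam.mono Ioo_sub_Ioi).pow _)) fun x hx => ?_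
      have hl := lam_pos ⟨hx.1, hx.2.le⟩
      have h0 : 0 < 1 + x := by linarith [hx.1]
      positivity)
    (fun x hx => by
      rw [uIcc_of_le hx.1.le]
      exact (continuousOn_lam_inv_ext k.succ_ne_zero).mono (Icc_subset_Icc_right hx.2))
    (fun x hx => by
      refine (hasDerivAt_lam_inv_pow k hx).congr_of_eventuallyEq ?_
      filter_upwards [Ioi_mem_nhds hx.1] with y hy
      rw [if_neg (not_le.2 hy)])
    (fun x hx => by
      have hl := lam_pos ⟨hx.1, hx.2.le⟩
      have h0 : 0 < 1 + x := by linarith [hx.1]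
      rw [abs_of_pos (by positivity)]
      exact le_mul_of_one_le_left (by positivity) (by linarith [(Nat.cast_nonneg k : (0 : ℝ) ≤ k)]))
    (fun x hx => by
      have hl := lam_pos ⟨hx.1, hx.2.le⟩
      rw [if_pos le_rfl, if_neg (not_le.2 hx.1), sub_zero, ← abs_mul, ← mul_pow,
        mul_inv_cancel₀ hl.ne']
      simp)

/-- `φ ↦ lam⁻¹ ∫_0^x φ / (1+s)` -/
def volLog : Volterra :=
  Volterra.ofMajorant 0 (fun x => (lam x)⁻¹) (fun s => 1 / (1 + s)) (5 / 2)
    (fun x => -lam x) (fun x => 1 / (1 + x)) (by norm_num)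
    ((continuousOn_lam.mono Ioo_sub_Ioi).inv₀ fun x hx => (lam_pos ⟨hx.1, hx.2.le⟩).ne')
    (continuousOn_const.div (continuousOn_const.add continuousOn_id) fun x hx => by
      have : -1 < x := hx.1
      linarith)
    (fun x hx => (continuousOn_lam.mono (uIcc_sub_Ioi (by norm_num) hx.1)).neg)
    (fun x hx => (hasDerivAt_lam hx.1).neg.congr_deriv (neg_neg _))
    (fun x hx => by
      have h0 : 0 < 1 + x := by linarith [hx.1]
      rw [abs_of_pos (by positivity)])
    (fun x hx => by
      have hl := two_le_lam ⟨hx.1, hx.2.le⟩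
      have hl0 := lam_le_three (le_refl 0)
      have hl0' := two_le_lam (x := 0) (by norm_num)
      rw [abs_inv, abs_of_pos (by linarith : 0 < lam x), inv_mul_le_iff₀ (by linarith)]
      refine abs_le.2 ⟨?_, ?_⟩ <;> linarith)

/-- `φ ↦ (1+x)^ε ∫_{x₀}^x (1+s)^{-ε-1} φ` -/
def volPow (x₀ ε : ℝ) (hx₀ : x₀ ∈ Icc (0 : ℝ) 1) (hε : 0 < ε) (hε' : ε ≤ 1) : Volterra :=
  Volterra.ofMajorant x₀ (fun x => (1 + x) ^ ε) (fun s => (1 + s) ^ (-ε - 1)) (3 / ε)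
    (fun x => -(1 + x) ^ (-ε) / ε) (fun x => (1 + x) ^ (-ε - 1)) ⟨by linarith [hx₀.1], hx₀.2⟩
    ((continuousOn_onePlus_rpow _).mono Ioo_sub_Ioi)
    ((continuousOn_onePlus_rpow _).mono Ioo_sub_Ioi)
    (fun x hx => (((continuousOn_onePlus_rpow _).mono
      (uIcc_sub_Ioi (by linarith [hx₀.1]) hx.1)).neg).div_const _)
    (fun x hx => by
      have h := ((hasDerivAt_onePlus_rpow (-ε) hx.1).neg).div_const ε
      refine h.congr_deriv ?_
      field_simp)
    (fun x hx => by rw [abs_of_pos (onePlus_rpow_pos _ hx.1)])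
    (fun x hx => by
      have h1 := onePlus_rpow_pos ε hx.1
      have h2 : (1 + x) ^ ε * (1 + x) ^ (-ε) = 1 := by
        rw [← Real.rpow_add (by linarith [hx.1])]; simp
      have h3 := onePlus_rpow_le_two hε.le hε' ⟨hx.1.le, hx.2.le⟩
      have h4 : (1 + x₀) ^ (-ε) ≤ 1 :=
        Real.rpow_le_one_of_one_le_of_nonpos (by linarith [hx₀.1]) (by linarith)
      have h5 := onePlus_rpow_pos (-ε) (x := x₀) (by linarith [hx₀.1])
      rw [abs_of_pos h1, show -(1 + x) ^ (-ε) / ε - -(1 + x₀) ^ (-ε) / ε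
        = ((1 + x₀) ^ (-ε) - (1 + x) ^ (-ε)) / ε by ring, abs_div, abs_of_pos hε, ← mul_div_assoc]
      refine div_le_div_of_nonneg_right ?_ hε.le
      rw [← abs_of_pos h1, ← abs_mul, mul_sub, h2]
      refine abs_le.2 ⟨?_, ?_⟩ <;> nlinarith)

/-- `φ ↦ (1+x)^ε lam⁻² ∫_0^x (1+s)^{-ε-1} lam² φ` -/
def volPowLam (ε : ℝ) (hε : 0 < ε) (hε' : ε ≤ 1) : Volterra :=
  Volterra.ofMajorant 0 (fun x => (1 + x) ^ ε * (lam x ^ 2)⁻¹)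
    (fun s => (1 + s) ^ (-ε - 1) * lam s ^ 2) (6 / ε)
    (fun x => -((1 + x) ^ (-ε) * lam x ^ 2) / ε)
    -- The second summand comes from differentiating `lam ^ 2`; it is positive, so it only helps the
    -- domination.
    (fun x => (1 + x) ^ (-ε - 1) * lam x ^ 2 + 2 / ε * ((1 + x) ^ (-ε) * lam x / (1 + x)))
    (by norm_num)
    (((continuousOn_onePlus_rpow _).mono Ioo_sub_Ioi).mul
      (((continuousOn_lam.mono Ioo_sub_Ioi).pow 2).inv₀ fun x hx =>
        (pow_pos (lam_pos ⟨hx.1, hx.2.le⟩) 2).ne'))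
    (((continuousOn_onePlus_rpow _).mono Ioo_sub_Ioi).mul
      ((continuousOn_lam.mono Ioo_sub_Ioi).pow 2))
    (fun x hx => by
      have := uIcc_sub_Ioi (a := 0) (by norm_num) hx.1
      exact ((((continuousOn_onePlus_rpow _).mono this).mul
        ((continuousOn_lam.mono this).pow 2)).neg).div_const _)
    (fun x hx => by
      have h0 : 0 < 1 + x := by linarith [hx.1]
      have h := (((hasDerivAt_onePlus_rpow (-ε) hx.1).mul
        ((hasDerivAt_lam hx.1).pow 2)).neg).div_const ε
      refine h.congr_deriv ?_
      simp only [Pi.pow_apply]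
      field_simp
      push_cast
      ring)
    (fun x hx => by
      have hl := lam_pos ⟨hx.1, hx.2.le⟩
      have h0 : 0 < 1 + x := by linarith [hx.1]
      rw [abs_of_pos (by positivity)]
      have : 0 ≤ 2 / ε * ((1 + x) ^ (-ε) * lam x / (1 + x)) := by positivity
      linarith)
    (fun x hx => by
      have hl := two_le_lam ⟨hx.1, hx.2.le⟩
      have hl0 := lam_le_three (le_refl 0)
      have hl0' := two_le_lam (x := 0) (by norm_num)
      have h0 : 0 < 1 + x := by linarith [hx.1]
      have h1 := onePlus_rpow_pos ε hx.1
      have h2 : (1 + x) ^ ε * (1 + x) ^ (-ε) = 1 := by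
        rw [← Real.rpow_add (by linarith [hx.1])]; simp
      have h3 := onePlus_rpow_le_two hε.le hε' ⟨hx.1.le, hx.2.le⟩
      have h6 : 0 < lam x ^ 2 := by positivity
      have h7 : lam 0 ^ 2 ≤ 9 := by nlinarith
      have h8 : 4 ≤ lam x ^ 2 := by nlinarith
      rw [abs_of_pos (by positivity), add_zero, Real.one_rpow, one_mul,
        show -((1 + x) ^ (-ε) * lam x ^ 2) / ε - -lam 0 ^ 2 / ε
          = (lam 0 ^ 2 - (1 + x) ^ (-ε) * lam x ^ 2) / ε by ring, abs_div, abs_of_pos hε,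
        ← mul_div_assoc]
      refine div_le_div_of_nonneg_right ?_ hε.le
      rw [mul_comm ((1 + x) ^ ε), mul_assoc, inv_mul_le_iff₀ h6, ← abs_of_pos h1, ← abs_mul,
        mul_sub, ← mul_assoc, h2, one_mul]
      refine abs_le.2 ⟨?_, ?_⟩ <;> nlinarith [sq_nonneg (lam 0)])

/-- `σ ↦ (1+x)^{1+r} (1-x)⁻¹ ∫_1^x 2 (1+s)^{-r-2} σ` -/
def volSwirlOne (r : ℝ) (hr : 0 < r) : Volterra :=
  Volterra.ofMajorant 1 (fun x => (1 + x) ^ (1 + r) * (1 - x)⁻¹)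
    (fun s => 2 * (1 + s) ^ (-(1 + r) - 1)) 1
    -- This `G` vanishes at the base `1` and is exactly the negative reciprocal of the outer weight,
    -- hence the bound `1`. Each of the three swirl integrations gains one factor `1 - x` in this
    -- way.
    (fun x => -((1 - x) * (1 + x) ^ (-(1 + r))))
    (fun x => (1 + x) ^ (-(1 + r)) + (1 - x) * ((1 + r) * (1 + x) ^ (-(1 + r) - 1)))
    (by norm_num)
    (((continuousOn_onePlus_rpow _).mono Ioo_sub_Ioi).mul
      ((continuousOn_const.sub continuousOn_id).inv₀ fun x hx => by
        have : 0 < 1 - x := by linarith [hx.2]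
        exact this.ne'))
    (continuousOn_const.mul ((continuousOn_onePlus_rpow _).mono Ioo_sub_Ioi))
    (fun x hx => (((continuousOn_const.sub continuousOn_id).mul
      ((continuousOn_onePlus_rpow _).mono (uIcc_sub_Ioi (by norm_num) hx.1))).neg))
    (fun x hx => by
      have h := (((hasDerivAt_id x).const_sub 1).mul (hasDerivAt_onePlus_rpow (-(1 + r)) hx.1)).neg
      refine h.congr_deriv ?_
      simp only [id]
      ring)
    (fun x hx => by
      have h0 : 0 < 1 + x := by linarith [hx.1]
      have h1 := onePlus_rpow_pos (-(1 + r) - 1) hx.1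
      have h2 : (1 + x) ^ (-(1 + r)) = (1 + x) ^ (-(1 + r) - 1) * (1 + x) := by
        rw [← Real.rpow_add_one h0.ne']; ring_nf
      rw [abs_of_pos (by positivity), h2]
      -- The identity `(1 + x) + (1 - x) = 2` accounts for the factor `2` of the kernel; what is
      -- left over is this term.
      have : 0 ≤ r * (1 - x) * (1 + x) ^ (-(1 + r) - 1) :=
        mul_nonneg (mul_nonneg hr.le (by linarith [hx.2])) h1.le
      nlinarith)
    (fun x hx => by
      have h0 : 0 < 1 + x := by linarith [hx.1]
      have h1 : 0 < 1 - x := by linarith [hx.2]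
      have h2 : (1 + x) ^ (1 + r) * (1 + x) ^ (-(1 + r)) = 1 := by
        rw [← Real.rpow_add h0]; simp
      rw [← abs_mul]
      have : (1 + x) ^ (1 + r) * (1 - x)⁻¹ *
          (-((1 - x) * (1 + x) ^ (-(1 + r))) - -((1 - 1) * (1 + 1) ^ (-(1 + r)))) = -1 := by
        rw [sub_self, zero_mul, neg_zero, sub_zero]
        field_simp
        rw [h2]
      rw [this]; simp)

/-- `σ ↦ (1+x)^r (1-x)⁻² ∫_1^x (1+s)^{-r-1} (1-s) σ` -/
def volSwirlTwo (r : ℝ) (hr : 0 < r) (hr' : r < 1) : Volterra :=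
  Volterra.ofMajorant 1 (fun x => (1 + x) ^ r * ((1 - x) ^ 2)⁻¹)
    (fun s => (1 + s) ^ (-r - 1) * (1 - s)) (1 / (2 * r))
    (fun x => -((1 - x) ^ 2 * (1 + x) ^ (-r)) / (2 * r))
    (fun x => (2 * (1 - x) * (1 + x) ^ (-r) + (1 - x) ^ 2 * (r * (1 + x) ^ (-r - 1))) / (2 * r))
    (by norm_num)
    (((continuousOn_onePlus_rpow _).mono Ioo_sub_Ioi).mul
      (((continuousOn_const.sub continuousOn_id).pow 2).inv₀ fun x hx => by
        have : 0 < 1 - x := by linarith [hx.2]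
        exact (pow_pos this 2).ne'))
    (((continuousOn_onePlus_rpow _).mono Ioo_sub_Ioi).mul
      (continuousOn_const.sub continuousOn_id))
    (fun x hx => ((((continuousOn_const.sub continuousOn_id).pow 2).mul
      ((continuousOn_onePlus_rpow _).mono (uIcc_sub_Ioi (by norm_num) hx.1))).neg).div_const _)
    (fun x hx => by
      have h := ((((hasDerivAt_id x).const_sub 1).pow 2).mul
        (hasDerivAt_onePlus_rpow (-r) hx.1)).neg.div_const (2 * r)
      refine h.congr_deriv ?_
      simp only [Pi.pow_apply, id]
      push_cast
      ring)
    (fun x hx => by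
      have h0 : 0 < 1 + x := by linarith [hx.1]
      have h3 : 0 < 1 - x := by linarith [hx.2]
      have h1 := onePlus_rpow_pos (-r - 1) hx.1
      have h2 : (1 + x) ^ (-r) = (1 + x) ^ (-r - 1) * (1 + x) := by
        rw [← Real.rpow_add_one h0.ne']; ring_nf
      rw [abs_of_pos (by positivity), h2, le_div_iff₀ (by positivity)]
      -- Without the common factors the domination reads `2 (1 + x) + r (1 - x) ≥ 2 r`, and the gap
      -- is `(2 - r) (1 + x)`.
      have : 0 ≤ (1 + x) ^ (-r - 1) * (1 - x) * ((2 - r) * (1 + x)) :=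
        mul_nonneg (by positivity) (mul_nonneg (by linarith) h0.le)
      nlinarith)
    (fun x hx => by
      have h0 : 0 < 1 + x := by linarith [hx.1]
      have h1 : 0 < 1 - x := by linarith [hx.2]
      have h2 : (1 + x) ^ r * (1 + x) ^ (-r) = 1 := by
        rw [← Real.rpow_add h0]; simp
      rw [← abs_mul]
      have : (1 + x) ^ r * ((1 - x) ^ 2)⁻¹ * (-((1 - x) ^ 2 * (1 + x) ^ (-r)) / (2 * r)
          - -((1 - 1) ^ 2 * (1 + 1) ^ (-r)) / (2 * r)) = -(1 / (2 * r)) := by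
        rw [sub_self]
        field_simp
        linear_combination -(1 - x) ^ 2 * h2
      rw [this, abs_neg, abs_of_pos (by positivity)])

/-- `σ ↦ (1-x)⁻³ ∫_1^x (1+s)^{-r} (1-s)² σ` -/
def volSwirlThree (r : ℝ) (hr : 0 < r) (hr' : r < 1) : Volterra :=
  Volterra.ofMajorant 1 (fun x => ((1 - x) ^ 3)⁻¹)
    (fun s => (1 + s) ^ (-r) * (1 - s) ^ 2) (3 / (1 - r))
    -- The factor `3 - (1 + x)^(1 - r)` stays between `1` and `3`, and its derivative supplies the
    -- singularity `(1 + x)^(-r)`, integrable because `r < 1`.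
    (fun x => -((1 - x) ^ 3 * (3 - (1 + x) ^ (1 - r))) / (1 - r))
    (fun x => (3 * (1 - x) ^ 2 * (3 - (1 + x) ^ (1 - r))
      + (1 - x) ^ 3 * ((1 - r) * (1 + x) ^ (-r))) / (1 - r))
    (by norm_num)
    (((continuousOn_const.sub continuousOn_id).pow 3).inv₀ fun x hx => by
        have : 0 < 1 - x := by linarith [hx.2]
        exact (pow_pos this 3).ne')
    (((continuousOn_onePlus_rpow _).mono Ioo_sub_Ioi).mul
      ((continuousOn_const.sub continuousOn_id).pow 2))
    (fun x hx => ((((continuousOn_const.sub continuousOn_id).pow 3).mul (continuousOn_const.sub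
      ((continuousOn_onePlus_rpow _).mono (uIcc_sub_Ioi (by norm_num) hx.1)))).neg).div_const _)
    (fun x hx => by
      have h := ((((hasDerivAt_id x).const_sub 1).pow 3).mul
        ((hasDerivAt_onePlus_rpow (1 - r) hx.1).const_sub 3)).neg.div_const (1 - r)
      refine h.congr_deriv ?_
      simp only [Pi.pow_apply, id]
      rw [show (1 - r - 1) = -r by ring]
      push_cast
      ring)
    (fun x hx => by
      have h0 : 0 < 1 + x := by linarith [hx.1]
      have h3 : 0 < 1 - x := by linarith [hx.2]
      have h1 := onePlus_rpow_pos (-r) hx.1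
      have h2 : (1 + x) ^ (1 - r) = (1 + x) ^ (-r) * (1 + x) := by
        rw [← Real.rpow_add_one h0.ne']; ring_nf
      have h4 := onePlus_rpow_le_two (r := 1 - r) (by linarith) (by linarith) ⟨hx.1.le, hx.2.le⟩
      rw [abs_of_pos (by positivity), le_div_iff₀ (by linarith)]
      -- The singular term of the majorant falls short of the kernel by `x (1 - x)² (1 + x)^(-r)`.
      -- For `x > 0` the regular term makes up for it.
      have h5 : x * (1 - r) * (1 + x) ^ (-r) ≤ 3 * (3 - (1 + x) ^ (1 - r)) := by
        rcases le_total x 0 with hx0 | hx0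
        · have : x * (1 - r) * (1 + x) ^ (-r) ≤ 0 :=
            mul_nonpos_of_nonpos_of_nonneg (mul_nonpos_of_nonpos_of_nonneg hx0 (by linarith)) h1.le
          linarith
        · have h6 : (1 + x) ^ (-r) ≤ 1 :=
            Real.rpow_le_one_of_one_le_of_nonpos (by linarith) (by linarith)
          have h7 : x * (1 - r) ≤ 1 := by nlinarith [hx.2]
          have h8 : 0 ≤ x * (1 - r) := mul_nonneg hx0 (by linarith)
          nlinarith
      nlinarith [mul_le_mul_of_nonneg_left h5 (sq_nonneg (1 - x))])
    (fun x hx => by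
      have h0 : 0 < 1 + x := by linarith [hx.1]
      have h1 : 0 < 1 - x := by linarith [hx.2]
      have h4 := onePlus_rpow_le_two (r := 1 - r) (by linarith) (by linarith) ⟨hx.1.le, hx.2.le⟩
      have h5 := onePlus_rpow_pos (1 - r) hx.1
      rw [← abs_mul]
      have : ((1 - x) ^ 3)⁻¹ * (-((1 - x) ^ 3 * (3 - (1 + x) ^ (1 - r))) / (1 - r)
          - -((1 - 1) ^ 3 * (3 - (1 + 1) ^ (1 - r))) / (1 - r))
          = -((3 - (1 + x) ^ (1 - r)) / (1 - r)) := by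
        field_simp; ring
      rw [this, abs_neg, abs_div, abs_of_pos (by linarith : 0 < 1 - r)]
      refine div_le_div_of_nonneg_right ?_ (by linarith)
      refine abs_le.2 ⟨?_, ?_⟩ <;> linarith)

/-! ### Bounds for elements of `M₁` and `M₂` -/

theorem hasDerivAt_deriv_of_contDiffOn_two {s : Set ℝ} (hs : IsOpen s) {f : ℝ → ℝ}
    (h : ContDiffOn ℝ 2 f s) {x : ℝ} (hx : x ∈ s) : HasDerivAt (deriv f) (deriv (deriv f) x) x := by
  rw [show (2 : WithTop ℕ∞) = 1 + 1 by norm_num, contDiffOn_succ_iff_deriv_of_isOpen hs] at h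
  exact ((h.2.2.differentiableOn one_ne_zero x hx).differentiableAt (hs.mem_nhds hx)).hasDerivAt

theorem one_third_le_neg_wtLog {x : ℝ} (hx : x ∈ Ioo (-1 : ℝ) 1) : 1 / 3 ≤ -wtLog x := by
  have h0 : 0 < (1 + x) / 3 := by linarith [hx.1]
  have h1 : Real.log ((1 + x) / 3) ≤ (1 + x) / 3 - 1 := Real.log_le_sub_one_of_pos h0
  unfold wtLog
  linarith [hx.2]

theorem lam_eq_sub_wtLog {x : ℝ} (hx : x ∈ Ioo (-1 : ℝ) 1) :
    lam x = 2 + Real.log 2 - Real.log 3 - wtLog x := by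
  have h0 : (1 + x) ≠ 0 := by linarith [hx.1]
  unfold lam wtLog
  rw [Real.log_div h0 (by norm_num), Real.log_div h0 (by norm_num)]
  ring

/-- The two logarithmic weights differ by a constant less than `2`, and `|wtLog| ≥ 1/3`, whence `1 +
2 · 3 = 7`. Together with `wtLog_le_lam` this lets `lam` replace the weight of `M₁` throughout. -/
theorem lam_le_wtLog {x : ℝ} (hx : x ∈ Ioo (-1 : ℝ) 1) : lam x ≤ 7 * |wtLog x| := by
  have h1 := one_third_le_neg_wtLog hx
  have h2 : Real.log 2 ≤ Real.log 3 := Real.log_le_log (by norm_num) (by norm_num)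
  rw [lam_eq_sub_wtLog hx, abs_of_neg (by linarith)]
  linarith

theorem wtLog_le_lam {x : ℝ} (hx : x ∈ Ioo (-1 : ℝ) 1) : |wtLog x| ≤ lam x := by
  have h1 := one_third_le_neg_wtLog hx
  have h2 : Real.log (3 / 2) ≤ 3 / 2 - 1 := Real.log_le_sub_one_of_pos (by norm_num)
  rw [Real.log_div (by norm_num) (by norm_num)] at h2
  rw [lam_eq_sub_wtLog hx, abs_of_neg (by linarith)]
  linarith

theorem onePlus_mul_lam_le {x : ℝ} (hx : x ∈ Ioo (-1 : ℝ) 1) : (1 + x) * lam x ≤ 4 := by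
  have h0 : 0 < (1 + x) / 2 := by linarith [hx.1]
  have h1 := Real.one_sub_inv_le_log_of_pos h0
  have h2 : (1 + x) / 2 * (1 - ((1 + x) / 2)⁻¹) ≤ (1 + x) / 2 * Real.log ((1 + x) / 2) :=
    mul_le_mul_of_nonneg_left h1 h0.le
  rw [mul_sub, mul_inv_cancel₀ h0.ne'] at h2
  unfold lam
  nlinarith [hx.2]

section MemM₁

variable {f : ℝ → ℝ} {x : ℝ}

theorem MemM₁.hasDerivAt (h : MemM₁ f) (hx : x ∈ Ioo (-1 : ℝ) 1) : HasDerivAt f (deriv f x) x :=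
  ((h.at₁ x hx).differentiableAt (by norm_num)).hasDerivAt

theorem MemM₁.continuousOn_deriv (h : MemM₁ f) : ContinuousOn (deriv f) (Ioo (-1) 1) :=
  (h.smooth₁.mono Ioo_subset_Ioc_self).continuousOn_deriv_of_isOpen isOpen_Ioo (by norm_num)

theorem MemM₁.continuousOn (h : MemM₁ f) : ContinuousOn f (Ioo (-1) 1) :=
  h.cont.mono Ioo_subset_Icc_self

theorem MemM₁.abs_lam_mul_le (h : MemM₁ f) (hx : x ∈ Ioo (-1 : ℝ) 1) :
    lam x * |f x| ≤ 7 * normM₁ f := by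
  have h1 := le_wsup h.bdd₀ hx
  rw [iteratedDeriv_zero, abs_mul] at h1
  have a1 := wsup_nonneg (w := wtLogSq) (k := 1) (s := Ioo (-1) 1) (f := f)
  have a2 := wsup_nonneg (w := 1) (k := 2) (s := Ioo 0 1) (f := f)
  have h2 := mul_le_mul_of_nonneg_right (lam_le_wtLog hx) (abs_nonneg (f x))
  unfold normM₁
  nlinarith

theorem MemM₁.abs_deriv_le (h : MemM₁ f) (hx : x ∈ Ioo (-1 : ℝ) 1) :
    (1 + x) * lam x ^ 2 * |deriv f x| ≤ 49 * normM₁ f := by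
  have h0 : 0 < 1 + x := by linarith [hx.1]
  have h1 := le_wsup h.bdd₁ hx
  rw [iteratedDeriv_one, abs_mul, wtLogSq, abs_of_nonneg (by positivity)] at h1
  have a1 := wsup_nonneg (w := wtLog) (k := 0) (s := Ioo (-1) 1) (f := f)
  have a2 := wsup_nonneg (w := 1) (k := 2) (s := Ioo 0 1) (f := f)
  have h3 : lam x ^ 2 ≤ 49 * Real.log ((1 + x) / 3) ^ 2 := by
    have := pow_le_pow_left₀ (lam_pos ⟨hx.1, hx.2.le⟩).le (lam_le_wtLog hx) 2
    rw [mul_pow, sq_abs] at this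
    unfold wtLog at this
    linarith
  have h2 : (1 + x) * lam x ^ 2 * |deriv f x|
      ≤ (1 + x) * (49 * Real.log ((1 + x) / 3) ^ 2) * |deriv f x| := by gcongr
  unfold normM₁
  nlinarith

theorem MemM₁.abs_deriv_deriv_le (h : MemM₁ f) (hx : x ∈ Ioo (0 : ℝ) 1) :
    |deriv (deriv f) x| ≤ normM₁ f := by
  have h1 := le_wsup h.bdd₂ hx
  rw [iteratedDeriv_succ, iteratedDeriv_one, Pi.one_apply, one_mul] at h1
  have a1 := wsup_nonneg (w := wtLogSq) (k := 1) (s := Ioo (-1) 1) (f := f)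
  have a2 := wsup_nonneg (w := wtLog) (k := 0) (s := Ioo (-1) 1) (f := f)
  unfold normM₁
  linarith

theorem MemM₁.abs_deriv_le_right (h : MemM₁ f) (hx : x ∈ Ioo (-1 : ℝ) 1) (hx0 : 0 ≤ x) :
    |deriv f x| ≤ 13 * normM₁ f := by
  have h1 := h.abs_deriv_le hx
  -- On the right half the weight is at least `2 ^ 2`; the constant `49 / 4` is rounded up to `13`.
  have h2 : 4 ≤ (1 + x) * lam x ^ 2 := by nlinarith [two_le_lam ⟨hx.1, hx.2.le⟩]
  nlinarith [mul_le_mul_of_nonneg_right h2 (abs_nonneg (deriv f x)), normM₁_nonneg f]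

theorem MemM₁.abs_le_right (h : MemM₁ f) (hx : x ∈ Ioo (-1 : ℝ) 1) (hx0 : 0 ≤ x) :
    |f x| ≤ 13 * normM₁ f * (1 - x) := by
  obtain ⟨y, hy, hy'⟩ := exists_hasDerivAt_eq_slope f (deriv f) hx.2
    (h.cont.mono (Icc_subset_Icc_left hx.1.le)) fun y hy => h.hasDerivAt ⟨hx.1.trans hy.1, hy.2⟩
  have h1 : 0 < 1 - x := by linarith [hx.2]
  rw [h.right, eq_div_iff h1.ne'] at hy'
  have h2 := h.abs_deriv_le_right ⟨hx.1.trans hy.1, hy.2⟩ (hx0.trans hy.1.le)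
  have h3 : f x = -(deriv f y * (1 - x)) := by linarith
  rw [h3, abs_neg, abs_mul, abs_of_pos h1]
  gcongr

/-- The numerator of `(f / (1 - x))'` has derivative `(1 - x) f''` and tends to `0` at `1`, so it
vanishes to second order there. As `f''` is only controlled inside `(0, 1)`, the mean value theorem
is applied on `[x, y]` and then `y → 1`. -/
theorem MemM₁.abs_deriv_quot_le (h : MemM₁ f) (hx : x ∈ Ioo (0 : ℝ) 1) :
    |(1 - x) * deriv f x + f x| ≤ normM₁ f * (1 - x) ^ 2 := by
  have hN := normM₁_nonneg f
  have hsub : ∀ y ∈ Ioo (0 : ℝ) 1, y ∈ Ioo (-1 : ℝ) 1 := fun y hy => ⟨by linarith [hy.1], hy.2⟩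
  have hg : ∀ y ∈ Ioo (0 : ℝ) 1, HasDerivAt (fun y => (1 - y) * deriv f y + f y)
      ((1 - y) * deriv (deriv f) y) y := by
    intro y hy
    have h1 := (((hasDerivAt_id y).const_sub 1).mul
      (hasDerivAt_deriv_of_contDiffOn_two isOpen_Ioo h.smooth₂ hy)).add (h.hasDerivAt (hsub y hy))
    refine h1.congr_deriv ?_
    simp only [id]
    ring
  have key : ∀ y ∈ Ioo x 1, |(1 - x) * deriv f x + f x|
      ≤ normM₁ f * (1 - x) ^ 2 + 26 * normM₁ f * (1 - y) := by
    intro y hy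
    have hy' : y ∈ Ioo (0 : ℝ) 1 := ⟨hx.1.trans hy.1, hy.2⟩
    obtain ⟨z, hz, hz'⟩ := exists_hasDerivAt_eq_slope (fun y => (1 - y) * deriv f y + f y)
      (fun y => (1 - y) * deriv (deriv f) y) hy.1
      (fun z hz => (hg z ⟨hx.1.trans_le hz.1, hz.2.trans_lt hy.2⟩).continuousAt.continuousWithinAt)
      fun z hz => hg z ⟨hx.1.trans hz.1, hz.2.trans hy.2⟩
    have h1 : 0 < y - x := by linarith [hy.1]
    have h2 : 0 < 1 - z := by linarith [hz.2, hy.2]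
    have h3 : 0 < 1 - y := by linarith [hy.2]
    rw [eq_div_iff h1.ne'] at hz'
    have h4 := h.abs_deriv_deriv_le (x := z) ⟨hx.1.trans hz.1, hz.2.trans hy.2⟩
    have h5 : |(1 - z) * deriv (deriv f) z * (y - x)| ≤ normM₁ f * (1 - x) ^ 2 := by
      rw [abs_mul, abs_mul, abs_of_pos h1, abs_of_pos h2]
      calc (1 - z) * |deriv (deriv f) z| * (y - x) ≤ (1 - x) * normM₁ f * (1 - x) := by
            have := hz.1
            have := hy.2
            have h0 : 0 ≤ 1 - x := by linarith
            have := mul_nonneg h0 hN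
            gcongr
        _ = _ := by ring
    have h6 : |(1 - y) * deriv f y| ≤ 13 * normM₁ f * (1 - y) := by
      rw [abs_mul, abs_of_pos h3, mul_comm]
      gcongr
      exact h.abs_deriv_le_right (hsub y hy') hy'.1.le
    have h7 := h.abs_le_right (hsub y hy') hy'.1.le
    have h8 : (1 - x) * deriv f x + f x
        = (1 - y) * deriv f y + f y - (1 - z) * deriv (deriv f) z * (y - x) := by linarith
    rw [h8]
    have h9 := abs_sub ((1 - y) * deriv f y + f y) ((1 - z) * deriv (deriv f) z * (y - x))
    have h10 := abs_add_le ((1 - y) * deriv f y) (f y)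
    linarith
  have hlim : Tendsto (fun y => normM₁ f * (1 - x) ^ 2 + 26 * normM₁ f * (1 - y)) (𝓝[<] 1)
      (𝓝 (normM₁ f * (1 - x) ^ 2)) := by
    have : Tendsto (fun y => normM₁ f * (1 - x) ^ 2 + 26 * normM₁ f * (1 - y)) (𝓝 1)
        (𝓝 (normM₁ f * (1 - x) ^ 2 + 26 * normM₁ f * (1 - 1))) :=
      (by fun_prop : Continuous fun y =>
        normM₁ f * (1 - x) ^ 2 + 26 * normM₁ f * (1 - y)).tendsto 1
    rw [sub_self, mul_zero, add_zero] at this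
    exact this.mono_left nhdsWithin_le_nhds
  refine ge_of_tendsto hlim ?_
  filter_upwards [Ioo_mem_nhdsLT hx.2] with y hy using key y hy

/-- On the right half the zero of `f` at `1` pays for the denominator, with constant `3 · 13`; on
the left half `1 - x ≥ 1`. -/
theorem MemM₁.abs_quot_le (h : MemM₁ f) (hx : x ∈ Ioo (-1 : ℝ) 1) :
    |lam x * (f x / (1 - x))| ≤ 39 * normM₁ f := by
  have h1 : 0 < 1 - x := by linarith [hx.2]
  have hl := lam_pos ⟨hx.1, hx.2.le⟩
  have hN := normM₁_nonneg f
  rw [abs_mul, abs_div, abs_of_pos h1, abs_of_pos hl, ← mul_div_assoc, div_le_iff₀ h1]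
  rcases le_total x 0 with hx0 | hx0
  · have := h.abs_lam_mul_le hx
    nlinarith
  · calc lam x * |f x| ≤ 3 * (13 * normM₁ f * (1 - x)) := by
          gcongr
          · exact lam_le_three hx0
          · exact h.abs_le_right hx hx0
      _ = _ := by ring

/-- On the left half the two terms of the numerator contribute `49` and `4 · 7`. On the right half
the denominator is absorbed by `abs_deriv_quot_le`; this is what the bound on `f''` in the norm of
`M₁` is for. -/
theorem MemM₁.abs_quot_deriv_le (h : MemM₁ f) (hx : x ∈ Ioo (-1 : ℝ) 1) :
    |(1 + x) * lam x ^ 2 * (((1 - x) * deriv f x + f x) / (1 - x) ^ 2)| ≤ 77 * normM₁ f := by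
  have h1 : 0 < 1 - x := by linarith [hx.2]
  have h0 : 0 < 1 + x := by linarith [hx.1]
  have hl := lam_pos ⟨hx.1, hx.2.le⟩
  have hN := normM₁_nonneg f
  have hw : 0 < (1 + x) * lam x ^ 2 := by positivity
  rw [abs_mul, abs_div, abs_of_pos hw, abs_of_pos (pow_pos h1 2), ← mul_div_assoc,
    div_le_iff₀ (pow_pos h1 2)]
  rcases le_or_gt x 0 with hx0 | hx0
  · have h2 := h.abs_lam_mul_le hx
    have h3 := h.abs_deriv_le hx
    have h4 := onePlus_mul_lam_le hx
    have h5 : |(1 - x) * deriv f x + f x| ≤ (1 - x) * |deriv f x| + |f x| := by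
      have := abs_add_le ((1 - x) * deriv f x) (f x)
      rwa [abs_mul, abs_of_pos h1] at this
    have h6 : (1 + x) * lam x * (lam x * |f x|) ≤ 4 * (7 * normM₁ f) := by gcongr
    have h7 : (1 - x) * ((1 + x) * lam x ^ 2 * |deriv f x|) ≤ (1 - x) * (49 * normM₁ f) := by
      gcongr
    calc (1 + x) * lam x ^ 2 * |(1 - x) * deriv f x + f x|
        ≤ (1 + x) * lam x ^ 2 * ((1 - x) * |deriv f x| + |f x|) := by gcongr
      _ ≤ (1 - x) * (49 * normM₁ f) + 28 * normM₁ f := by linarith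
      _ ≤ 77 * normM₁ f * (1 - x) ^ 2 := by
          have : 1 - x ≤ (1 - x) ^ 2 := by nlinarith
          have : 1 ≤ (1 - x) ^ 2 := by nlinarith
          nlinarith
  · have h2 := h.abs_deriv_quot_le ⟨hx0, hx.2⟩
    have h3 : (1 + x) * lam x ^ 2 ≤ 2 * 3 ^ 2 := by
      gcongr
      · linarith [hx.2]
      · exact lam_le_three hx0.le
    calc (1 + x) * lam x ^ 2 * |(1 - x) * deriv f x + f x|
        ≤ (2 * 3 ^ 2) * (normM₁ f * (1 - x) ^ 2) := by gcongr
      _ ≤ 77 * normM₁ f * (1 - x) ^ 2 := by nlinarith [mul_nonneg hN (sq_nonneg (1 - x))]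

end MemM₁

section MemM₂

variable {ε : ℝ} {f : ℝ → ℝ} {x : ℝ}

theorem MemM₂.hasDerivAt (h : MemM₂ ε f) (hx : x ∈ Ioo (-1 : ℝ) 1) : HasDerivAt f (deriv f x) x :=
  ((h.at₁ x hx).differentiableAt (by norm_num)).hasDerivAt

theorem MemM₂.continuousOn_deriv (h : MemM₂ ε f) : ContinuousOn (deriv f) (Ioo (-1) 1) :=
  (h.smooth₁.mono Ioo_subset_Ioc_self).continuousOn_deriv_of_isOpen isOpen_Ioo (by norm_num)

theorem MemM₂.continuousOn (h : MemM₂ ε f) : ContinuousOn f (Ioo (-1) 1) :=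
  (h.smooth₁.continuousOn).mono Ioo_subset_Ioc_self

theorem MemM₂.abs_le (h : MemM₂ ε f) (hx : x ∈ Ioo (-1 : ℝ) 1) :
    (1 + x) ^ ε * |f x| ≤ normM₂ ε f := by
  have h1 := le_wsup h.bdd₀ hx
  rw [iteratedDeriv_zero, abs_mul, wpow, abs_of_pos (onePlus_rpow_pos ε hx.1)] at h1
  have a1 := wsup_nonneg (w := wpow (1 + ε)) (k := 1) (s := Ioo (-1) 1) (f := f)
  have a2 := wsup_nonneg (w := wpow (2 + ε)) (k := 2) (s := Ioo (-1) 1) (f := f)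
  unfold normM₂
  linarith

theorem MemM₂.abs_deriv_le (h : MemM₂ ε f) (hx : x ∈ Ioo (-1 : ℝ) 1) :
    |(1 + x) ^ (1 + ε) * deriv f x| ≤ normM₂ ε f := by
  have h1 := le_wsup h.bdd₁ hx
  rw [iteratedDeriv_one, wpow] at h1
  have a1 := wsup_nonneg (w := wpow ε) (k := 0) (s := Ioo (-1) 1) (f := f)
  have a2 := wsup_nonneg (w := wpow (2 + ε)) (k := 2) (s := Ioo (-1) 1) (f := f)
  unfold normM₂
  linarith

theorem MemM₂.abs_le_right (h : MemM₂ ε f) (hε : 0 ≤ ε) (hx : x ∈ Ioo (-1 : ℝ) 1) (hx0 : 0 ≤ x) :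
    |f x| ≤ normM₂ ε f * (1 - x) := by
  obtain ⟨y, hy, hy'⟩ := exists_hasDerivAt_eq_slope f (deriv f) hx.2
    (h.smooth₁.continuousOn.mono fun y hy => ⟨hx.1.trans_le hy.1, hy.2⟩)
    fun y hy => h.hasDerivAt ⟨hx.1.trans hy.1, hy.2⟩
  have h1 : 0 < 1 - x := by linarith [hx.2]
  rw [h.right, eq_div_iff h1.ne'] at hy'
  have h2 := h.abs_deriv_le (x := y) ⟨hx.1.trans hy.1, hy.2⟩
  have h4 : 1 ≤ (1 + y) ^ (1 + ε) := Real.one_le_rpow (by linarith [hy.1]) (by linarith)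
  rw [abs_mul, abs_of_pos (by linarith)] at h2
  have h5 : |deriv f y| ≤ normM₂ ε f := by nlinarith [abs_nonneg (deriv f y)]
  have h3 : f x = -(deriv f y * (1 - x)) := by linarith
  rw [h3, abs_neg, abs_mul, abs_of_pos h1]
  gcongr

theorem MemM₂.abs_quot_le (h : MemM₂ ε f) (hε : 0 ≤ ε) (hε' : ε ≤ 1)
    (hx : x ∈ Ioo (-1 : ℝ) 1) : |(1 + x) ^ ε * (f x / (1 - x))| ≤ 2 * normM₂ ε f := by
  have h1 : 0 < 1 - x := by linarith [hx.2]
  have hN := normM₂_nonneg ε f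
  rw [abs_mul, abs_div, abs_of_pos h1, abs_of_pos (onePlus_rpow_pos ε hx.1), ← mul_div_assoc,
    div_le_iff₀ h1]
  rcases le_total x 0 with hx0 | hx0
  · have := h.abs_le hx
    nlinarith
  · calc (1 + x) ^ ε * |f x| ≤ 2 * (normM₂ ε f * (1 - x)) := by
          gcongr
          · exact onePlus_rpow_le_two hε hε' ⟨hx.1.le, hx.2.le⟩
          · exact h.abs_le_right hε hx hx0
      _ = _ := by ring

end MemM₂

/-! ### Continuous linear maps from `X` to `Cb` -/

section toCb

variable {ε : ℝ}

theorem X.normM₁_le (v : X ε) : normM₁ v.pair.1 ≤ ‖v‖ := by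
  rw [X.norm_def]; linarith [normM₂_nonneg ε v.pair.2]

theorem X.normM₂_le (v : X ε) : normM₂ ε v.pair.2 ≤ ‖v‖ := by
  rw [X.norm_def]; linarith [normM₁_nonneg v.pair.1]

/-- A continuous linear map `X → Cb` given by its values. -/
def X.toCb (g : X ε → ℝ → ℝ) (C : ℝ) (hC₀ : 0 ≤ C)
    (hcont : ∀ v, ContinuousOn (g v) (Ioo (-1) 1))
    (hC : ∀ v, ∀ x ∈ Ioo (-1 : ℝ) 1, |g v x| ≤ C * ‖v‖)
    (hadd : ∀ v w, ∀ x ∈ Ioo (-1 : ℝ) 1, g (v + w) x = g v x + g w x)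
    (hsmul : ∀ (c : ℝ) (v), ∀ x ∈ Ioo (-1 : ℝ) 1, g (c • v) x = c * g v x) : X ε →L[ℝ] Cb :=
  LinearMap.mkContinuous
    { toFun := fun v => Cb.mk (g v) (C * ‖v‖) (hcont v) (hC v)
      map_add' := fun v w => Cb.ext_on fun x hx => by
        rw [extZero_add, extZero_mk hx, extZero_mk hx, extZero_mk hx, hadd v w x hx]
      map_smul' := fun c v => Cb.ext_on fun x hx => by
        rw [RingHom.id_apply, extZero_smul, extZero_mk hx, extZero_mk hx, hsmul c v x hx] }
    C fun v => Cb.norm_le (mul_nonneg hC₀ (norm_nonneg _)) fun x hx => by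
        rw [LinearMap.coe_mk, AddHom.coe_mk, extZero_mk hx]
        exact hC v x hx

theorem X.toCb_apply {g : X ε → ℝ → ℝ} {C : ℝ} {hC₀ hcont hC hadd hsmul} (v : X ε) {x : ℝ}
    (hx : x ∈ Ioo (-1 : ℝ) 1) :
    extZero (X.toCb g C hC₀ hcont hC hadd hsmul v) x = g v x := by
  rw [X.toCb, LinearMap.mkContinuous_apply, LinearMap.coe_mk, AddHom.coe_mk, extZero_mk hx]

/-- `lam · f / (1 - x)` for `f = v_θ` -/
def dataθ (ε : ℝ) : X ε →L[ℝ] Cb :=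
  X.toCb (fun v x => lam x * (v.pair.1 x / (1 - x))) 39 (by norm_num)
    (fun v => (continuousOn_lam.mono Ioo_sub_Ioi).mul (v.mem₁.continuousOn.div
      (continuousOn_const.sub continuousOn_id) fun x hx => sub_ne_zero.2 hx.2.ne'))
    (fun v x hx => (v.mem₁.abs_quot_le hx).trans (by gcongr; exact v.normM₁_le))
    (fun v w x hx => by simp only [map_add, Prod.fst_add, Pi.add_apply]; ring)
    (fun c v x hx => by simp only [map_smul, Prod.smul_fst, Pi.smul_apply, smul_eq_mul]; ring)

/-- `(1 + x) lam² (f / (1 - x))'` for `f = v_θ` -/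
def dataDerivθ (ε : ℝ) : X ε →L[ℝ] Cb :=
  X.toCb (fun v x => (1 + x) * lam x ^ 2 *
      (((1 - x) * deriv v.pair.1 x + v.pair.1 x) / (1 - x) ^ 2)) 77 (by norm_num)
    (fun v => ((continuousOn_const.add continuousOn_id).mul
      ((continuousOn_lam.mono Ioo_sub_Ioi).pow 2)).mul ((((continuousOn_const.sub
        continuousOn_id).mul v.mem₁.continuousOn_deriv).add v.mem₁.continuousOn).div
      ((continuousOn_const.sub continuousOn_id).pow 2)
        fun x hx => pow_ne_zero 2 (sub_ne_zero.2 hx.2.ne')))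
    (fun v x hx => (v.mem₁.abs_quot_deriv_le hx).trans (by gcongr; exact v.normM₁_le))
    (fun v w x hx => by
      simp only [map_add, Prod.fst_add, Pi.add_apply]
      rw [((v.mem₁.hasDerivAt hx).add (w.mem₁.hasDerivAt hx)).deriv]; ring)
    (fun c v x hx => by
      simp only [map_smul, Prod.smul_fst, Pi.smul_apply, smul_eq_mul]
      rw [((v.mem₁.hasDerivAt hx).const_smul c).deriv, smul_eq_mul]; ring)

/-- `(1 + x)^ε w / (1 - x)` for `w = v_φ` -/
def dataφ (ε : ℝ) (hε : 0 < ε) (hε' : ε ≤ 1) : X ε →L[ℝ] Cb :=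
  X.toCb (fun v x => (1 + x) ^ ε * (v.pair.2 x / (1 - x))) 2 (by norm_num)
    (fun v => ((continuousOn_onePlus_rpow ε).mono Ioo_sub_Ioi).mul (v.mem₂.continuousOn.div
      (continuousOn_const.sub continuousOn_id) fun x hx => sub_ne_zero.2 hx.2.ne'))
    (fun v x hx => (v.mem₂.abs_quot_le hε.le hε' hx).trans (by gcongr; exact v.normM₂_le))
    (fun v w x hx => by simp only [map_add, Prod.snd_add, Pi.add_apply]; ring)
    (fun c v x hx => by simp only [map_smul, Prod.smul_snd, Pi.smul_apply, smul_eq_mul]; ring)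

/-- `(1 + x)^{1+ε} w'` for `w = v_φ` -/
def dataDerivφ (ε : ℝ) : X ε →L[ℝ] Cb :=
  X.toCb (fun v x => (1 + x) ^ (1 + ε) * deriv v.pair.2 x) 1 (by norm_num)
    (fun v => ((continuousOn_onePlus_rpow _).mono Ioo_sub_Ioi).mul v.mem₂.continuousOn_deriv)
    (fun v x hx => (v.mem₂.abs_deriv_le hx).trans (by rw [one_mul]; exact v.normM₂_le))
    (fun v w x hx => by
      simp only [map_add, Prod.snd_add]
      rw [((v.mem₂.hasDerivAt hx).add (w.mem₂.hasDerivAt hx)).deriv]; ring)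
    (fun c v x hx => by
      simp only [map_smul, Prod.smul_snd]
      rw [((v.mem₂.hasDerivAt hx).const_smul c).deriv, smul_eq_mul]; ring)

end toCb

/-! ### Reconstruction of elements of `X` from second order data -/

theorem volLam_prim_hasDerivAt (k : ℕ) (φ : Cb) {x : ℝ} (hx : x ∈ Ioo (-1 : ℝ) 1) :
    HasDerivAt ((volLam k).prim φ) (extZero φ x / ((1 + x) * lam x ^ (k + 2))) x := by
  refine ((volLam k).hasDerivAt_prim φ hx).congr_deriv ?_
  rw [div_eq_inv_mul]
  rfl

theorem volLam_prim_bound (k : ℕ) (φ : Cb) {x : ℝ} (hx : x ∈ Ioo (-1 : ℝ) 1) :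
    |lam x ^ (k + 1) * (volLam k).prim φ x| ≤ ‖φ‖ := by
  have := (volLam k).abs_out_mul_prim_le φ hx
  rwa [show (volLam k).bound = 1 from rfl, one_mul] at this

theorem volLam_op_apply (k : ℕ) (φ : Cb) {x : ℝ} (hx : x ∈ Ioo (-1 : ℝ) 1) :
    extZero ((volLam k).op φ) x = lam x ^ (k + 1) * (volLam k).prim φ x :=
  (volLam k).op_apply φ hx

theorem volLam_op_norm_le (k : ℕ) (φ : Cb) : ‖(volLam k).op φ‖ ≤ ‖φ‖ :=
  Cb.norm_le (norm_nonneg _) fun x hx => by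
    rw [volLam_op_apply k φ hx]
    exact volLam_prim_bound k φ hx

/-- The function `F` with `lam³ (1+x) ((1+x) F')' = θ` that vanishes at `-1`. -/
def doublePrim (θ : Cb) (x : ℝ) : ℝ := (volLam 0).prim ((volLam 1).op θ) x

theorem doublePrim_hasDerivAt (θ : Cb) {x : ℝ} (hx : x ∈ Ioo (-1 : ℝ) 1) :
    HasDerivAt (doublePrim θ) ((volLam 1).prim θ x / (1 + x)) x := by
  refine (volLam_prim_hasDerivAt 0 _ hx).congr_deriv ?_
  have hl := lam_pos ⟨hx.1, hx.2.le⟩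
  have h0 : 0 < 1 + x := by linarith [hx.1]
  rw [volLam_op_apply 1 θ hx]
  field_simp

theorem doublePrim_bound (θ : Cb) {x : ℝ} (hx : x ∈ Ioo (-1 : ℝ) 1) :
    |lam x * doublePrim θ x| ≤ ‖θ‖ := by
  have := (volLam_prim_bound 0 ((volLam 1).op θ) hx).trans (volLam_op_norm_le 1 θ)
  rwa [zero_add, pow_one] at this

/-- `(1 - x) F`, extended by zero -/
def recθ (θ : Cb) (x : ℝ) : ℝ := if x ∈ Ioo (-1 : ℝ) 1 then (1 - x) * doublePrim θ x else 0

/-- The derivative of `recθ`. -/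
def recθ' (θ : Cb) (x : ℝ) : ℝ :=
  -doublePrim θ x + (1 - x) * ((volLam 1).prim θ x / (1 + x))

/-- The second derivative of `recθ`. -/
def recθ'' (θ : Cb) (x : ℝ) : ℝ :=
  -(2 * ((volLam 1).prim θ x / (1 + x))) + (1 - x) *
    ((extZero θ x / ((1 + x) * lam x ^ 3) * (1 + x) - (volLam 1).prim θ x) / (1 + x) ^ 2)

theorem recθ_of_Ioc (θ : Cb) {x : ℝ} (hx : x ∈ Ioc (-1 : ℝ) 1) :
    recθ θ x = (1 - x) * doublePrim θ x := by
  rcases hx.2.lt_or_eq with h | rfl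
  · exact if_pos ⟨hx.1, h⟩
  · simp [recθ]

theorem hasDerivAt_oneSub (x : ℝ) : HasDerivAt (fun y : ℝ => 1 - y) (-1) x :=
  (hasDerivAt_id x).const_sub 1

theorem hasDerivAt_onePlus (x : ℝ) : HasDerivAt (fun y : ℝ => 1 + y) 1 x :=
  (hasDerivAt_id x).const_add 1

theorem recθ_hasDerivAt (θ : Cb) {x : ℝ} (hx : x ∈ Ioo (-1 : ℝ) 1) :
    HasDerivAt (recθ θ) (recθ' θ x) x := by
  have h := (hasDerivAt_oneSub x).mul (doublePrim_hasDerivAt θ hx)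
  refine (h.congr_of_eventuallyEq ?_).congr_deriv ?_
  · filter_upwards [isOpen_Ioo.mem_nhds hx] with y hy
    exact recθ_of_Ioc θ ⟨hy.1, hy.2.le⟩
  · unfold recθ'; ring

theorem recθ'_hasDerivAt (θ : Cb) {x : ℝ} (hx : x ∈ Ioo (-1 : ℝ) 1) :
    HasDerivAt (recθ' θ) (recθ'' θ x) x := by
  have h0 : 1 + x ≠ 0 := by linarith [hx.1]
  have h := (doublePrim_hasDerivAt θ hx).neg.add ((hasDerivAt_oneSub x).mul
    ((volLam_prim_hasDerivAt 1 θ hx).div (hasDerivAt_onePlus x) h0))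
  refine h.congr_deriv ?_
  unfold recθ''
  simp only [Pi.div_apply]
  ring

/-- Near `-1` the estimates are those of `volLam`. The second derivative is only needed on `(0, 1)`,
where `lam ≥ 2` and `1 + x > 1` make every term harmless. The constant is `2 + 6 + 1`. -/
theorem recθ_memM₁ (θ : Cb) : MemM₁ (recθ θ) ∧ normM₁ (recθ θ) ≤ 9 * ‖θ‖ := by
  have hθ := norm_nonneg θ
  have hF : ContinuousOn (doublePrim θ) (Ioc (-1) 1) := (volLam 0).continuousOn_prim _
  have hz : ContinuousOn ((volLam 1).prim θ) (Ioc (-1) 1) := (volLam 1).continuousOn_prim _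
  have hne : ∀ x ∈ Ioc (-1 : ℝ) 1, (1 + x) ≠ 0 := fun x hx => by linarith [hx.1]
  have hc0 : ContinuousOn (recθ θ) (Ioc (-1) 1) :=
    ((continuousOn_const.sub continuousOn_id).mul hF).congr fun x hx => recθ_of_Ioc θ hx
  have hc1 : ContinuousOn (recθ' θ) (Ioc (-1) 1) :=
    hF.neg.add ((continuousOn_const.sub continuousOn_id).mul
      (hz.div (continuousOn_const.add continuousOn_id) hne))
  have hc2 : ContinuousOn (recθ'' θ) (Ioo (-1) 1) := by
    have hz' := hz.mono Ioo_subset_Ioc_self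
    have h1 : ContinuousOn (fun x : ℝ => 1 + x) (Ioo (-1) 1) := by fun_prop
    have h2 : ContinuousOn (fun x : ℝ => 1 - x) (Ioo (-1) 1) := by fun_prop
    have h3 : ∀ x ∈ Ioo (-1 : ℝ) 1, (1 + x) ≠ 0 := fun x hx => by linarith [hx.1]
    refine (continuousOn_const.mul (hz'.div h1 h3)).neg.add (h2.mul
      ((((continuousOn_extZero.div (h1.mul ((continuousOn_lam.mono Ioo_sub_Ioi).pow 3))
        fun x hx => mul_ne_zero (h3 x hx) (pow_pos (lam_pos ⟨hx.1, hx.2.le⟩) 3).ne').mul h1).sub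
        hz').div (h1.pow 2) fun x hx => pow_ne_zero 2 (h3 x hx)))
  have hb0 : ∀ x ∈ Ioo (-1 : ℝ) 1, |lam x * recθ θ x| ≤ 2 * ‖θ‖ := by
    intro x hx
    have h1 : 0 < 1 - x := by linarith [hx.2]
    rw [recθ_of_Ioc θ ⟨hx.1, hx.2.le⟩, mul_left_comm, abs_mul, abs_of_pos h1]
    have := doublePrim_bound θ hx
    gcongr
    linarith [hx.1]
  have hb0' : ∀ x ∈ Ioo (-1 : ℝ) 1, |wtLog x * iteratedDeriv 0 (recθ θ) x| ≤ 2 * ‖θ‖ := by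
    intro x hx
    have hl := lam_pos ⟨hx.1, hx.2.le⟩
    refine le_trans ?_ (hb0 x hx)
    rw [iteratedDeriv_zero, abs_mul, abs_mul, abs_of_pos hl]
    gcongr
    exact wtLog_le_lam hx
  have hb1 : ∀ x ∈ Ioo (-1 : ℝ) 1, |wtLogSq x * iteratedDeriv 1 (recθ θ) x| ≤ 6 * ‖θ‖ := by
    intro x hx
    have hl := lam_pos ⟨hx.1, hx.2.le⟩
    have h0 : 0 < 1 + x := by linarith [hx.1]
    have h1 : 0 < 1 - x := by linarith [hx.2]
    have hw : |wtLogSq x| ≤ (1 + x) * lam x ^ 2 := by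
      unfold wtLogSq
      rw [abs_mul, abs_pow, abs_of_pos h0]
      gcongr
      exact wtLog_le_lam hx
    have e1 := doublePrim_bound θ hx
    have e2 := volLam_prim_bound 1 θ hx
    have e3 := onePlus_mul_lam_le hx
    rw [iteratedDeriv_one, (recθ_hasDerivAt θ hx).deriv, abs_mul]
    calc |wtLogSq x| * |recθ' θ x| ≤ (1 + x) * lam x ^ 2 * |recθ' θ x| := by gcongr
      _ = |(1 + x) * lam x ^ 2 * recθ' θ x| := by
          rw [abs_mul, abs_of_pos (a := (1 + x) * lam x ^ 2) (by positivity)]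
      _ = |-((1 + x) * lam x * (lam x * doublePrim θ x))
            + (1 - x) * (lam x ^ (1 + 1) * (volLam 1).prim θ x)| := by
          congr 1
          unfold recθ'
          field_simp
          ring
      _ ≤ (1 + x) * lam x * |lam x * doublePrim θ x|
            + (1 - x) * |lam x ^ (1 + 1) * (volLam 1).prim θ x| := by
          refine (abs_add_le _ _).trans ?_
          rw [abs_neg, abs_mul (1 - x), abs_of_pos h1, abs_mul ((1 + x) * lam x),
            abs_of_pos (a := (1 + x) * lam x) (by positivity)]
      _ ≤ 4 * ‖θ‖ + 2 * ‖θ‖ := by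
          gcongr
          linarith [hx.1]
      _ = 6 * ‖θ‖ := by ring
  have hsub : Ioo (0 : ℝ) 1 ⊆ Ioo (-1) 1 := Ioo_subset_Ioo_left (by norm_num)
  have hb2 : ∀ x ∈ Ioo (0 : ℝ) 1,
      |(1 : ℝ → ℝ) x * iteratedDeriv 2 (recθ θ) x| ≤ 1 * ‖θ‖ := by
    intro x hx
    have hx' := hsub hx
    have hl := two_le_lam ⟨hx'.1, hx'.2.le⟩
    have h0 : 1 < 1 + x := by linarith [hx.1]
    have h1 : 0 < 1 - x := by linarith [hx.2]
    rw [iteratedDeriv_two_of_hasDerivAt isOpen_Ioo (fun y hy => recθ_hasDerivAt θ hy) hx'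
      (recθ'_hasDerivAt θ hx'), Pi.one_apply, one_mul, one_mul]
    have e2 := volLam_prim_bound 1 θ hx'
    have e4 : |(volLam 1).prim θ x| ≤ ‖θ‖ / 4 := by
      rw [abs_mul, abs_of_pos (a := lam x ^ (1 + 1)) (by positivity)] at e2
      have : 4 ≤ lam x ^ (1 + 1) := by rw [one_add_one_eq_two]; nlinarith
      nlinarith [abs_nonneg ((volLam 1).prim θ x)]
    have e5 : |extZero θ x / lam x ^ 3| ≤ ‖θ‖ / 8 := by
      rw [abs_div, abs_of_pos (a := lam x ^ 3) (by positivity)]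
      have : 2 ^ 3 ≤ lam x ^ 3 := by gcongr
      calc |extZero θ x| / lam x ^ 3 ≤ ‖θ‖ / 2 ^ 3 := by
            gcongr
            exact abs_extZero_le
        _ = ‖θ‖ / 8 := by norm_num
    have e6 : |(volLam 1).prim θ x / (1 + x)| ≤ ‖θ‖ / 4 := by
      rw [abs_div, abs_of_pos (a := 1 + x) (by linarith)]
      exact (div_le_self (abs_nonneg _) h0.le).trans e4
    have e7 : |(extZero θ x / ((1 + x) * lam x ^ 3) * (1 + x) - (volLam 1).prim θ x) / (1 + x) ^ 2|
        ≤ ‖θ‖ / 8 + ‖θ‖ / 4 := by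
      rw [abs_div, abs_of_pos (a := (1 + x) ^ 2) (by positivity)]
      refine (div_le_self (abs_nonneg _) (by nlinarith)).trans ?_
      have : extZero θ x / ((1 + x) * lam x ^ 3) * (1 + x) = extZero θ x / lam x ^ 3 := by
        field_simp
      rw [this]
      exact (abs_sub _ _).trans (add_le_add e5 e4)
    have e8 := mul_le_mul_of_nonneg_left e7 h1.le
    have e9 : (1 - x) * (‖θ‖ / 8 + ‖θ‖ / 4) ≤ 1 * (‖θ‖ / 8 + ‖θ‖ / 4) := by
      gcongr
      linarith [hx.1]
    unfold recθ''
    refine (abs_add_le _ _).trans ?_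
    rw [abs_neg, abs_mul, abs_mul, abs_two, abs_of_pos h1]
    linarith
  refine ⟨⟨?_, ?_, contDiffOn_one_Ioc (fun x hx => recθ_hasDerivAt θ hx) hc0 hc1,
    contDiffOn_two_of_hasDerivAt isOpen_Ioo (fun x hx => recθ_hasDerivAt θ (hsub hx))
      (fun x hx => recθ'_hasDerivAt θ (hsub hx)) (hc2.mono hsub), ?_, ?_, wbdd_of hb0',
    wbdd_of hb1, wbdd_of hb2⟩, ?_⟩
  · intro x hx
    exact if_neg fun h => hx ⟨h.1.le, h.2.le⟩
  · intro x hx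
    rcases hx.1.eq_or_lt with rfl | h
    · rw [← Ioc_insert_left (by norm_num : (-1 : ℝ) ≤ 1), continuousWithinAt_insert_self]
      have h1 := (tendsto_zero_of_lam_mul_bdd hb0).mono_left (nhdsWithin_mono (-1) Ioc_sub_Ioi)
      have h2 : recθ θ (-1) = 0 := if_neg (by norm_num)
      rw [← h2] at h1
      exact h1
    · have := hc0 x ⟨h, hx.2⟩
      refine this.mono_of_mem_nhdsWithin ?_
      filter_upwards [self_mem_nhdsWithin, mem_nhdsWithin_of_mem_nhds (Ioi_mem_nhds h)]
        with y hy hy'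
      exact ⟨hy', hy.2⟩
  · exact if_neg (by norm_num)
  · exact if_neg (by norm_num)
  · have h1 := wsup_le (by positivity) hb0'
    have h2 := wsup_le (by positivity) hb1
    have h3 := wsup_le (by positivity) hb2
    unfold normM₁
    linarith

/-! ### Reconstruction of the swirl component, and the map into `X` -/

section recφ

variable (ε : ℝ) (hε : 0 < ε) (hε' : ε ≤ 1)

/-- `(1 + x)^ε` as an element of `Cb` -/
def powCb (hε : 0 < ε) (hε' : ε ≤ 1) : Cb :=
  Cb.mk (fun x => (1 + x) ^ ε) 2 ((continuousOn_onePlus_rpow ε).mono Ioo_sub_Ioi) fun x hx => by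
    rw [abs_of_pos (onePlus_rpow_pos ε hx.1)]
    exact onePlus_rpow_le_two hε.le hε' ⟨hx.1.le, hx.2.le⟩

theorem powCb_norm_le : ‖powCb ε hε hε'‖ ≤ 2 :=
  Cb.norm_le (by norm_num) fun x hx => by
    rw [powCb, extZero_mk hx, abs_of_pos (onePlus_rpow_pos ε hx.1)]
    exact onePlus_rpow_le_two hε.le hε' ⟨hx.1.le, hx.2.le⟩

/-- `φ ↦ (1+x)^ε ∫_0^x (1+s)^{-ε-1} φ` -/
abbrev volPowZero : Volterra := volPow (hε := hε) (hε' := hε') 0 ε (by norm_num)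

/-- `φ ↦ (1+x)^ε ∫_1^x (1+s)^{-ε-1} φ` -/
abbrev volPowOne : Volterra := volPow (hε := hε) (hε' := hε') 1 ε (by norm_num)

/-- `(1 + x)^ε p` with `p(0) = p₀`, `(1 + x)^{1+ε} p' = π` -/
def slopeCb (π : Cb) (p₀ : ℝ) : Cb := p₀ • powCb ε hε hε' + (volPowZero ε hε hε').op π

/-- `p` with `p(0) = p₀`, `(1 + x)^{1+ε} p' = π` -/
def slopeFun (π : Cb) (p₀ : ℝ) (x : ℝ) : ℝ := p₀ + (volPowZero ε hε hε').prim π x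

theorem volPow_op_norm_le {x₀ : ℝ} (hx₀ : x₀ ∈ Icc (0 : ℝ) 1) (φ : Cb) :
    ‖(volPow x₀ ε hx₀ hε hε').op φ‖ ≤ 3 / ε * ‖φ‖ :=
  Cb.norm_le (by positivity) fun x hx => by
    rw [(volPow x₀ ε hx₀ hε hε').op_apply φ hx]
    exact (volPow x₀ ε hx₀ hε hε').abs_out_mul_prim_le φ hx

theorem slopeCb_apply (π : Cb) (p₀ : ℝ) {x : ℝ} (hx : x ∈ Ioo (-1 : ℝ) 1) :
    extZero (slopeCb ε hε hε' π p₀) x = (1 + x) ^ ε * slopeFun ε hε hε' π p₀ x := by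
  rw [slopeCb, extZero_add, extZero_smul, powCb, extZero_mk hx, Volterra.op_apply _ _ hx, slopeFun,
    mul_add, mul_comm p₀]
  rfl

theorem slopeFun_hasDerivAt (π : Cb) (p₀ : ℝ) {x : ℝ} (hx : x ∈ Ioo (-1 : ℝ) 1) :
    HasDerivAt (slopeFun ε hε hε' π p₀) ((1 + x) ^ (-ε - 1) * extZero π x) x :=
  ((volPowZero ε hε hε').hasDerivAt_prim π hx).const_add p₀

theorem slopeCb_norm_le (π : Cb) (p₀ : ℝ) :
    ‖slopeCb ε hε hε' π p₀‖ ≤ 2 * |p₀| + 3 / ε * ‖π‖ := by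
  refine (norm_add_le _ _).trans (add_le_add ?_ (volPow_op_norm_le ε hε hε' _ π))
  rw [norm_smul, Real.norm_eq_abs, mul_comm]
  gcongr
  apply powCb_norm_le

/-- `w` with `w(1) = 0`, `(1+x) w' = p`, `p(0) = p₀`, `(1 + x)^{1+ε} p' = π`; extended by zero -/
def recφ (π : Cb) (p₀ : ℝ) (x : ℝ) : ℝ :=
  if x ∈ Ioo (-1 : ℝ) 1 then (volPowOne ε hε hε').prim (slopeCb ε hε hε' π p₀) x else 0

theorem recφ_of_Ioc (π : Cb) (p₀ : ℝ) {x : ℝ} (hx : x ∈ Ioc (-1 : ℝ) 1) :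
    recφ ε hε hε' π p₀ x = (volPowOne ε hε hε').prim (slopeCb ε hε hε' π p₀) x := by
  rcases hx.2.lt_or_eq with h | rfl
  · exact if_pos ⟨hx.1, h⟩
  · exact (if_neg (by norm_num)).trans ((volPowOne ε hε hε').prim_base _).symm

theorem onePlus_rpow_neg_sub_one {x : ℝ} (hx : -1 < x) :
    (1 + x) ^ (-ε - 1) = ((1 + x) ^ ε * (1 + x))⁻¹ := by
  have h0 : 0 < 1 + x := by linarith
  rw [← Real.rpow_add_one h0.ne', ← Real.rpow_neg h0.le]
  ring_nf

theorem recφ_hasDerivAt (π : Cb) (p₀ : ℝ) {x : ℝ} (hx : x ∈ Ioo (-1 : ℝ) 1) :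
    HasDerivAt (recφ ε hε hε' π p₀) (slopeFun ε hε hε' π p₀ x / (1 + x)) x := by
  refine (((volPowOne ε hε hε').hasDerivAt_prim
    (slopeCb ε hε hε' π p₀) hx).congr_of_eventuallyEq ?_).congr_deriv ?_
  · filter_upwards [isOpen_Ioo.mem_nhds hx] with y hy
    exact recφ_of_Ioc ε hε hε' π p₀ ⟨hy.1, hy.2.le⟩
  · have h0 : 0 < 1 + x := by linarith [hx.1]
    have h1 := onePlus_rpow_pos ε hx.1
    rw [slopeCb_apply ε hε hε' π p₀ hx]
    change (1 + x) ^ (-ε - 1) * _ = _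
    rw [onePlus_rpow_neg_sub_one ε hx.1]
    field_simp

theorem recφ_deriv_hasDerivAt (π : Cb) (p₀ : ℝ) {x : ℝ} (hx : x ∈ Ioo (-1 : ℝ) 1) :
    HasDerivAt (fun x => slopeFun ε hε hε' π p₀ x / (1 + x))
      (((1 + x) ^ (-ε - 1) * extZero π x * (1 + x) - slopeFun ε hε hε' π p₀ x) / (1 + x) ^ 2) x := by
  have h0 : 1 + x ≠ 0 := by linarith [hx.1]
  refine ((slopeFun_hasDerivAt ε hε hε' π p₀ hx).div (hasDerivAt_onePlus x) h0).congr_deriv ?_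
  rw [mul_one]

/-- With `p = (1 + x) w'` one has `(1 + x)² w'' = (1 + x) p' - p`, so all three weighted bounds
follow from those of `π` and of `(1 + x)^ε p`. -/
theorem recφ_memM₂ (π : Cb) (p₀ : ℝ) : MemM₂ ε (recφ ε hε hε' π p₀) ∧
    normM₂ ε (recφ ε hε hε' π p₀) ≤ (3 / ε + 2) * (2 * |p₀| + 3 / ε * ‖π‖) + ‖π‖ := by
  have hN := slopeCb_norm_le ε hε hε' π p₀
  have hp : ContinuousOn (slopeFun ε hε hε' π p₀) (Ioc (-1) 1) :=
    continuousOn_const.add ((volPowZero ε hε hε').continuousOn_prim π)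
  have hw : ContinuousOn (recφ ε hε hε' π p₀) (Ioc (-1) 1) :=
    ((volPowOne ε hε hε').continuousOn_prim _).congr fun x hx => recφ_of_Ioc ε hε hε' π p₀ hx
  have hne : ∀ x ∈ Ioc (-1 : ℝ) 1, (1 + x) ≠ 0 := fun x hx => by linarith [hx.1]
  have hne' : ∀ x ∈ Ioo (-1 : ℝ) 1, (1 + x) ≠ 0 := fun x hx => by linarith [hx.1]
  have hc1 : ContinuousOn (fun x => slopeFun ε hε hε' π p₀ x / (1 + x)) (Ioc (-1) 1) :=
    hp.div (continuousOn_const.add continuousOn_id) hne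
  have hc2 : ContinuousOn (fun x => ((1 + x) ^ (-ε - 1) * extZero π x * (1 + x)
      - slopeFun ε hε hε' π p₀ x) / (1 + x) ^ 2) (Ioo (-1) 1) := by
    have h1 : ContinuousOn (fun x : ℝ => 1 + x) (Ioo (-1) 1) := by fun_prop
    exact (((((continuousOn_onePlus_rpow _).mono Ioo_sub_Ioi).mul continuousOn_extZero).mul h1).sub
      (hp.mono Ioo_subset_Ioc_self)).div (h1.pow 2) fun x hx => pow_ne_zero 2 (hne' x hx)
  have hpb : ∀ x ∈ Ioo (-1 : ℝ) 1, |(1 + x) ^ ε * slopeFun ε hε hε' π p₀ x|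
      ≤ ‖slopeCb ε hε hε' π p₀‖ := fun x hx => by
    rw [← slopeCb_apply ε hε hε' π p₀ hx]
    exact abs_extZero_le
  have hb0 : ∀ x ∈ Ioo (-1 : ℝ) 1, |wpow ε x * iteratedDeriv 0 (recφ ε hε hε' π p₀) x|
      ≤ 3 / ε * ‖slopeCb ε hε hε' π p₀‖ := by
    intro x hx
    rw [iteratedDeriv_zero, recφ_of_Ioc ε hε hε' π p₀ ⟨hx.1, hx.2.le⟩]
    exact (volPowOne ε hε hε').abs_out_mul_prim_le _ hx
  have hb1 : ∀ x ∈ Ioo (-1 : ℝ) 1, |wpow (1 + ε) x * iteratedDeriv 1 (recφ ε hε hε' π p₀) x|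
      ≤ ‖slopeCb ε hε hε' π p₀‖ := by
    intro x hx
    refine le_of_eq_of_le ?_ (hpb x hx)
    have h0 : 0 < 1 + x := by linarith [hx.1]
    rw [iteratedDeriv_one, (recφ_hasDerivAt ε hε hε' π p₀ hx).deriv, wpow, Real.rpow_add h0,
      Real.rpow_one]
    congr 1
    field_simp
  have hb2 : ∀ x ∈ Ioo (-1 : ℝ) 1, |wpow (2 + ε) x * iteratedDeriv 2 (recφ ε hε hε' π p₀) x|
      ≤ ‖π‖ + ‖slopeCb ε hε hε' π p₀‖ := by
    intro x hx
    have h0 : 0 < 1 + x := by linarith [hx.1]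
    have h1 := onePlus_rpow_pos ε hx.1
    rw [iteratedDeriv_two_of_hasDerivAt isOpen_Ioo (fun y hy => recφ_hasDerivAt ε hε hε' π p₀ hy)
      hx (recφ_deriv_hasDerivAt ε hε hε' π p₀ hx), wpow, Real.rpow_add h0, Real.rpow_two,
      onePlus_rpow_neg_sub_one ε hx.1]
    have : (1 + x) ^ 2 * (1 + x) ^ ε * (((((1 + x) ^ ε * (1 + x))⁻¹ * extZero π x * (1 + x)
        - slopeFun ε hε hε' π p₀ x) / (1 + x) ^ 2))
        = extZero π x - (1 + x) ^ ε * slopeFun ε hε hε' π p₀ x := by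
      field_simp
    rw [this]
    exact (abs_sub _ _).trans (add_le_add abs_extZero_le (hpb x hx))
  refine ⟨⟨?_, contDiffOn_one_Ioc (fun x hx => recφ_hasDerivAt ε hε hε' π p₀ hx) hw hc1,
    contDiffOn_two_of_hasDerivAt isOpen_Ioo (fun x hx => recφ_hasDerivAt ε hε hε' π p₀ hx)
      (fun x hx => recφ_deriv_hasDerivAt ε hε hε' π p₀ hx) hc2, if_neg (by norm_num),
    wbdd_of hb0, wbdd_of hb1, wbdd_of hb2⟩, ?_⟩
  · intro x hx
    exact if_neg fun h => hx ⟨h.1, h.2.le⟩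
  · have h1 := wsup_le (by positivity) hb0
    have h2 := wsup_le (by positivity) hb1
    have h3 := wsup_le (by positivity) hb2
    have h4 : (3 / ε + 2) * ‖slopeCb ε hε hε' π p₀‖
        ≤ (3 / ε + 2) * (2 * |p₀| + 3 / ε * ‖π‖) := by gcongr
    unfold normM₂
    linarith

theorem slopeCb_add (π π' : Cb) (p₀ p₀' : ℝ) :
    slopeCb ε hε hε' (π + π') (p₀ + p₀') = slopeCb ε hε hε' π p₀ + slopeCb ε hε hε' π' p₀' := by
  simp only [slopeCb, map_add, add_smul]; abel

theorem slopeCb_smul (c : ℝ) (π : Cb) (p₀ : ℝ) :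
    slopeCb ε hε hε' (c • π) (c * p₀) = c • slopeCb ε hε hε' π p₀ := by
  simp only [slopeCb, map_smul, mul_smul, smul_add]

/-- The element of `X` with second order data `θ`, `π` and `(1+x) w'(x) = p₀` at `x = 0`. -/
def reconstruct : Cb × Cb × ℝ →L[ℝ] X ε :=
  LinearMap.mkContinuous
    { toFun := fun d => (⟨(recθ d.1, recφ ε hε hε' d.2.1 d.2.2), (recθ_memM₁ d.1).1,
        (recφ_memM₂ ε hε hε' d.2.1 d.2.2).1⟩ : ↥(M₁.prod (M₂ ε)))
      map_add' := fun d e => by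
        refine X.pair_injective (Prod.ext (funext fun x => ?_) (funext fun x => ?_))
        · change recθ (d.1 + e.1) x = recθ d.1 x + recθ e.1 x
          unfold recθ doublePrim
          split_ifs with hx
          · rw [map_add, Volterra.prim_add _ _ _ ⟨hx.1, hx.2.le⟩, mul_add]
          · rw [add_zero]
        · change recφ ε hε hε' (d.2.1 + e.2.1) (d.2.2 + e.2.2) x
            = recφ ε hε hε' d.2.1 d.2.2 x + recφ ε hε hε' e.2.1 e.2.2 x
          unfold recφ
          split_ifs with hx
          · rw [slopeCb_add, Volterra.prim_add _ _ _ ⟨hx.1, hx.2.le⟩]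
          · rw [add_zero]
      map_smul' := fun c d => by
        refine X.pair_injective (Prod.ext (funext fun x => ?_) (funext fun x => ?_))
        · change recθ (c • d.1) x = c * recθ d.1 x
          unfold recθ doublePrim
          split_ifs with hx
          · rw [map_smul, Volterra.prim_smul]; ring
          · rw [mul_zero]
        · change recφ ε hε hε' (c • d.2.1) (c * d.2.2) x = c * recφ ε hε hε' d.2.1 d.2.2 x
          unfold recφ
          split_ifs with hx
          · rw [slopeCb_smul, Volterra.prim_smul]
          · rw [mul_zero] }
    (9 + ((3 / ε + 2) * (2 + 3 / ε) + 1)) fun d => by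
      have h1 := (recθ_memM₁ d.1).2
      have h2 := (recφ_memM₂ ε hε hε' d.2.1 d.2.2).2
      have n1 : ‖d.1‖ ≤ ‖d‖ := norm_fst_le d
      have n2 : ‖d.2.1‖ ≤ ‖d‖ := (norm_fst_le d.2).trans (norm_snd_le d)
      have n3 : |d.2.2| ≤ ‖d‖ := (norm_snd_le d.2).trans (norm_snd_le d)
      have h3 : (3 / ε + 2) * (2 * |d.2.2| + 3 / ε * ‖d.2.1‖) + ‖d.2.1‖
          ≤ (3 / ε + 2) * (2 * ‖d‖ + 3 / ε * ‖d‖) + ‖d‖ := by gcongr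
      change normM₁ (recθ d.1) + normM₂ ε (recφ ε hε hε' d.2.1 d.2.2) ≤ _
      calc normM₁ (recθ d.1) + normM₂ ε (recφ ε hε hε' d.2.1 d.2.2)
          ≤ 9 * ‖d‖ + ((3 / ε + 2) * (2 * ‖d‖ + 3 / ε * ‖d‖) + ‖d‖) := by linarith
        _ = _ := by ring

theorem reconstruct_pair (d : Cb × Cb × ℝ) :
    (reconstruct ε hε hε' d).pair = (recθ d.1, recφ ε hε hε' d.2.1 d.2.2) := rfl

end recφ

/-! ### The solution operator of the linearized system -/

/-- `2 - c ln ((1 + x) / 2)` -/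
def den (c x : ℝ) : ℝ := 2 - c * Real.log ((1 + x) / 2)

theorem den_eq (c x : ℝ) : den c x = 2 + c * (lam x - 2) := by
  unfold den lam; ring

theorem two_le_den {c x : ℝ} (hc : 0 < c) (hx : x ∈ Ioc (-1 : ℝ) 1) : 2 ≤ den c x := by
  rw [den_eq]
  nlinarith [two_le_lam hx]

theorem den_pos {c x : ℝ} (hc : 0 < c) (hx : x ∈ Ioc (-1 : ℝ) 1) : 0 < den c x := by
  linarith [two_le_den hc hx]

theorem hasDerivAt_den (c : ℝ) {x : ℝ} (hx : -1 < x) :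
    HasDerivAt (den c) (-(c / (1 + x))) x := by
  have h := ((hasDerivAt_lam hx).sub_const 2).const_mul c |>.const_add 2
  refine (h.congr_of_eventuallyEq (Eventually.of_forall fun y => den_eq c y)).congr_deriv ?_
  ring

/-- `lam⁻¹` as an element of `Cb` -/
def lamInv : Cb :=
  Cb.mk (fun x => (lam x)⁻¹) (1 / 2)
    ((continuousOn_lam.mono Ioo_sub_Ioi).inv₀ fun x hx => (lam_pos ⟨hx.1, hx.2.le⟩).ne')
    fun x hx => by
      have := two_le_lam ⟨hx.1, hx.2.le⟩
      rw [abs_inv, abs_of_pos (by linarith), one_div]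
      exact inv_anti₀ (by norm_num) this

theorem lamInv_apply {x : ℝ} (hx : x ∈ Ioo (-1 : ℝ) 1) : extZero lamInv x = (lam x)⁻¹ :=
  extZero_mk hx

/-- `den / lam` as an element of `Cb` -/
def denQuot (c : ℝ) : Cb := c • (1 : Cb) + (2 - 2 * c) • lamInv

theorem denQuot_apply (c : ℝ) {x : ℝ} (hx : x ∈ Ioo (-1 : ℝ) 1) :
    extZero (denQuot c) x = den c x / lam x := by
  have hl := lam_pos ⟨hx.1, hx.2.le⟩
  rw [denQuot, extZero_add, extZero_smul, extZero_smul, extZero_one hx, lamInv_apply hx, den_eq]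
  field_simp
  ring

/-- For `c > 0` the functions `den` and `lam` are comparable, with constants depending on `c` only.
This is where `γ > -1` makes the solution operator available. -/
theorem isUnit_denQuot {c : ℝ} (hc : 0 < c) : IsUnit (denQuot c) := by
  have hD : ContinuousOn (den c) (Ioo (-1) 1) := fun x hx =>
    (hasDerivAt_den c hx.1).continuousAt.continuousWithinAt
  -- The bound is `lam = (lam - 2) + 2 ≤ den / c + den`.
  refine IsUnit.of_mul_eq_one (Cb.mk (fun x => lam x / den c x) (1 + 1 / c)
    ((continuousOn_lam.mono Ioo_sub_Ioi).div hD fun x hx => (den_pos hc ⟨hx.1, hx.2.le⟩).ne')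
    fun x hx => ?_) (Cb.ext_on fun x hx => ?_)
  · have hl := two_le_lam ⟨hx.1, hx.2.le⟩
    have hd := two_le_den hc ⟨hx.1, hx.2.le⟩
    rw [abs_of_pos (div_pos (by linarith) (by linarith)), div_le_iff₀ (by linarith), add_mul,
      one_mul, one_div, den_eq, mul_add (c⁻¹), inv_mul_cancel_left₀ hc.ne']
    have : 0 < c⁻¹ * 2 := by positivity
    nlinarith
  · have hl := lam_pos ⟨hx.1, hx.2.le⟩
    have hd := den_pos hc ⟨hx.1, hx.2.le⟩
    rw [extZero_mul, denQuot_apply c hx, extZero_mk hx, extZero_one hx]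
    field_simp

/-- `lam / den` as an element of `Cb` -/
def denInv (c : ℝ) : Cb := Ring.inverse (denQuot c)

theorem denInv_apply {c x : ℝ} (hc : 0 < c) (hx : x ∈ Ioo (-1 : ℝ) 1) :
    extZero (denInv c) x = lam x / den c x := by
  have h : extZero (denQuot c * denInv c) x = 1 := by
    rw [denInv, Ring.mul_inverse_cancel _ (isUnit_denQuot hc), extZero_one hx]
  have hl := lam_pos ⟨hx.1, hx.2.le⟩
  have hd := den_pos hc ⟨hx.1, hx.2.le⟩
  rw [extZero_mul, denQuot_apply c hx] at h
  field_simp at h ⊢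
  linarith

/-- Evaluation at `0`. -/
def evalZero : Cb →L[ℝ] ℝ := BoundedContinuousFunction.evalCLM ℝ ⟨0, mem_zero⟩

theorem evalZero_apply (φ : Cb) : evalZero φ = extZero φ 0 := (extZero_of_mem mem_zero).symm

/-- `lam f / (1 - x)`, where `f` solves `(1-x²) f' + (2x + Ū_θ) f = (1-x)² Φ`, `f(0) = b`, with
`Φ` the primitive of `η / ((1+x) lam³)` that vanishes at `-1`. -/
def solθ (c b : ℝ) (η : Cb) : Cb :=
  denInv c ^ 2 * (volLog.op (denQuot c ^ 2 * (volLam 1).op η) + (b * den c 0 ^ 2) • lamInv)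

/-- `(1+x) lam² (f / (1 - x))'` for the solution `f` of `solθ` -/
def solDerivθ (c b : ℝ) (η : Cb) : Cb :=
  (volLam 1).op η + (2 * c) • (denInv c * solθ c b η)

/-- `lam³ (1+x) ((1+x) (f / (1 - x))')'` for the solution `f` of `solθ` -/
def solDataθ (c b : ℝ) (η : Cb) : Cb :=
  η + (2 * c ^ 2) • (denInv c ^ 2 * solθ c b η) + (2 * c) • (denInv c * solDerivθ c b η)

section

variable (ε : ℝ) (hε : 0 < ε) (hε' : ε ≤ 1)

/-- `(1+x)^ε p`, where `p` solves `(1+x) p' = (2c/den) p + (1+x)^{-ε} P`, `p(0) = 0`. -/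
def partφ (c : ℝ) (P : Cb) : Cb :=
  denInv c ^ 2 * (volPowLam ε hε hε').op (denQuot c ^ 2 * P)

/-- The constant that makes `w(0) = b V²_φ(0)`. -/
def constφ (c b : ℝ) (P : Cb) : ℝ :=
  -(b * den c 0 ^ 2) + 2 * den c 0 / Real.log 2 *
    evalZero ((volPowOne ε hε hε').op (partφ ε hε hε' c P))

/-- `(1+x)^ε lam⁻²` as an element of `Cb` -/
def powLamCb : Cb := powCb ε hε hε' * lamInv ^ 2

/-- `(1+x)^{1+ε} w'` for the solution `w` of the linearized swirl equation with `w(1) = 0`,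
`w(0) = b V²_φ(0)` -/
def solφ (c b : ℝ) (P : Cb) : Cb :=
  partφ ε hε hε' c P + constφ ε hε hε' c b P • (powLamCb ε hε hε' * denInv c ^ 2)

/-- `(1+x)^{1+ε} ((1+x) w')'` for the solution `w` of `solφ` -/
def solDataφ (c b : ℝ) (P : Cb) : Cb :=
  P + (2 * c) • (denInv c * lamInv * solφ ε hε hε' c b P)

/-- The solution of the linearized system with right hand sides given by `y` and with prescribed
values at `0`. -/
def linSol (q : (ℝ × EuclideanSpace ℝ (Fin 2)) × Cb × Cb) : X ε :=
  reconstruct ε hε hε' (solDataθ (q.1.1 + 1) (q.1.2 0) q.2.1,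
    solDataφ ε hε hε' (q.1.1 + 1) (q.1.2 1) q.2.2,
    evalZero (solφ ε hε hε' (q.1.1 + 1) (q.1.2 1) q.2.2))

/-! ### Smooth dependence of the solution formulas on the parameters -/

section smooth

variable {Z : Type*} [NormedAddCommGroup Z] [NormedSpace ℝ Z] {z₀ : Z} {c b : Z → ℝ} {η : Z → Cb}

theorem contDiffAt_denQuot (hc : ContDiffAt ℝ ∞ c z₀) :
    ContDiffAt ℝ ∞ (fun z => denQuot (c z)) z₀ :=
  (hc.smul contDiffAt_const).add ((contDiffAt_const.sub (contDiffAt_const.mul hc)).smul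
    contDiffAt_const)

/-- Inversion is smooth at units of a Banach algebra. This is the only non-polynomial dependence on
`c` in the solution formulas. -/
theorem contDiffAt_denInv (hc : ContDiffAt ℝ ∞ c z₀) (h0 : 0 < c z₀) :
    ContDiffAt ℝ ∞ (fun z => denInv (c z)) z₀ :=
  ContDiffAt.comp z₀ (contDiffAt_ringInverse ℝ (isUnit_denQuot h0).unit) (contDiffAt_denQuot hc)

theorem contDiffAt_den_zero (hc : ContDiffAt ℝ ∞ c z₀) :
    ContDiffAt ℝ ∞ (fun z => den (c z) 0) z₀ := by
  unfold den; fun_prop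

theorem _root_.ContDiffAt.clm_apply_const {F G : Type*} [NormedAddCommGroup F] [NormedSpace ℝ F]
    [NormedAddCommGroup G] [NormedSpace ℝ G] (L : F →L[ℝ] G) {f : Z → F}
    (hf : ContDiffAt ℝ ∞ f z₀) : ContDiffAt ℝ ∞ (fun z => L (f z)) z₀ :=
  L.contDiff.contDiffAt.comp z₀ hf

theorem contDiffAt_solθ (hc : ContDiffAt ℝ ∞ c z₀) (hb : ContDiffAt ℝ ∞ b z₀)
    (hη : ContDiffAt ℝ ∞ η z₀) (h0 : 0 < c z₀) :
    ContDiffAt ℝ ∞ (fun z => solθ (c z) (b z) (η z)) z₀ :=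
  ((contDiffAt_denInv hc h0).pow 2).mul ((ContDiffAt.clm_apply_const volLog.op
    (((contDiffAt_denQuot hc).pow 2).mul (hη.clm_apply_const (volLam 1).op))).add
      ((hb.mul ((contDiffAt_den_zero hc).pow 2)).smul contDiffAt_const))

theorem contDiffAt_solDerivθ (hc : ContDiffAt ℝ ∞ c z₀) (hb : ContDiffAt ℝ ∞ b z₀)
    (hη : ContDiffAt ℝ ∞ η z₀) (h0 : 0 < c z₀) :
    ContDiffAt ℝ ∞ (fun z => solDerivθ (c z) (b z) (η z)) z₀ :=
  (hη.clm_apply_const (volLam 1).op).add ((contDiffAt_const.mul hc).smul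
    ((contDiffAt_denInv hc h0).mul (contDiffAt_solθ hc hb hη h0)))

theorem contDiffAt_solDataθ (hc : ContDiffAt ℝ ∞ c z₀) (hb : ContDiffAt ℝ ∞ b z₀)
    (hη : ContDiffAt ℝ ∞ η z₀) (h0 : 0 < c z₀) :
    ContDiffAt ℝ ∞ (fun z => solDataθ (c z) (b z) (η z)) z₀ :=
  (hη.add ((contDiffAt_const.mul (hc.pow 2)).smul (((contDiffAt_denInv hc h0).pow 2).mul
    (contDiffAt_solθ hc hb hη h0)))).add ((contDiffAt_const.mul hc).smul
      ((contDiffAt_denInv hc h0).mul (contDiffAt_solDerivθ hc hb hη h0)))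

theorem contDiffAt_partφ (hc : ContDiffAt ℝ ∞ c z₀) (hη : ContDiffAt ℝ ∞ η z₀) (h0 : 0 < c z₀) :
    ContDiffAt ℝ ∞ (fun z => partφ ε hε hε' (c z) (η z)) z₀ :=
  ((contDiffAt_denInv hc h0).pow 2).mul (ContDiffAt.clm_apply_const (volPowLam ε hε hε').op
    (((contDiffAt_denQuot hc).pow 2).mul hη))

theorem contDiffAt_solφ (hc : ContDiffAt ℝ ∞ c z₀) (hb : ContDiffAt ℝ ∞ b z₀)
    (hη : ContDiffAt ℝ ∞ η z₀) (h0 : 0 < c z₀) :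
    ContDiffAt ℝ ∞ (fun z => solφ ε hε hε' (c z) (b z) (η z)) z₀ := by
  have h1 := contDiffAt_partφ ε hε hε' hc hη h0
  have h2 : ContDiffAt ℝ ∞ (fun z => constφ ε hε hε' (c z) (b z) (η z)) z₀ :=
    (hb.mul ((contDiffAt_den_zero hc).pow 2)).neg.add
    (((contDiffAt_const.mul (contDiffAt_den_zero hc)).div_const _).mul
      (ContDiffAt.clm_apply_const evalZero (h1.clm_apply_const (volPowOne ε hε hε').op)))
  exact h1.add (h2.smul (contDiffAt_const.mul ((contDiffAt_denInv hc h0).pow 2)))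

theorem contDiffAt_solDataφ (hc : ContDiffAt ℝ ∞ c z₀) (hb : ContDiffAt ℝ ∞ b z₀)
    (hη : ContDiffAt ℝ ∞ η z₀) (h0 : 0 < c z₀) :
    ContDiffAt ℝ ∞ (fun z => solDataφ ε hε hε' (c z) (b z) (η z)) z₀ :=
  hη.add ((contDiffAt_const.mul hc).smul (((contDiffAt_denInv hc h0).mul contDiffAt_const).mul
    (contDiffAt_solφ ε hε hε' hc hb hη h0)))

end smooth

theorem contDiffAt_linSol {q : (ℝ × EuclideanSpace ℝ (Fin 2)) × Cb × Cb} (hq : -1 < q.1.1) :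
    ContDiffAt ℝ ∞ (linSol ε hε hε') q := by
  have hc : ContDiffAt ℝ ∞
      (fun q : (ℝ × EuclideanSpace ℝ (Fin 2)) × Cb × Cb => q.1.1 + 1) q := by fun_prop
  have hb : ∀ i, ContDiffAt ℝ ∞
      (fun q : (ℝ × EuclideanSpace ℝ (Fin 2)) × Cb × Cb => q.1.2 i) q := fun i => by fun_prop
  have h0 : 0 < q.1.1 + 1 := by linarith
  refine ContDiffAt.clm_apply_const (reconstruct ε hε hε') ?_
  exact (contDiffAt_solDataθ hc (hb 0) (by fun_prop) h0).prodMk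
    ((contDiffAt_solDataφ ε hε hε' hc (hb 1) (by fun_prop) h0).prodMk
      (ContDiffAt.clm_apply_const evalZero (contDiffAt_solφ ε hε hε' hc (hb 1) (by fun_prop) h0)))

theorem linSol_zero (γ : ℝ) : linSol ε hε hε' ((γ, 0), 0) = 0 := by
  simp [linSol, solDataθ, solDerivθ, solθ, solDataφ, solφ, constφ, partφ]
  exact map_zero (reconstruct ε hε hε')

end

/-! ### The linearized equations -/

/-- Since `(1 + x) den' = -c`, the function `den ^ 2` is the integrating factor of both scalar
equations. -/
theorem hasDerivAt_mul_den_sq {c : ℝ} (hc : 0 < c) {g : ℝ → ℝ} {r x : ℝ}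
    (hx : x ∈ Ioo (-1 : ℝ) 1)
    (h : HasDerivAt g ((2 * c / den c x * g x + r) / (1 + x)) x) :
    HasDerivAt (fun y => g y * den c y ^ 2) (r * den c x ^ 2 / (1 + x)) x := by
  have hd := den_pos hc ⟨hx.1, hx.2.le⟩
  have h0 : 0 < 1 + x := by linarith [hx.1]
  refine (h.mul ((hasDerivAt_den c hx.1).pow 2)).congr_deriv ?_
  simp only [Pi.pow_apply]
  push_cast
  field_simp
  ring

/-- Difference of two solutions of the first order linear equation. -/
theorem exists_sub_eq_div_den_sq {c : ℝ} (hc : 0 < c) {g₁ g₂ r : ℝ → ℝ}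
    (h₁ : ∀ x ∈ Ioo (-1 : ℝ) 1, HasDerivAt g₁ ((2 * c / den c x * g₁ x + r x) / (1 + x)) x)
    (h₂ : ∀ x ∈ Ioo (-1 : ℝ) 1, HasDerivAt g₂ ((2 * c / den c x * g₂ x + r x) / (1 + x)) x) :
    ∃ A, ∀ x ∈ Ioo (-1 : ℝ) 1, g₁ x - g₂ x = A / den c x ^ 2 := by
  obtain ⟨A, hA⟩ := exists_const_of_hasDerivAt_zero
    (d := fun x => g₁ x * den c x ^ 2 - g₂ x * den c x ^ 2) fun x hx =>
      ((hasDerivAt_mul_den_sq hc hx (h₁ x hx)).sub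
        (hasDerivAt_mul_den_sq hc hx (h₂ x hx))).congr_deriv (sub_self _)
  refine ⟨A, fun x hx => ?_⟩
  have hd := den_pos hc ⟨hx.1, hx.2.le⟩
  rw [eq_div_iff (by positivity), ← hA x hx]
  ring

theorem eqOn_of_firstOrder {c : ℝ} (hc : 0 < c) {g₁ g₂ r : ℝ → ℝ}
    (h₁ : ∀ x ∈ Ioo (-1 : ℝ) 1, HasDerivAt g₁ ((2 * c / den c x * g₁ x + r x) / (1 + x)) x)
    (h₂ : ∀ x ∈ Ioo (-1 : ℝ) 1, HasDerivAt g₂ ((2 * c / den c x * g₂ x + r x) / (1 + x)) x)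
    (h0 : g₁ 0 = g₂ 0) : EqOn g₁ g₂ (Ioo (-1) 1) := by
  obtain ⟨A, hA⟩ := exists_sub_eq_div_den_sq hc h₁ h₂
  have hd := den_pos hc (x := 0) (by norm_num)
  have hA0 := hA 0 mem_zero
  rw [h0, sub_self, eq_comm, div_eq_zero_iff] at hA0
  have : A = 0 := hA0.resolve_right (by positivity)
  intro x hx
  have := hA x hx
  subst A
  rw [zero_div] at this
  linarith

/-- `ln((1+x)/2) / (2 den)`, the primitive of `1 / ((1+x) den²)` that vanishes at `1` -/
def kerPrim (c x : ℝ) : ℝ := Real.log ((1 + x) / 2) / (2 * den c x)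

theorem kerPrim_one (c : ℝ) : kerPrim c 1 = 0 := by
  rw [kerPrim, one_add_one_eq_two, div_self two_ne_zero, Real.log_one, zero_div]

theorem kerPrim_zero (c : ℝ) : kerPrim c 0 = -(Real.log 2 / (2 * den c 0)) := by
  rw [kerPrim, add_zero, one_div, Real.log_inv, neg_div]

theorem hasDerivAt_kerPrim {c : ℝ} (hc : 0 < c) {x : ℝ} (hx : x ∈ Ioc (-1 : ℝ) 1) :
    HasDerivAt (kerPrim c) (1 / ((1 + x) * den c x ^ 2)) x := by
  have hd := den_pos hc hx
  have h0 : 0 < 1 + x := by linarith [hx.1]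
  have h1 : HasDerivAt (fun y : ℝ => Real.log ((1 + y) / 2)) (1 / (1 + x)) x := by
    refine ((((hasDerivAt_onePlus x).div_const 2)).log (by positivity)).congr_deriv ?_
    field_simp
  refine (h1.div ((hasDerivAt_den c hx.1).const_mul 2) (by positivity)).congr_deriv ?_
  have : den c x = 2 - c * Real.log ((1 + x) / 2) := rfl
  field_simp
  rw [this]
  ring

/-- The mean value theorem needs only continuity at `1`; this is the counterpart at the right end of
`eq_zero_of_hasDerivAt_zero`. -/
theorem eq_zero_of_hasDerivAt_zero_right {d : ℝ → ℝ}
    (h : ∀ x ∈ Ioo (-1 : ℝ) 1, HasDerivAt d 0 x) (hc : ContinuousOn d (Ioc (-1) 1)) (h1 : d 1 = 0)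
    {x : ℝ} (hx : x ∈ Ioo (-1 : ℝ) 1) : d x = 0 := by
  obtain ⟨y, hy, hy'⟩ := exists_hasDerivAt_eq_slope d (fun _ => 0) hx.2
    (hc.mono fun y hy => ⟨hx.1.trans_le hy.1, hy.2⟩) fun y hy => h y ⟨hx.1.trans hy.1, hy.2⟩
  have : 0 < 1 - x := by linarith [hx.2]
  rw [h1, eq_div_iff this.ne'] at hy'
  linarith

/-- Uniqueness for the linearized swirl equation. -/
theorem eqOn_of_secondOrder {c : ℝ} (hc : 0 < c) {w₁ w₂ p₁ p₂ r : ℝ → ℝ}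
    (hw₁ : ∀ x ∈ Ioo (-1 : ℝ) 1, HasDerivAt w₁ (p₁ x / (1 + x)) x)
    (hw₂ : ∀ x ∈ Ioo (-1 : ℝ) 1, HasDerivAt w₂ (p₂ x / (1 + x)) x)
    (h₁ : ∀ x ∈ Ioo (-1 : ℝ) 1, HasDerivAt p₁ ((2 * c / den c x * p₁ x + r x) / (1 + x)) x)
    (h₂ : ∀ x ∈ Ioo (-1 : ℝ) 1, HasDerivAt p₂ ((2 * c / den c x * p₂ x + r x) / (1 + x)) x)
    (hc₁ : ContinuousOn w₁ (Ioc (-1) 1)) (hc₂ : ContinuousOn w₂ (Ioc (-1) 1))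
    (hr₁ : w₁ 1 = 0) (hr₂ : w₂ 1 = 0) (h0 : w₁ 0 = w₂ 0) : EqOn w₁ w₂ (Ioo (-1) 1) := by
  obtain ⟨A, hA⟩ := exists_sub_eq_div_den_sq hc h₁ h₂
  -- The slopes `p₁`, `p₂` differ by `A / den ^ 2`, so `w₁ - w₂` is `A` times the primitive
  -- vanishing at `1`. That primitive is nonzero at `0`, so equal values at `0` give `A = 0`.
  have key : ∀ x ∈ Ioo (-1 : ℝ) 1, w₁ x - w₂ x - A * kerPrim c x = 0 := by
    intro x hx
    refine eq_zero_of_hasDerivAt_zero_right (d := fun x => w₁ x - w₂ x - A * kerPrim c x)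
      (fun y hy => ?_) ((hc₁.sub hc₂).sub (continuousOn_const.mul fun y hy =>
        (hasDerivAt_kerPrim hc hy).continuousAt.continuousWithinAt))
      (by simp [hr₁, hr₂, kerPrim_one]) hx
    refine (((hw₁ y hy).sub (hw₂ y hy)).sub ((hasDerivAt_kerPrim hc
      ⟨hy.1, hy.2.le⟩).const_mul A)).congr_deriv ?_
    rw [← sub_div, hA y hy]
    have hd := den_pos hc ⟨hy.1, hy.2.le⟩
    have h0 : 0 < 1 + y := by linarith [hy.1]
    field_simp
    ring
  have k0 := key 0 mem_zero
  have hd := den_pos hc (x := 0) (by norm_num)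
  have hlog := Real.log_pos one_lt_two
  rw [h0, sub_self, zero_sub, neg_eq_zero, kerPrim_zero] at k0
  have hA0 : A = 0 := (mul_eq_zero.1 k0).resolve_right (neg_ne_zero.2 (by positivity))
  intro x hx
  have := key x hx
  rw [hA0] at this
  linarith

/-! ### Properties of the solution operator -/

section linear

variable {c b : ℝ} {η P : Cb} {x : ℝ}

/-- `f / (1 - x)` for the solution `f` of the linearized equation -/
def solFun (c b : ℝ) (η : Cb) (x : ℝ) : ℝ :=
  (volLog.prim (denQuot c ^ 2 * (volLam 1).op η) x + b * den c 0 ^ 2) / den c x ^ 2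

theorem solθ_apply (hc : 0 < c) (hx : x ∈ Ioo (-1 : ℝ) 1) :
    extZero (solθ c b η) x = lam x * solFun c b η x := by
  have hl := lam_pos ⟨hx.1, hx.2.le⟩
  have hd := den_pos hc ⟨hx.1, hx.2.le⟩
  rw [solθ, extZero_mul, extZero_pow hx, denInv_apply hc hx, extZero_add, extZero_smul,
    lamInv_apply hx, Volterra.op_apply _ _ hx, solFun]
  change (lam x / den c x) ^ 2 * ((lam x)⁻¹ * _ + _) = _
  field_simp

theorem solFun_zero (hc : 0 < c) : solFun c b η 0 = b := by
  have hd := den_pos hc (x := 0) (by norm_num)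
  have h : volLog.prim (denQuot c ^ 2 * (volLam 1).op η) 0 = 0 := volLog.prim_base _
  rw [solFun, h]
  field_simp
  ring

/-- Variation of constants with the integrating factor `den ^ 2`. -/
theorem hasDerivAt_solFun (hc : 0 < c) (hx : x ∈ Ioo (-1 : ℝ) 1) :
    HasDerivAt (solFun c b η)
      ((2 * c / den c x * solFun c b η x + (volLam 1).prim η x) / (1 + x)) x := by
  have hl := lam_pos ⟨hx.1, hx.2.le⟩
  have hd := den_pos hc ⟨hx.1, hx.2.le⟩
  have h0 : 0 < 1 + x := by linarith [hx.1]
  have h := ((volLog.hasDerivAt_prim (denQuot c ^ 2 * (volLam 1).op η) hx).add_const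
    (b * den c 0 ^ 2)).div ((hasDerivAt_den c hx.1).pow 2) (pow_pos hd 2).ne'
  refine h.congr_deriv ?_
  rw [extZero_mul, extZero_pow hx, denQuot_apply c hx, volLam_op_apply 1 η hx]
  change (1 / (1 + x) * _ * _ - _) / _ = _
  simp only [Pi.pow_apply, solFun]
  push_cast
  field_simp
  ring

/-- `(1 + x) (f / (1 - x))'` -/
def solDerivFun (c b : ℝ) (η : Cb) (x : ℝ) : ℝ :=
  2 * c / den c x * solFun c b η x + (volLam 1).prim η x

theorem solDerivθ_apply (hc : 0 < c) (hx : x ∈ Ioo (-1 : ℝ) 1) :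
    extZero (solDerivθ c b η) x = lam x ^ 2 * solDerivFun c b η x := by
  have hl := lam_pos ⟨hx.1, hx.2.le⟩
  have hd := den_pos hc ⟨hx.1, hx.2.le⟩
  rw [solDerivθ, extZero_add, extZero_smul, extZero_mul, denInv_apply hc hx, solθ_apply hc hx,
    volLam_op_apply 1 η hx, solDerivFun]
  field_simp
  ring

/-- Differentiating the equation once more, with `(1 / den)' = c / ((1 + x) den ^ 2)`, explains each
summand of `solDataθ`. -/
theorem hasDerivAt_solDerivFun (hc : 0 < c) (hx : x ∈ Ioo (-1 : ℝ) 1) :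
    HasDerivAt (solDerivFun c b η)
      (extZero (solDataθ c b η) x / ((1 + x) * lam x ^ 3)) x := by
  have hl := lam_pos ⟨hx.1, hx.2.le⟩
  have hd := den_pos hc ⟨hx.1, hx.2.le⟩
  have h0 : 0 < 1 + x := by linarith [hx.1]
  have h := (((hasDerivAt_const x (2 * c)).div (hasDerivAt_den c hx.1) hd.ne').mul
    (hasDerivAt_solFun (b := b) (η := η) hc hx)).add (volLam_prim_hasDerivAt 1 η hx)
  refine h.congr_deriv ?_
  rw [solDataθ, extZero_add, extZero_add, extZero_smul, extZero_smul, extZero_mul, extZero_mul,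
    extZero_pow hx, denInv_apply hc hx, solθ_apply hc hx, solDerivθ_apply hc hx, solDerivFun]
  simp only [Pi.div_apply]
  field_simp
  ring

/-- Both sides have the same derivative and are `O(lam⁻²)` at `-1`, so no constant of integration is
lost in passing to second order data. -/
theorem prim_solDataθ (hc : 0 < c) (hx : x ∈ Ioo (-1 : ℝ) 1) :
    (volLam 1).prim (solDataθ c b η) x = solDerivFun c b η x := by
  refine sub_eq_zero.1 (eq_zero_of_hasDerivAt_zero
    (d := fun x => (volLam 1).prim (solDataθ c b η) x - solDerivFun c b η x)
    (fun y hy => ((volLam_prim_hasDerivAt 1 _ hy).sub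
      (hasDerivAt_solDerivFun hc hy)).congr_deriv (sub_self _))
    (tendsto_zero_of_lam_mul_bdd (C := ‖solDataθ c b η‖ + ‖solDerivθ c b η‖) fun y hy => ?_) hx)
  have hl := two_le_lam ⟨hy.1, hy.2.le⟩
  have h1 := volLam_prim_bound 1 (solDataθ c b η) hy
  have h2 := abs_extZero_le (φ := solDerivθ c b η) (x := y)
  rw [solDerivθ_apply hc hy] at h2
  have h3 := (abs_sub (lam y ^ (1 + 1) * (volLam 1).prim (solDataθ c b η) y)
    (lam y ^ 2 * solDerivFun c b η y)).trans (add_le_add h1 h2)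
  refine le_trans ?_ h3
  rw [one_add_one_eq_two, ← mul_sub, pow_two, mul_assoc, abs_mul (lam y), abs_mul (lam y),
    abs_mul (lam y)]
  refine le_mul_of_one_le_left (by positivity) ?_
  rw [abs_of_pos (by linarith)]
  linarith

/-- The same argument one integration lower: `reconstruct` returns precisely the variation of
constants solution. -/
theorem doublePrim_solDataθ (hc : 0 < c) (hx : x ∈ Ioo (-1 : ℝ) 1) :
    doublePrim (solDataθ c b η) x = solFun c b η x := by
  refine sub_eq_zero.1 (eq_zero_of_hasDerivAt_zero
    (d := fun x => doublePrim (solDataθ c b η) x - solFun c b η x)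
    (fun y hy => ((doublePrim_hasDerivAt _ hy).sub (hasDerivAt_solFun hc hy)).congr_deriv ?_)
    (tendsto_zero_of_lam_mul_bdd (C := ‖solDataθ c b η‖ + ‖solθ c b η‖) fun y hy => ?_) hx)
  · rw [prim_solDataθ hc hy]
    exact sub_self _
  · have h1 := doublePrim_bound (solDataθ c b η) hy
    have h2 := abs_extZero_le (φ := solθ c b η) (x := y)
    rw [solθ_apply hc hy] at h2
    rw [mul_sub]
    exact (abs_sub _ _).trans (add_le_add h1 h2)

variable (ε : ℝ) (hε : 0 < ε) (hε' : ε ≤ 1)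

/-- `(1 + x) w'` for the solution `w` of the linearized swirl equation -/
def slopeSol (c b : ℝ) (P : Cb) (x : ℝ) : ℝ :=
  ((volPowLam ε hε hε').prim (denQuot c ^ 2 * P) x + constφ ε hε hε' c b P) / den c x ^ 2

theorem partφ_apply (hc : 0 < c) (hx : x ∈ Ioo (-1 : ℝ) 1) :
    extZero (partφ ε hε hε' c P) x
      = (1 + x) ^ ε * ((volPowLam ε hε hε').prim (denQuot c ^ 2 * P) x / den c x ^ 2) := by
  have hl := lam_pos ⟨hx.1, hx.2.le⟩
  have hd := den_pos hc ⟨hx.1, hx.2.le⟩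
  rw [partφ, extZero_mul, extZero_pow hx, denInv_apply hc hx, Volterra.op_apply _ _ hx]
  change (lam x / den c x) ^ 2 * ((1 + x) ^ ε * (lam x ^ 2)⁻¹ * _) = _
  field_simp

theorem powLamCb_mul_apply (hc : 0 < c) (hx : x ∈ Ioo (-1 : ℝ) 1) :
    extZero (powLamCb ε hε hε' * denInv c ^ 2) x = (1 + x) ^ ε * (1 / den c x ^ 2) := by
  have hl := lam_pos ⟨hx.1, hx.2.le⟩
  have hd := den_pos hc ⟨hx.1, hx.2.le⟩
  rw [powLamCb, extZero_mul, extZero_mul, extZero_pow hx, extZero_pow hx, lamInv_apply hx,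
    denInv_apply hc hx, powCb, extZero_mk hx]
  field_simp

theorem solφ_apply (hc : 0 < c) (hx : x ∈ Ioo (-1 : ℝ) 1) :
    extZero (solφ ε hε hε' c b P) x = (1 + x) ^ ε * slopeSol ε hε hε' c b P x := by
  rw [solφ, extZero_add, extZero_smul, partφ_apply ε hε hε' hc hx,
    powLamCb_mul_apply ε hε hε' hc hx, slopeSol]
  ring

theorem hasDerivAt_slopeSol (hc : 0 < c) (hx : x ∈ Ioo (-1 : ℝ) 1) :
    HasDerivAt (slopeSol ε hε hε' c b P) ((2 * c / den c x * slopeSol ε hε hε' c b P x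
      + extZero P x / (1 + x) ^ ε) / (1 + x)) x := by
  have hl := lam_pos ⟨hx.1, hx.2.le⟩
  have hd := den_pos hc ⟨hx.1, hx.2.le⟩
  have h0 : 0 < 1 + x := by linarith [hx.1]
  have hp := onePlus_rpow_pos ε hx.1
  have h := (((volPowLam ε hε hε').hasDerivAt_prim (denQuot c ^ 2 * P) hx).add_const
    (constφ ε hε hε' c b P)).div ((hasDerivAt_den c hx.1).pow 2) (pow_pos hd 2).ne'
  refine h.congr_deriv ?_
  rw [extZero_mul, extZero_pow hx, denQuot_apply c hx]
  change ((1 + x) ^ (-ε - 1) * lam x ^ 2 * _ * _ - _) / _ = _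
  rw [onePlus_rpow_neg_sub_one ε hx.1]
  simp only [Pi.pow_apply, slopeSol]
  push_cast
  field_simp
  ring

/-- The slope may be unbounded at `-1`, so its constant of integration is fixed at `0` instead. This
is why the data of `reconstruct` contain a real number besides two elements of `Cb`. -/
theorem slopeFun_solDataφ (hc : 0 < c) (hx : x ∈ Ioo (-1 : ℝ) 1) :
    slopeFun ε hε hε' (solDataφ ε hε hε' c b P) (evalZero (solφ ε hε hε' c b P)) x
      = slopeSol ε hε hε' c b P x := by
  obtain ⟨A, hA⟩ := exists_const_of_hasDerivAt_zero
    (d := fun x => slopeFun ε hε hε' (solDataφ ε hε hε' c b P)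
      (evalZero (solφ ε hε hε' c b P)) x - slopeSol ε hε hε' c b P x) fun y hy => by
      refine ((slopeFun_hasDerivAt ε hε hε' _ _ hy).sub
        (hasDerivAt_slopeSol ε hε hε' hc hy)).congr_deriv ?_
      have hl := lam_pos ⟨hy.1, hy.2.le⟩
      have hd := den_pos hc ⟨hy.1, hy.2.le⟩
      have h0 : 0 < 1 + y := by linarith [hy.1]
      have hp := onePlus_rpow_pos ε hy.1
      rw [solDataφ, extZero_add, extZero_smul, extZero_mul, extZero_mul, denInv_apply hc hy,
        lamInv_apply hy, solφ_apply ε hε hε' hc hy, onePlus_rpow_neg_sub_one ε hy.1]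
      field_simp
      ring
  have h1 := hA x hx
  have h2 := hA 0 mem_zero
  have h3 : (volPowZero ε hε hε').prim (solDataφ ε hε hε' c b P) 0 = 0 :=
    (volPowZero ε hε hε').prim_base _
  rw [evalZero_apply, solφ_apply ε hε hε' hc mem_zero, slopeFun, h3, add_zero, add_zero,
    Real.one_rpow, one_mul, sub_self] at h2
  rw [← h2] at h1
  exact sub_eq_zero.1 h1

theorem slopeCb_solDataφ (hc : 0 < c) :
    slopeCb ε hε hε' (solDataφ ε hε hε' c b P) (evalZero (solφ ε hε hε' c b P))
      = solφ ε hε hε' c b P :=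
  Cb.ext_on fun x hx => by
    rw [slopeCb_apply ε hε hε' _ _ hx, slopeFun_solDataφ ε hε hε' hc hx, solφ_apply ε hε hε' hc hx]

/-- Makes the homogeneous part of the swirl explicit; the factor in `constφ` is `-1 / kerPrim c 0`.
-/
theorem volPowOne_prim_ker (hc : 0 < c) (hx : x ∈ Ioo (-1 : ℝ) 1) :
    (volPowOne ε hε hε').prim (powLamCb ε hε hε' * denInv c ^ 2) x = kerPrim c x := by
  refine sub_eq_zero.1 (eq_zero_of_hasDerivAt_zero_right (d := fun x =>
    (volPowOne ε hε hε').prim (powLamCb ε hε hε' * denInv c ^ 2) x - kerPrim c x)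
    (fun y hy => ?_) (((volPowOne ε hε hε').continuousOn_prim _).sub fun y hy =>
      (hasDerivAt_kerPrim hc hy).continuousAt.continuousWithinAt) ?_ hx)
  · refine (((volPowOne ε hε hε').hasDerivAt_prim _ hy).sub (hasDerivAt_kerPrim hc
      ⟨hy.1, hy.2.le⟩)).congr_deriv ?_
    have hd := den_pos hc ⟨hy.1, hy.2.le⟩
    have h0 : 0 < 1 + y := by linarith [hy.1]
    have hp := onePlus_rpow_pos ε hy.1
    rw [powLamCb_mul_apply ε hε hε' hc hy]
    change (1 + y) ^ (-ε - 1) * _ - _ = 0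
    rw [onePlus_rpow_neg_sub_one ε hy.1]
    field_simp
    ring
  · have : (volPowOne ε hε hε').prim (powLamCb ε hε hε' * denInv c ^ 2) 1 = 0 :=
      (volPowOne ε hε hε').prim_base _
    rw [this, kerPrim_one, sub_zero]

theorem evalZero_volPowOne (φ : Cb) :
    evalZero ((volPowOne ε hε hε').op φ) = (volPowOne ε hε hε').prim φ 0 := by
  rw [evalZero_apply, Volterra.op_apply _ _ mem_zero]
  change (1 + 0) ^ ε * _ = _
  rw [add_zero, Real.one_rpow, one_mul]

/-- `constφ` cancels the value of the particular solution at `0`. What remains is `b` times the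
value at `0` of the second component of `kerTwo`. -/
theorem recφ_zero (hc : 0 < c) :
    recφ ε hε hε' (solDataφ ε hε hε' c b P) (evalZero (solφ ε hε hε' c b P)) 0
      = b * (den c 0 * Real.log 2 / 2) := by
  have hd := den_pos hc (x := 0) (by norm_num)
  have hlog := Real.log_pos one_lt_two
  rw [recφ_of_Ioc ε hε hε' _ _ (by norm_num), slopeCb_solDataφ ε hε hε' hc, solφ,
    Volterra.prim_add _ _ _ (by norm_num), Volterra.prim_smul,
    volPowOne_prim_ker ε hε hε' hc mem_zero, kerPrim_zero, constφ, evalZero_volPowOne]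
  field_simp
  ring

end linear

/-! ### Explicit form of the kernel elements -/

section kernel

variable {γ x : ℝ}

theorem Ubarθ_eq (hγ : -1 < γ) (hx : x ∈ Ioc (-1 : ℝ) 1) :
    Ubarθ γ x = (1 - x) * (1 - 2 * (γ + 1) / den (γ + 1) x) := by
  have hd := den_pos (c := γ + 1) (by linarith) hx
  have h : (γ + 1) * Real.log ((1 + x) / 2) - 2 = -den (γ + 1) x := by unfold den; ring
  rw [Ubarθ, h, div_neg]
  ring

theorem uIcc_zero_subset (hx : x ∈ Ioo (-1 : ℝ) 1) : uIcc 0 x ⊆ Ioo (-1) 1 := by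
  intro y hy
  exact ⟨(lt_min (by norm_num) hx.1).trans_le hy.1, hy.2.trans_lt (max_lt (by norm_num) hx.2)⟩

theorem continuousOn_den (c : ℝ) : ContinuousOn (den c) (Ioo (-1) 1) := fun _ hx =>
  (hasDerivAt_den c hx.1).continuousAt.continuousWithinAt

theorem continuousOn_Ubarθ (hγ : -1 < γ) : ContinuousOn (Ubarθ γ) (Ioo (-1) 1) := by
  have h1 : ContinuousOn (fun x : ℝ => 1 - x) (Ioo (-1) 1) := by fun_prop
  refine (h1.mul (continuousOn_const.sub (continuousOn_const.div (continuousOn_den (γ + 1))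
    fun x hx => (den_pos (by linarith) ⟨hx.1, hx.2.le⟩).ne'))).congr fun x hx =>
      Ubarθ_eq hγ ⟨hx.1, hx.2.le⟩

theorem one_sub_sq_ne_zero (hx : x ∈ Ioo (-1 : ℝ) 1) : 1 - x ^ 2 ≠ 0 := by
  have : 0 < (1 - x) * (1 + x) := mul_pos (by linarith [hx.2]) (by linarith [hx.1])
  nlinarith

/-- The integrand splits as `1 / (1 - s) - 2 c / ((1 + s) den)`, whose primitive is elementary. -/
theorem exp_neg_aFun (hγ : -1 < γ) (hx : x ∈ Ioo (-1 : ℝ) 1) :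
    Real.exp (-aFun γ x) = (1 - x) * (den (γ + 1) 0 ^ 2 / den (γ + 1) x ^ 2) := by
  have hc : 0 < γ + 1 := by linarith
  have hsub := uIcc_zero_subset hx
  have hdx := den_pos hc ⟨hx.1, hx.2.le⟩
  have hd0 := den_pos hc (x := 0) (by norm_num)
  have h1 : 0 < 1 - x := by linarith [hx.2]
  have hcont : ContinuousOn (fun s => (2 * s + Ubarθ γ s) / (1 - s ^ 2)) (Ioo (-1) 1) :=
    ContinuousOn.div (ContinuousOn.add (by fun_prop) (continuousOn_Ubarθ hγ)) (by fun_prop)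
      fun s hs => one_sub_sq_ne_zero hs
  have key : aFun γ x = (2 * Real.log (den (γ + 1) x) - Real.log (1 - x))
      - (2 * Real.log (den (γ + 1) 0) - Real.log (1 - 0)) := by
    refine intervalIntegral.integral_eq_sub_of_hasDerivAt
      (f := fun x => 2 * Real.log (den (γ + 1) x) - Real.log (1 - x)) (fun y hy => ?_)
      (hcont.mono hsub).intervalIntegrable
    have hy' := hsub hy
    have hd := den_pos hc ⟨hy'.1, hy'.2.le⟩
    have h2 : 0 < 1 - y := by linarith [hy'.2]
    have h3 : 0 < 1 + y := by linarith [hy'.1]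
    have h4 := one_sub_sq_ne_zero hy'
    refine ((((hasDerivAt_den (γ + 1) hy'.1).log hd.ne').const_mul 2).sub
      ((hasDerivAt_oneSub y).log h2.ne')).congr_deriv ?_
    rw [Ubarθ_eq hγ ⟨hy'.1, hy'.2.le⟩, show 1 - y ^ 2 = (1 - y) * (1 + y) by ring]
    field_simp
    ring
  rw [key, sub_zero, Real.log_one, sub_zero]
  have e : -(2 * Real.log (den (γ + 1) x) - Real.log (1 - x) - 2 * Real.log (den (γ + 1) 0))
      = Real.log ((1 - x) * (den (γ + 1) 0 ^ 2 / den (γ + 1) x ^ 2)) := by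
    rw [Real.log_mul h1.ne' (by positivity), Real.log_div (by positivity) (by positivity),
      Real.log_pow, Real.log_pow]
    push_cast
    ring
  rw [e, Real.exp_log (by positivity)]

/-- Here the integrand is `1 / (1 + s) - 2 c / ((1 + s) den)`. -/
theorem exp_neg_bFun (hγ : -1 < γ) (hx : x ∈ Ioo (-1 : ℝ) 1) :
    Real.exp (-bFun γ x) = den (γ + 1) 0 ^ 2 * (1 / ((1 + x) * den (γ + 1) x ^ 2)) := by
  have hc : 0 < γ + 1 := by linarith
  have hsub := uIcc_zero_subset hx
  have hdx := den_pos hc ⟨hx.1, hx.2.le⟩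
  have hd0 := den_pos hc (x := 0) (by norm_num)
  have h1 : 0 < 1 + x := by linarith [hx.1]
  have hcont : ContinuousOn (fun s => Ubarθ γ s / (1 - s ^ 2)) (Ioo (-1) 1) :=
    ContinuousOn.div (continuousOn_Ubarθ hγ) (by fun_prop) fun s hs => one_sub_sq_ne_zero hs
  have key : bFun γ x = (2 * Real.log (den (γ + 1) x) + Real.log (1 + x))
      - (2 * Real.log (den (γ + 1) 0) + Real.log (1 + 0)) := by
    refine intervalIntegral.integral_eq_sub_of_hasDerivAt
      (f := fun x => 2 * Real.log (den (γ + 1) x) + Real.log (1 + x)) (fun y hy => ?_)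
      (hcont.mono hsub).intervalIntegrable
    have hy' := hsub hy
    have hd := den_pos hc ⟨hy'.1, hy'.2.le⟩
    have h2 : 0 < 1 - y := by linarith [hy'.2]
    have h3 : 0 < 1 + y := by linarith [hy'.1]
    refine ((((hasDerivAt_den (γ + 1) hy'.1).log hd.ne').const_mul 2).add
      ((hasDerivAt_onePlus y).log h3.ne')).congr_deriv ?_
    rw [Ubarθ_eq hγ ⟨hy'.1, hy'.2.le⟩, show 1 - y ^ 2 = (1 - y) * (1 + y) by ring]
    field_simp
    ring
  rw [key, add_zero, Real.log_one, add_zero]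
  have e : -(2 * Real.log (den (γ + 1) x) + Real.log (1 + x) - 2 * Real.log (den (γ + 1) 0))
      = Real.log (den (γ + 1) 0 ^ 2 * (1 / ((1 + x) * den (γ + 1) x ^ 2))) := by
    rw [one_div, Real.log_mul (by positivity) (by positivity), Real.log_inv,
      Real.log_mul (by positivity) (by positivity), Real.log_pow, Real.log_pow]
    push_cast
    ring
  rw [e, Real.exp_log (by positivity)]

theorem kerTwo_eq (hγ : -1 < γ) (hx : x ∈ Ioo (-1 : ℝ) 1) :
    (kerTwo γ).2 x = -(den (γ + 1) 0 ^ 2 * kerPrim (γ + 1) x) := by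
  have hc : 0 < γ + 1 := by linarith
  have hsub : uIcc x 1 ⊆ Ioc (-1) 1 := by
    rw [uIcc_of_le hx.2.le]
    exact fun y hy => ⟨hx.1.trans_le hy.1, hy.2⟩
  have h1 : (kerTwo γ).2 x
      = ∫ t in x..1, den (γ + 1) 0 ^ 2 * (1 / ((1 + t) * den (γ + 1) t ^ 2)) := by
    refine intervalIntegral.integral_congr_ae ?_
    exact ae_uIoc_of_forall_Ioo ⟨hx.1.le, hx.2.le⟩ (by norm_num) fun s hs => exp_neg_bFun hγ hs
  have hcont : ContinuousOn (fun t => 1 / ((1 + t) * den (γ + 1) t ^ 2)) (Ioc (-1) 1) := by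
    refine continuousOn_const.div (ContinuousOn.mul (by fun_prop) (ContinuousOn.pow (fun y hy =>
      (hasDerivAt_den _ hy.1).continuousAt.continuousWithinAt) 2)) fun y hy => ?_
    have hd := den_pos hc hy
    have h3 : 0 < 1 + y := by linarith [hy.1]
    positivity
  have h2 := intervalIntegral.integral_eq_sub_of_hasDerivAt (f := kerPrim (γ + 1))
    (fun y hy => hasDerivAt_kerPrim hc (hsub hy)) (hcont.mono hsub).intervalIntegrable
  rw [h1, intervalIntegral.integral_const_mul, h2, kerPrim_one]
  ring

end kernel

/-! ### Characterization of the solution operator -/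

theorem X.eq_of_agreeOn {ε : ℝ} {v w : X ε} (h : AgreeOn v.pair w.pair) : v = w := by
  refine X.pair_injective (Prod.ext (funext fun x => ?_) (funext fun x => ?_))
  · by_cases hx : x ∈ Ioo (-1 : ℝ) 1
    · exact h.1 hx
    · by_cases hx' : x ∈ Icc (-1 : ℝ) 1
      · rcases hx'.1.eq_or_lt with rfl | h1
        · rw [v.mem₁.left, w.mem₁.left]
        · rcases hx'.2.eq_or_lt with rfl | h2
          · rw [v.mem₁.right, w.mem₁.right]
          · exact absurd ⟨h1, h2⟩ hx
      · rw [v.mem₁.eq_zero x hx', w.mem₁.eq_zero x hx']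
  · by_cases hx : x ∈ Ioo (-1 : ℝ) 1
    · exact h.2 hx
    · by_cases hx' : x ∈ Ioc (-1 : ℝ) 1
      · rcases hx'.2.eq_or_lt with rfl | h2
        · rw [v.mem₂.right, w.mem₂.right]
        · exact absurd ⟨hx'.1, h2⟩ hx
      · exact (v.mem₂.eq_zero x hx').trans (w.mem₂.eq_zero x hx').symm

/-- `f₁ = (1 - x) g` and `w = f₂` solve the linearized equations with parameter `c` and right hand
sides `r₁`, `r₂` in the variables `g` and `p = (1 + x) w'`. -/
structure SolvesLinear (c : ℝ) (f : Pair) (r₁ r₂ : ℝ → ℝ) : Prop where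
  eqθ : ∀ x ∈ Ioo (-1 : ℝ) 1, HasDerivAt (fun y => f.1 y / (1 - y))
    ((2 * c / den c x * (f.1 x / (1 - x)) + r₁ x) / (1 + x)) x
  diffφ : ∀ x ∈ Ioo (-1 : ℝ) 1, DifferentiableAt ℝ f.2 x
  eqφ : ∀ x ∈ Ioo (-1 : ℝ) 1, HasDerivAt (fun y => (1 + y) * deriv f.2 y)
    ((2 * c / den c x * ((1 + x) * deriv f.2 x) + r₂ x) / (1 + x)) x
  cont : ContinuousOn f.2 (Ioc (-1) 1)
  right : f.2 1 = 0

/-- The first equation leaves one free constant, fixed by the value at `0`. The second leaves two,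
of which `w(1) = 0` fixes one and `w(0)` the other. Hence the values at `0` serve as coordinates. -/
theorem SolvesLinear.agreeOn {c : ℝ} (hc : 0 < c) {f g : Pair} {r₁ r₂ : ℝ → ℝ}
    (hf : SolvesLinear c f r₁ r₂) (hg : SolvesLinear c g r₁ r₂) (h₁ : f.1 0 = g.1 0)
    (h₂ : f.2 0 = g.2 0) : AgreeOn f g := by
  have hw : ∀ {f : Pair}, SolvesLinear c f r₁ r₂ → ∀ x ∈ Ioo (-1 : ℝ) 1,
      HasDerivAt f.2 ((1 + x) * deriv f.2 x / (1 + x)) x := by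
    intro f hf x hx
    have h0 : 1 + x ≠ 0 := by linarith [hx.1]
    rw [mul_div_cancel_left₀ _ h0]
    exact (hf.diffφ x hx).hasDerivAt
  refine ⟨fun x hx => ?_, eqOn_of_secondOrder hc (hw hf) (hw hg) hf.eqφ hg.eqφ hf.cont hg.cont
    hf.right hg.right h₂⟩
  have h := eqOn_of_firstOrder hc hf.eqθ hg.eqθ (by simp [h₁]) hx
  have h0 : 1 - x ≠ 0 := by linarith [hx.2]
  exact (div_left_inj' h0).1 h

section linSol

variable (ε : ℝ) (hε : 0 < ε) (hε' : ε ≤ 1) {γ : ℝ} (β : EuclideanSpace ℝ (Fin 2)) (y : Cb × Cb)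

theorem linSol_fst (hγ : -1 < γ) {x : ℝ} (hx : x ∈ Ioo (-1 : ℝ) 1) :
    (linSol ε hε hε' ((γ, β), y)).pair.1 x = (1 - x) * solFun (γ + 1) (β 0) y.1 x := by
  rw [linSol, reconstruct_pair]
  change recθ _ x = _
  rw [recθ_of_Ioc _ ⟨hx.1, hx.2.le⟩, doublePrim_solDataθ (by linarith) hx]

theorem linSol_fst_zero (hγ : -1 < γ) : (linSol ε hε hε' ((γ, β), y)).pair.1 0 = β 0 := by
  rw [linSol_fst ε hε hε' β y hγ mem_zero, solFun_zero (by linarith), sub_zero, one_mul]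

theorem linSol_snd_zero (hγ : -1 < γ) : (linSol ε hε hε' ((γ, β), y)).pair.2 0
    = β 1 * (den (γ + 1) 0 * Real.log 2 / 2) := by
  rw [linSol, reconstruct_pair]
  exact recφ_zero ε hε hε' (by linarith)

theorem linSol_snd_hasDerivAt (hγ : -1 < γ) {x : ℝ} (hx : x ∈ Ioo (-1 : ℝ) 1) :
    HasDerivAt (linSol ε hε hε' ((γ, β), y)).pair.2
      (slopeSol ε hε hε' (γ + 1) (β 1) y.2 x / (1 + x)) x := by
  rw [linSol, reconstruct_pair, ← slopeFun_solDataφ ε hε hε' (by linarith) hx]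
  exact recφ_hasDerivAt ε hε hε' _ _ hx

theorem linSol_solves (hγ : -1 < γ) : SolvesLinear (γ + 1) (linSol ε hε hε' ((γ, β), y)).pair
    ((volLam 1).prim y.1) (fun x => extZero y.2 x / (1 + x) ^ ε) where
  eqθ x hx := by
    have h := hasDerivAt_solFun (c := γ + 1) (b := β 0) (η := y.1) (by linarith) hx
    have e : ∀ z ∈ Ioo (-1 : ℝ) 1, (linSol ε hε hε' ((γ, β), y)).pair.1 z / (1 - z)
        = solFun (γ + 1) (β 0) y.1 z := fun z hz => by
      rw [linSol_fst ε hε hε' β y hγ hz, mul_div_cancel_left₀ _ (by linarith [hz.2])]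
    rw [e x hx]
    refine h.congr_of_eventuallyEq ?_
    filter_upwards [isOpen_Ioo.mem_nhds hx] with z hz using e z hz
  diffφ x hx := (linSol_snd_hasDerivAt ε hε hε' β y hγ hx).differentiableAt
  eqφ x hx := by
    have h := hasDerivAt_slopeSol ε hε hε' (c := γ + 1) (b := β 1) (P := y.2) (by linarith) hx
    have e : ∀ z ∈ Ioo (-1 : ℝ) 1, (1 + z) * deriv (linSol ε hε hε' ((γ, β), y)).pair.2 z
        = slopeSol ε hε hε' (γ + 1) (β 1) y.2 z := fun z hz => by
      rw [(linSol_snd_hasDerivAt ε hε hε' β y hγ hz).deriv,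
        mul_div_cancel₀ _ (by linarith [hz.1])]
    rw [e x hx]
    refine h.congr_of_eventuallyEq ?_
    filter_upwards [isOpen_Ioo.mem_nhds hx] with z hz using e z hz
  cont := (X.mem₂ _).smooth₁.continuousOn
  right := (X.mem₂ _).right

/-- Uniqueness spares evaluating the integral operators: the explicit kernel elements solve the
homogeneous equations with the same values at `0`. -/
theorem agreeOn_linSol_kernel (hγ : -1 < γ) :
    AgreeOn (linSol ε hε hε' ((γ, β), 0)).pair (β 0 • kerOne γ + β 1 • kerTwo γ) := by
  have hc : 0 < γ + 1 := by linarith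
  have hd0 := den_pos hc (x := 0) (by norm_num)
  let g : Pair := (fun x => (1 - x) * (β 0 * den (γ + 1) 0 ^ 2 / den (γ + 1) x ^ 2),
    fun x => -(β 1 * den (γ + 1) 0 ^ 2) * kerPrim (γ + 1) x)
  have hgd : ∀ x ∈ Ioo (-1 : ℝ) 1, HasDerivAt g.2
      (-(β 1 * den (γ + 1) 0 ^ 2) * (1 / ((1 + x) * den (γ + 1) x ^ 2))) x := fun x hx =>
    (hasDerivAt_kerPrim hc ⟨hx.1, hx.2.le⟩).const_mul _
  have hquot : ∀ (A : ℝ), ∀ x ∈ Ioo (-1 : ℝ) 1, HasDerivAt (fun x => A / den (γ + 1) x ^ 2)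
      ((2 * (γ + 1) / den (γ + 1) x * (A / den (γ + 1) x ^ 2) + 0) / (1 + x)) x := by
    intro A x hx
    have hd := den_pos hc ⟨hx.1, hx.2.le⟩
    have h0 : 0 < 1 + x := by linarith [hx.1]
    refine ((hasDerivAt_const x A).div ((hasDerivAt_den (γ + 1) hx.1).pow 2)
      (pow_pos hd 2).ne').congr_deriv ?_
    simp only [Pi.pow_apply]
    push_cast
    field_simp
    ring
  have hg : SolvesLinear (γ + 1) g ((volLam 1).prim 0) (fun x => extZero 0 x / (1 + x) ^ ε) := by
    have hr1 : ∀ x, (volLam 1).prim 0 x = 0 := fun x => by simp [Volterra.prim, extZero_zero]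
    refine ⟨fun x hx => ?_, fun x hx => (hgd x hx).differentiableAt, fun x hx => ?_, ?_, ?_⟩
    · have e : ∀ z ∈ Ioo (-1 : ℝ) 1, g.1 z / (1 - z)
          = β 0 * den (γ + 1) 0 ^ 2 / den (γ + 1) z ^ 2 := fun z hz =>
        mul_div_cancel_left₀ _ (by linarith [hz.2])
      rw [e x hx, hr1]
      refine (hquot _ x hx).congr_of_eventuallyEq ?_
      filter_upwards [isOpen_Ioo.mem_nhds hx] with z hz using e z hz
    · have e : ∀ z ∈ Ioo (-1 : ℝ) 1, (1 + z) * deriv g.2 z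
          = -(β 1 * den (γ + 1) 0 ^ 2) / den (γ + 1) z ^ 2 := fun z hz => by
        have hd := den_pos hc ⟨hz.1, hz.2.le⟩
        have h0 : 0 < 1 + z := by linarith [hz.1]
        rw [(hgd z hz).deriv]
        field_simp
      rw [e x hx, extZero_zero, zero_div]
      refine (hquot _ x hx).congr_of_eventuallyEq ?_
      filter_upwards [isOpen_Ioo.mem_nhds hx] with z hz using e z hz
    · exact continuousOn_const.mul fun y hy =>
        (hasDerivAt_kerPrim hc hy).continuousAt.continuousWithinAt
    · change _ * kerPrim (γ + 1) 1 = 0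
      rw [kerPrim_one, mul_zero]
  have key := (linSol_solves ε hε hε' β 0 hγ).agreeOn hc hg
    (by
      rw [linSol_fst_zero ε hε hε' β 0 hγ]
      change _ = (1 - 0) * (β 0 * den (γ + 1) 0 ^ 2 / den (γ + 1) 0 ^ 2)
      field_simp
      ring)
    (by
      rw [linSol_snd_zero ε hε hε' β 0 hγ]
      change _ = -(β 1 * den (γ + 1) 0 ^ 2) * kerPrim (γ + 1) 0
      rw [kerPrim_zero]
      field_simp)
  refine ⟨fun x hx => (key.1 hx).trans ?_, fun x hx => (key.2 hx).trans ?_⟩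
  · have h1 : (kerOne γ).1 x = (1 - x) * (den (γ + 1) 0 ^ 2 / den (γ + 1) x ^ 2) :=
      exp_neg_aFun hγ hx
    have h2 : (kerTwo γ).1 x = 0 := rfl
    rw [Prod.fst_add, Pi.add_apply, Prod.smul_fst, Prod.smul_fst, Pi.smul_apply, Pi.smul_apply, h1,
      h2, smul_eq_mul, smul_eq_mul]
    change (1 - x) * (β 0 * den (γ + 1) 0 ^ 2 / den (γ + 1) x ^ 2) = _
    ring
  · have h2 : (kerOne γ).2 x = 0 := rfl
    rw [Prod.snd_add, Pi.add_apply, Prod.smul_snd, Prod.smul_snd, Pi.smul_apply, Pi.smul_apply,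
      kerTwo_eq hγ hx, h2, smul_eq_mul, smul_eq_mul]
    change -(β 1 * den (γ + 1) 0 ^ 2) * kerPrim (γ + 1) x = _
    ring

end linSol

/-! ### The swirl integral -/

section psi

theorem swirlDensity_congr {u v : ℝ → ℝ} (h : EqOn u v (Ioo (-1) 1)) {s : ℝ}
    (hs : s ∈ Ioo (-1 : ℝ) 1) : swirlDensity u s = swirlDensity v s := by
  have h1 : deriv u s = deriv v s :=
    Filter.EventuallyEq.deriv_eq (h.eventuallyEq_of_mem (isOpen_Ioo.mem_nhds hs))
  rw [swirlDensity, swirlDensity, h hs, h1]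

theorem psiInner_congr {u v : ℝ → ℝ} (h : EqOn u v (Ioo (-1) 1)) {l : ℝ}
    (hl : l ∈ Icc (-1 : ℝ) 1) : psiInner u l = psiInner v l := by
  have h1 : (1 : ℝ) ∈ Icc (-1 : ℝ) 1 := by norm_num
  refine intervalIntegral.integral_congr_ae (ae_uIoc_of_forall_Ioo hl h1 fun t ht => ?_)
  exact intervalIntegral.integral_congr_ae (ae_uIoc_of_forall_Ioo ⟨ht.1.le, ht.2.le⟩ h1
    fun s hs => swirlDensity_congr h hs)

theorem psi_congr {u v : ℝ → ℝ} (h : EqOn u v (Ioo (-1) 1)) {x : ℝ}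
    (hx : x ∈ Icc (-1 : ℝ) 1) : psi u x = psi v x :=
  intervalIntegral.integral_congr_ae (ae_uIoc_of_forall_Ioo hx (by norm_num) fun _ hl =>
    psiInner_congr h ⟨hl.1.le, hl.2.le⟩)

variable {ε : ℝ} (hε : 0 < ε) (hε' : ε < 1 / 2) (v : X ε)

/-- `(1+x)^{1+2ε} w w' / (1-x)` for `w = v_φ` -/
def swirlCb : Cb := dataφ ε hε (by linarith) v * dataDerivφ ε v

/-- `σ ↦ (1+x)^r (1-x)⁻² ∫_x^1 ∫_t^1 2 (1+s)^{-2-r} σ` -/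
def innerOp (r : ℝ) (hr : 0 < r) (hr' : r < 1) : Cb →L[ℝ] Cb :=
  (volSwirlTwo r hr hr').op ∘L (volSwirlOne r hr).op

/-- Near `-1` the exponents add up: `ε` from `w`, `1 + ε` from `w'` and `1` from `1 - s²` give `2 +
2ε`. At `1` the pole is cancelled by the zero of `w`, which is kept inside `dataφ`. -/
theorem swirlDensity_eq {s : ℝ} (hs : s ∈ Ioo (-1 : ℝ) 1) : swirlDensity v.pair.2 s
    = (volSwirlOne (2 * ε) (by linarith)).ker s * extZero (swirlCb hε hε' v) s := by
  have h0 : 0 < 1 + s := by linarith [hs.1]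
  have h1 : 0 < 1 - s := by linarith [hs.2]
  have hp := onePlus_rpow_pos ε hs.1
  rw [swirlCb, extZero_mul, dataφ, dataDerivφ, X.toCb_apply v hs, X.toCb_apply v hs]
  change _ = 2 * (1 + s) ^ (-(1 + 2 * ε) - 1) * _
  have h2 : (1 + s) ^ (-(1 + 2 * ε) - 1) * ((1 + s) ^ ε * (1 + s) ^ (1 + ε)) = (1 + s)⁻¹ := by
    rw [← Real.rpow_add h0, ← Real.rpow_add h0, ← Real.rpow_neg_one]
    ring_nf
  rw [swirlDensity, show 1 - s ^ 2 = (1 - s) * (1 + s) by ring]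
  calc 2 * v.pair.2 s * deriv v.pair.2 s / ((1 - s) * (1 + s))
      = 2 * (v.pair.2 s / (1 - s)) * deriv v.pair.2 s * (1 + s)⁻¹ := by field_simp
    _ = _ := by rw [← h2]; ring

theorem swirlDensity_integrable (hε : 0 < ε) (hε' : ε < 1 / 2) (v : X ε)
    {t : ℝ} (ht : t ∈ Ioc (-1 : ℝ) 1) :
    IntervalIntegrable (swirlDensity v.pair.2) volume t 1 := by
  have h := ((volSwirlOne (2 * ε) (by linarith)).integrable_ker_mul (swirlCb hε hε' v) ht).symm
  refine h.congr_ae ?_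
  rw [EventuallyEq, ae_restrict_iff' measurableSet_uIoc]
  filter_upwards [ae_uIoc_of_forall_Ioo ⟨ht.1.le, ht.2⟩ (show (1 : ℝ) ∈ Icc (-1 : ℝ) 1 by norm_num)
    fun s hs => (swirlDensity_eq hε hε' v hs).symm] with s hs using hs

theorem integral_swirlDensity {t : ℝ} (ht : t ∈ Ioc (-1 : ℝ) 1) :
    ∫ s in t..1, swirlDensity v.pair.2 s
      = -(volSwirlOne (2 * ε) (by linarith)).prim (swirlCb hε hε' v) t := by
  rw [Volterra.prim, ← intervalIntegral.integral_symm]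
  exact intervalIntegral.integral_congr_ae (ae_uIoc_of_forall_Ioo ⟨ht.1.le, ht.2⟩ (by norm_num)
    fun s hs => swirlDensity_eq hε hε' v hs)

theorem psiInner_eq_prim {l : ℝ} (hl : l ∈ Ioc (-1 : ℝ) 1) : psiInner v.pair.2 l
    = (volSwirlTwo (2 * ε) (by linarith) (by linarith)).prim
      ((volSwirlOne (2 * ε) (by linarith)).op (swirlCb hε hε' v)) l := by
  rw [Volterra.prim]
  change _ = ∫ s in (1 : ℝ)..l, _
  rw [intervalIntegral.integral_symm, ← intervalIntegral.integral_neg]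
  refine intervalIntegral.integral_congr_ae (ae_uIoc_of_forall_Ioo ⟨hl.1.le, hl.2⟩ (by norm_num)
    fun s hs => ?_)
  have h0 : 0 < 1 + s := by linarith [hs.1]
  have h1 : 0 < 1 - s := by linarith [hs.2]
  have hp := onePlus_rpow_pos (2 * ε) hs.1
  rw [integral_swirlDensity hε hε' v ⟨hs.1, hs.2.le⟩, Volterra.op_apply _ _ hs]
  change _ = -((1 + s) ^ (-(2 * ε) - 1) * (1 - s) * ((1 + s) ^ (1 + 2 * ε) * (1 - s)⁻¹ * _))
  rw [onePlus_rpow_neg_sub_one (2 * ε) hs.1, Real.rpow_add h0, Real.rpow_one]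
  field_simp

theorem psiInner_eq {l : ℝ} (hl : l ∈ Ioo (-1 : ℝ) 1) : psiInner v.pair.2 l
    = (1 + l) ^ (-(2 * ε)) * (1 - l) ^ 2 *
      extZero (innerOp (2 * ε) (by linarith) (by linarith) (swirlCb hε hε' v)) l := by
  have h0 : 0 < 1 + l := by linarith [hl.1]
  have h1 : 0 < 1 - l := by linarith [hl.2]
  have hp := onePlus_rpow_pos (2 * ε) hl.1
  rw [psiInner_eq_prim hε hε' v ⟨hl.1, hl.2.le⟩, innerOp, ContinuousLinearMap.comp_apply,
    Volterra.op_apply _ _ hl]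
  change _ = _ * ((1 + l) ^ (2 * ε) * ((1 - l) ^ 2)⁻¹ * _)
  rw [Real.rpow_neg h0.le]
  field_simp

theorem psi_eq {x : ℝ} (hx : x ∈ Ioc (-1 : ℝ) 1) : psi v.pair.2 x
    = -(volSwirlThree (2 * ε) (by linarith) (by linarith)).prim
      (innerOp (2 * ε) (by linarith) (by linarith) (swirlCb hε hε' v)) x := by
  rw [Volterra.prim, ← intervalIntegral.integral_symm]
  exact intervalIntegral.integral_congr_ae (ae_uIoc_of_forall_Ioo ⟨hx.1.le, hx.2⟩ (by norm_num)
    fun s hs => psiInner_eq hε hε' v hs)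

/-- The integrand is `O((1 + x)^(-2ε))`, integrable at `-1` because `ε < 1/2`; this is the
convergence of `ψ` at `-1`. The factor `4` bounds `(1 - x)²`. -/
theorem psiInner_integrable (hε : 0 < ε) (hε' : ε < 1 / 2) (v : X ε) :
    IntervalIntegrable (psiInner v.pair.2) volume (-1) 1 := by
  set A := innerOp (2 * ε) (by linarith) (by linarith) (swirlCb hε hε' v) with hA
  have hr : 0 < 1 - 2 * ε := by linarith
  refine (intervalIntegrable_of_majorant (a := -1) (x := 1) (by norm_num) (by norm_num)
    (G := fun x => 4 * ‖A‖ * ((1 + x) ^ (1 - 2 * ε) / (1 - 2 * ε)))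
    (g := fun x => 4 * ‖A‖ * (1 + x) ^ (-(2 * ε))) ?_ ?_ ?_ ?_).1
  · have h2 : ContinuousOn (fun l : ℝ => (1 - l) ^ 2) (Ioo (-1) 1) := by fun_prop
    exact ((((continuousOn_onePlus_rpow _).mono Ioo_sub_Ioi).mul h2).mul
      continuousOn_extZero).congr fun l hl => psiInner_eq hε hε' v hl
  · exact continuousOn_const.mul ((ContinuousOn.rpow_const (by fun_prop)
      fun x _ => Or.inr hr.le).div_const _)
  · intro x hx
    refine (((hasDerivAt_onePlus_rpow (1 - 2 * ε) hx.1).div_const (1 - 2 * ε)).const_mul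
      (4 * ‖A‖)).congr_deriv ?_
    rw [show 1 - 2 * ε - 1 = -(2 * ε) by ring]
    field_simp
  · intro x hx
    have hp := onePlus_rpow_pos (-(2 * ε)) hx.1
    rw [psiInner_eq hε hε' v hx, ← hA, abs_mul, abs_mul, abs_of_pos hp,
      abs_of_nonneg (sq_nonneg _)]
    have h4 : (1 - x) ^ 2 ≤ 4 := by nlinarith [hx.1, hx.2]
    calc (1 + x) ^ (-(2 * ε)) * (1 - x) ^ 2 * |extZero A x|
        ≤ (1 + x) ^ (-(2 * ε)) * 4 * ‖A‖ := by
          gcongr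
          exact abs_extZero_le
      _ = _ := by ring

theorem tendsto_psi (hε : 0 < ε) (hε' : ε < 1 / 2) (v : X ε) :
    Tendsto (psi v.pair.2) (𝓝[>] (-1)) (𝓝 (psi v.pair.2 (-1))) := by
  have h := intervalIntegral.continuousOn_primitive_interval' (psiInner_integrable hε hε' v)
    (a := 1) right_mem_uIcc
  have h1 := h.neg (-1) left_mem_uIcc
  have h2 : ∀ x, -(∫ l in (1 : ℝ)..x, psiInner v.pair.2 l) = psi v.pair.2 x := fun x => by
    rw [psi, intervalIntegral.integral_symm, neg_neg]
  have h3 : Tendsto (psi v.pair.2) (𝓝[uIcc (-1) 1] (-1)) (𝓝 (psi v.pair.2 (-1))) := by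
    have h4 : ContinuousWithinAt (fun x => -(∫ l in (1 : ℝ)..x, psiInner v.pair.2 l))
        (uIcc (-1) 1) (-1) := h1
    simp only [h2] at h4
    exact h4
  refine h3.mono_left ?_
  rw [uIcc_of_le (by norm_num), ← nhdsWithin_Ioo_eq_nhdsGT (show (-1 : ℝ) < 1 by norm_num)]
  exact nhdsWithin_mono _ Ioo_subset_Icc_self

theorem hasDerivAt_psi (hε : 0 < ε) (hε' : ε < 1 / 2) (v : X ε) {x : ℝ}
    (hx : x ∈ Ioo (-1 : ℝ) 1) :
    HasDerivAt (psi v.pair.2) (-psiInner v.pair.2 x) x := by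
  have h := ((volSwirlThree (2 * ε) (by linarith) (by linarith)).hasDerivAt_prim
    (innerOp (2 * ε) (by linarith) (by linarith) (swirlCb hε hε' v)) hx).neg
  refine (h.congr_of_eventuallyEq ?_).congr_deriv ?_
  · filter_upwards [isOpen_Ioo.mem_nhds hx] with z hz
    exact psi_eq hε hε' v ⟨hz.1, hz.2.le⟩
  · rw [psiInner_eq hε hε' v hx]
    rfl

/-- `ψ / (1-x)² - ψ(-1) / 4` -/
def swirlForce (x : ℝ) : ℝ := psi v.pair.2 x / (1 - x) ^ 2 - psi v.pair.2 (-1) / 4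

theorem tendsto_swirlForce (hε : 0 < ε) (hε' : ε < 1 / 2) (v : X ε) :
    Tendsto (swirlForce v) (𝓝[>] (-1)) (𝓝 0) := by
  have h1 : Tendsto (fun x : ℝ => (1 - x) ^ 2) (𝓝[>] (-1)) (𝓝 4) := by
    have : Tendsto (fun x : ℝ => (1 - x) ^ 2) (𝓝 (-1)) (𝓝 ((1 - -1) ^ 2)) :=
      (by fun_prop : Continuous fun x : ℝ => (1 - x) ^ 2).tendsto (-1)
    rw [show ((1 : ℝ) - -1) ^ 2 = 4 by norm_num] at this
    exact this.mono_left nhdsWithin_le_nhds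
  have h2 := ((tendsto_psi hε hε' v).div h1 (by norm_num)).sub_const (psi v.pair.2 (-1) / 4)
  rw [sub_self] at h2
  exact h2

/-- `(1+x)^s lam³` as an element of `Cb` -/
def powLamCubeCb (s : ℝ) (hs : 0 < s) : Cb :=
  Cb.mk (fun x => (1 + x) ^ s * lam x ^ 3)
    (exists_rpow_mul_lam_pow_le hs (show 0 < 3 by norm_num)).choose
    (((continuousOn_onePlus_rpow s).mono Ioo_sub_Ioi).mul
      ((continuousOn_lam.mono Ioo_sub_Ioi).pow 3))
    (exists_rpow_mul_lam_pow_le hs (show 0 < 3 by norm_num)).choose_spec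

/-- `σ ↦ (1+x) lam³ (ψ / (1-x)²)'`, with `ψ` the triple integral of `2 (1+s)^{-2-r} σ` -/
def swirlOp (r : ℝ) (hr : 0 < r) (hr' : r < 1) (σ : Cb) : Cb :=
  -(powLamCubeCb (1 - r) (by linarith) * innerOp r hr hr' σ)
    - (2 : ℝ) • (powLamCubeCb 1 one_pos * (volSwirlThree r hr hr').op (innerOp r hr hr' σ))

/-- The spare power `(1 + x)^(1 - 2ε)` absorbs `lam³`, so the swirl force, once its value at `-1` is
subtracted, belongs to the class of right hand sides encoded by `volLam 1`. -/
theorem hasDerivAt_swirlForce {x : ℝ} (hx : x ∈ Ioo (-1 : ℝ) 1) : HasDerivAt (swirlForce v)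
    (extZero (swirlOp (2 * ε) (by linarith) (by linarith) (swirlCb hε hε' v)) x
      / ((1 + x) * lam x ^ 3)) x := by
  have h0 : 0 < 1 + x := by linarith [hx.1]
  have h1 : 0 < 1 - x := by linarith [hx.2]
  have hl := lam_pos ⟨hx.1, hx.2.le⟩
  have hp := onePlus_rpow_pos (2 * ε) hx.1
  have h := ((hasDerivAt_psi hε hε' v hx).div ((hasDerivAt_oneSub x).pow 2)
    (pow_pos h1 2).ne').sub_const (psi v.pair.2 (-1) / 4)
  refine h.congr_deriv ?_
  have e1 : extZero ((volSwirlThree (2 * ε) (by linarith) (by linarith)).op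
      (innerOp (2 * ε) (by linarith) (by linarith) (swirlCb hε hε' v))) x
      = ((1 - x) ^ 3)⁻¹ * -psi v.pair.2 x := by
    rw [psi_eq hε hε' v ⟨hx.1, hx.2.le⟩, neg_neg, Volterra.op_apply _ _ hx]
    rfl
  rw [swirlOp, extZero_sub, extZero_neg, extZero_smul, extZero_mul, extZero_mul, e1,
    psiInner_eq hε hε' v hx, powLamCubeCb, powLamCubeCb, extZero_mk hx, extZero_mk hx,
    Real.rpow_one, Real.rpow_neg h0.le, Real.rpow_sub h0, Real.rpow_one]
  simp only [Pi.pow_apply]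
  push_cast
  field_simp

/-! ### The quadratic part of the system -/

/-- The right hand sides of the linearized equations produced by `v`. -/
def quad (v : X ε) : Cb × Cb :=
  (-(dataθ ε v * dataDerivθ ε v)
      + swirlOp (2 * ε) (by linarith) (by linarith) (swirlCb hε hε' v),
    -(lamInv * (dataθ ε v * dataDerivφ ε v)))

theorem hasDerivAt_quot {x : ℝ} (hx : x ∈ Ioo (-1 : ℝ) 1) :
    HasDerivAt (fun y => v.pair.1 y / (1 - y))
      (((1 - x) * deriv v.pair.1 x + v.pair.1 x) / (1 - x) ^ 2) x := by
  have h1 : (1 - x) ≠ 0 := by linarith [hx.2]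
  refine ((v.mem₁.hasDerivAt hx).div (hasDerivAt_oneSub x) h1).congr_deriv ?_
  ring

theorem tendsto_quot : Tendsto (fun y => v.pair.1 y / (1 - y)) (𝓝[>] (-1)) (𝓝 0) :=
  tendsto_zero_of_lam_mul_bdd fun _ hx => v.mem₁.abs_quot_le hx

/-- The encoded right hand side is the true one: the derivatives agree, and both sides vanish at
`-1` thanks to the term `ψ(-1) / 4` in `swirlForce`. -/
theorem prim_quad {x : ℝ} (hx : x ∈ Ioo (-1 : ℝ) 1) : (volLam 1).prim (quad hε hε' v).1 x
    = swirlForce v x - 1 / 2 * (v.pair.1 x / (1 - x)) ^ 2 := by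
  refine sub_eq_zero.1 (eq_zero_of_hasDerivAt_zero (d := fun x =>
    (volLam 1).prim (quad hε hε' v).1 x
      - (swirlForce v x - 1 / 2 * (v.pair.1 x / (1 - x)) ^ 2)) (fun y hy => ?_) ?_ hx)
  · refine ((volLam_prim_hasDerivAt 1 _ hy).sub ((hasDerivAt_swirlForce hε hε' v hy).sub
      (((hasDerivAt_quot v hy).pow 2).const_mul (1 / 2)))).congr_deriv ?_
    have h0 : 0 < 1 + y := by linarith [hy.1]
    have h1 : 0 < 1 - y := by linarith [hy.2]
    have hl := lam_pos ⟨hy.1, hy.2.le⟩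
    rw [quad, extZero_add, extZero_neg, extZero_mul, dataθ, dataDerivθ, X.toCb_apply v hy,
      X.toCb_apply v hy]
    push_cast
    field_simp
    ring
  · have h1 : Tendsto ((volLam 1).prim (quad hε hε' v).1) (𝓝[>] (-1)) (𝓝 0) := by
      refine tendsto_zero_of_lam_mul_bdd (C := ‖(quad hε hε' v).1‖) fun y hy => ?_
      have hl := two_le_lam ⟨hy.1, hy.2.le⟩
      refine le_trans ?_ (volLam_prim_bound 1 (quad hε hε' v).1 hy)
      rw [pow_succ, pow_one, mul_assoc, abs_mul (lam y) (lam y * _)]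
      refine le_mul_of_one_le_left (abs_nonneg _) ?_
      rw [abs_of_pos (by linarith)]
      linarith
    have h2 := h1.sub ((tendsto_swirlForce hε hε' v).sub (((tendsto_quot v).pow 2).const_mul
      (1 / 2)))
    simpa using h2

theorem quad_snd_apply {x : ℝ} (hx : x ∈ Ioo (-1 : ℝ) 1) :
    extZero (quad hε hε' v).2 x / (1 + x) ^ ε
      = -(v.pair.1 x / (1 - x)) * ((1 + x) * deriv v.pair.2 x) := by
  have h0 : 0 < 1 + x := by linarith [hx.1]
  have h1 : 0 < 1 - x := by linarith [hx.2]
  have hl := lam_pos ⟨hx.1, hx.2.le⟩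
  have hp := onePlus_rpow_pos ε hx.1
  rw [quad, extZero_neg, extZero_mul, extZero_mul, lamInv_apply hx, dataθ, dataDerivφ,
    X.toCb_apply v hx, X.toCb_apply v hx, Real.rpow_add h0, Real.rpow_one]
  field_simp

theorem contDiff_quad : ContDiff ℝ ∞ (quad hε hε' (ε := ε)) := by
  have d0 := (dataθ ε).contDiff (n := ∞)
  have d1 := (dataDerivθ ε).contDiff (n := ∞)
  have d2 := (dataφ ε hε (by linarith)).contDiff (n := ∞)
  have d3 := (dataDerivφ ε).contDiff (n := ∞)
  have hσ : ContDiff ℝ ∞ (swirlCb hε hε' (ε := ε)) := d2.mul d3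
  have hA : ContDiff ℝ ∞ fun v : X ε =>
      innerOp (2 * ε) (by linarith) (by linarith) (swirlCb hε hε' v) :=
    (innerOp (2 * ε) (by linarith) (by linarith)).contDiff.comp hσ
  have hB : ContDiff ℝ ∞ fun v : X ε => (volSwirlThree (2 * ε) (by linarith) (by linarith)).op
      (innerOp (2 * ε) (by linarith) (by linarith) (swirlCb hε hε' v)) :=
    (volSwirlThree (2 * ε) (by linarith) (by linarith)).op.contDiff.comp hA
  exact ((d0.mul d1).neg.add ((contDiff_const.mul hA).neg.sub
    ((contDiff_const.mul hB).const_smul (2 : ℝ)))).prodMk (contDiff_const.mul (d0.mul d3)).neg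

theorem quad_smul (t : ℝ) : quad hε hε' (t • v) = t ^ 2 • quad hε hε' v := by
  have hσ : swirlCb hε hε' (t • v) = t ^ 2 • swirlCb hε hε' v := by
    simp only [swirlCb, map_smul, smul_mul_assoc, mul_smul_comm, smul_smul, pow_two]
  refine Prod.ext ?_ ?_
  · simp only [quad, hσ, swirlOp, map_smul, Prod.smul_fst, smul_mul_assoc, mul_smul_comm, smul_add,
      smul_sub, smul_neg, smul_smul, pow_two]
    simp only [mul_comm]
  · simp only [quad, map_smul, Prod.smul_snd, smul_mul_assoc, mul_smul_comm, smul_neg, smul_smul,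
      pow_two]

theorem quad_zero : quad hε hε' (0 : X ε) = 0 := by
  have := quad_smul hε hε' (0 : X ε) 0
  simpa using this

/-- Along each ray `quad` is `t ^ 2` times a constant, so every directional derivative at `0`
vanishes. -/
theorem hasFDerivAt_quad_zero : HasFDerivAt (quad hε hε' (ε := ε)) (0 : X ε →L[ℝ] Cb × Cb) 0 := by
  have hd : HasFDerivAt (quad hε hε' (ε := ε)) (fderiv ℝ (quad hε hε' (ε := ε)) 0) 0 :=
    ((contDiff_quad hε hε').differentiable (by norm_num) 0).hasFDerivAt
  have h0 : fderiv ℝ (quad hε hε' (ε := ε)) 0 = 0 := by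
    ext1 v
    have h1 : HasDerivAt (fun t : ℝ => quad hε hε' (t • v))
        (fderiv ℝ (quad hε hε' (ε := ε)) 0 v) 0 := by
      have hl : HasDerivAt (fun t : ℝ => t • v) v 0 := by
        simpa using (hasDerivAt_id (0 : ℝ)).smul_const v
      have hd' : HasFDerivAt (quad hε hε' (ε := ε)) (fderiv ℝ (quad hε hε' (ε := ε)) 0)
          ((0 : ℝ) • v) := by rwa [zero_smul]
      exact hd'.comp_hasDerivAt 0 hl
    have h2 : HasDerivAt (fun t : ℝ => quad hε hε' (t • v)) 0 0 := by
      simp only [quad_smul]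
      simpa using ((hasDerivAt_id (0 : ℝ)).pow 2).smul_const (quad hε hε' v)
    simpa using h1.unique h2
  rwa [h0] at hd

end psi

/-! ### Smooth dependence of fixed points on parameters -/

section fixedPoint

variable {P Y : Type*} [NormedAddCommGroup P] [NormedSpace ℝ P] [CompleteSpace P]
  [NormedAddCommGroup Y] [NormedSpace ℝ Y] [CompleteSpace Y]

/-- The map `(p, y) ↦ (p, y - N (p, y))` has derivative the identity at the base point. Injectivity
of its local inverse chart gives uniqueness, and the inverse along `(p, 0)` gives the fixed points.
The second claim provides a smooth germ at each nearby `p`; the germs are glued afterwards by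
uniqueness. -/
theorem eventually_fixedPoint {N : P × Y → Y} {p₀ : P}
    (hN : ∀ᶠ z in 𝓝 (p₀, (0 : Y)), ContDiffAt ℝ ∞ N z) (h0 : N (p₀, 0) = 0)
    (hd : HasFDerivAt N (0 : P × Y →L[ℝ] Y) (p₀, 0)) :
    (∀ᶠ t : P × Y × Y in 𝓝 (p₀, 0, 0), N (t.1, t.2.1) = t.2.1 → N (t.1, t.2.2) = t.2.2 →
      t.2.1 = t.2.2) ∧
    ∀ r > 0, ∀ᶠ p in 𝓝 p₀, ∃ g : P → Y, ContDiffAt ℝ ∞ g p ∧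
      ∀ᶠ p' in 𝓝 p, g p' ∈ ball 0 r ∧ N (p', g p') = g p' := by
  let Φ : P × Y → P × Y := fun z => (z.1, z.2 - N z)
  have hΦ : ∀ {z}, ContDiffAt ℝ ∞ N z → ContDiffAt ℝ ∞ Φ z := fun h =>
    contDiffAt_fst.prodMk (contDiffAt_snd.sub h)
  have hΦ0 : Φ (p₀, 0) = (p₀, 0) := by simp [Φ, h0]
  have hdΦ : HasFDerivAt Φ ((ContinuousLinearEquiv.refl ℝ (P × Y)) : P × Y →L[ℝ] P × Y)
      (p₀, 0) := by
    refine (hasFDerivAt_fst.prodMk (hasFDerivAt_snd.sub hd)).congr_fderiv ?_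
    ext z <;> simp
  have hsΦ : HasStrictFDerivAt Φ ((ContinuousLinearEquiv.refl ℝ (P × Y)) : P × Y →L[ℝ] P × Y)
      (p₀, 0) := (hΦ hN.self_of_nhds).hasStrictFDerivAt' hdΦ (by norm_num)
  let e := hsΦ.toOpenPartialHomeomorph Φ
  have he : ∀ z, e z = Φ z := fun z => rfl
  have hsrc : (p₀, (0 : Y)) ∈ e.source := hsΦ.mem_toOpenPartialHomeomorph_source
  have htgt : (p₀, (0 : Y)) ∈ e.target := by
    have := e.map_source hsrc
    rwa [he, hΦ0] at this
  have hsymm : e.symm (p₀, 0) = (p₀, 0) := by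
    have := e.left_inv hsrc
    rwa [he, hΦ0] at this
  constructor
  · have c1 : Tendsto (fun t : P × Y × Y => (t.1, t.2.1)) (𝓝 (p₀, 0, 0)) (𝓝 (p₀, 0)) :=
      (by fun_prop : Continuous fun t : P × Y × Y => (t.1, t.2.1)).tendsto _
    have c2 : Tendsto (fun t : P × Y × Y => (t.1, t.2.2)) (𝓝 (p₀, 0, 0)) (𝓝 (p₀, 0)) :=
      (by fun_prop : Continuous fun t : P × Y × Y => (t.1, t.2.2)).tendsto _
    filter_upwards [c1 (e.open_source.mem_nhds hsrc), c2 (e.open_source.mem_nhds hsrc)]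
      with t h1 h2 f1 f2
    have : Φ (t.1, t.2.1) = Φ (t.1, t.2.2) := by simp [Φ, f1, f2]
    exact (Prod.ext_iff.1 (e.injOn h1 h2 this)).2
  · intro r hr
    -- Smoothness of the inverse at points other than the base needs an invertible derivative there,
    -- which persists because invertible operators form an open set.
    have hinv : ∀ᶠ z in 𝓝 (p₀, (0 : Y)), ∃ L : (P × Y) ≃L[ℝ] P × Y,
        (L : P × Y →L[ℝ] P × Y) = fderiv ℝ Φ z := by
      have hc : ContinuousAt (fderiv ℝ Φ) (p₀, 0) :=
        (hΦ hN.self_of_nhds).continuousAt_fderiv (by norm_num)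
      rw [ContinuousAt, hdΦ.fderiv] at hc
      exact hc (ContinuousLinearEquiv.nhds _)
    have hball : ∀ᶠ z : P × Y in 𝓝 (p₀, (0 : Y)), z.2 ∈ ball (0 : Y) r :=
      continuousAt_snd (ball_mem_nhds (0 : Y) hr)
    have hcs : Tendsto e.symm (𝓝 (p₀, 0)) (𝓝 (p₀, 0)) := by
      have := e.continuousAt_symm htgt
      rwa [ContinuousAt, hsymm] at this
    have hcp : Tendsto (fun p : P => (p, (0 : Y))) (𝓝 p₀) (𝓝 (p₀, 0)) :=
      (by fun_prop : Continuous fun p : P => (p, (0 : Y))).tendsto _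
    have hgood := hcp ((e.open_target.eventually_mem htgt).and
      (hcs (hN.and (hinv.and hball))))
    filter_upwards [eventually_eventually_nhds.2 hgood] with p hp
    refine ⟨fun p => (e.symm (p, 0)).2, ?_, ?_⟩
    · obtain ⟨ht, hsm, ⟨L, hL⟩, -⟩ := hp.self_of_nhds
      have hfd : HasFDerivAt e (L : P × Y →L[ℝ] P × Y) (e.symm (p, 0)) := by
        rw [hL]
        exact ((hΦ hsm).differentiableAt (by norm_num)).hasFDerivAt
      have := e.contDiffAt_symm ht hfd (hΦ hsm)
      exact contDiffAt_snd.comp p (this.comp p (contDiffAt_id.prodMk contDiffAt_const))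
    · filter_upwards [hp] with q hq
      obtain ⟨ht, -, -, hb⟩ := hq
      refine ⟨hb, ?_⟩
      have h1 := e.right_inv ht
      rw [he] at h1
      have h2 : (e.symm (q, 0)).1 = q := congrArg Prod.fst h1
      have h3 : (e.symm (q, 0)).2 - N (e.symm (q, 0)) = 0 := congrArg Prod.snd h1
      have h4 : (q, (e.symm (q, 0)).2) = e.symm (q, 0) := Prod.ext h2.symm rfl
      rw [h4]
      exact (sub_eq_zero.1 h3).symm

end fixedPoint

/-- Compactness of `K`, in the form of neighbourhoods of `K × {0}` containing products, makes the
local radii of existence and uniqueness uniform. -/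
theorem exists_smooth_fixedPoint {A B Y : Type*} [NormedAddCommGroup A] [NormedSpace ℝ A]
    [CompleteSpace A] [NormedAddCommGroup B] [NormedSpace ℝ B] [CompleteSpace B]
    [NormedAddCommGroup Y] [NormedSpace ℝ Y] [CompleteSpace Y] {K : Set A} (hK : IsCompact K)
    {N : (A × B) × Y → Y}
    (hN : ∀ a ∈ K, ∀ᶠ z in 𝓝 (((a, 0), 0) : (A × B) × Y), ContDiffAt ℝ ∞ N z)
    (h0 : ∀ a ∈ K, N ((a, 0), 0) = 0) 
    (hd : ∀ a ∈ K, HasFDerivAt N (0 : (A × B) × Y →L[ℝ] Y) ((a, 0), 0)) :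
    ∃ O : Set A, IsOpen O ∧ K ⊆ O ∧ ∃ δ > 0, ∃ r > 0, ∃ g : A × B → Y,
      ContDiffOn ℝ ∞ g (O ×ˢ ball 0 δ) ∧ ∀ p ∈ O ×ˢ ball (0 : B) δ,
        N (p, g p) = g p ∧ ∀ y ∈ ball (0 : Y) r, N (p, y) = y → y = g p := by
  have hu : {t : A × B × Y × Y | N ((t.1, t.2.1), t.2.2.1) = t.2.2.1 →
      N ((t.1, t.2.1), t.2.2.2) = t.2.2.2 → t.2.2.1 = t.2.2.2} ∈ 𝓝ˢ K ×ˢ 𝓝 0 := by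
    refine hK.mem_nhdsSet_prod_of_forall fun a ha => ?_
    rw [← nhds_prod_eq]
    have hc : Tendsto (fun t : A × B × Y × Y => ((t.1, t.2.1), t.2.2.1, t.2.2.2))
        (𝓝 (a, 0)) (𝓝 ((a, 0), 0, 0)) :=
      (by fun_prop : Continuous fun t : A × B × Y × Y =>
        ((t.1, t.2.1), t.2.2.1, t.2.2.2)).tendsto _
    exact hc (eventually_fixedPoint (hN a ha) (h0 a ha) (hd a ha)).1
  obtain ⟨s, hs, t, ht, hst⟩ := Filter.mem_prod_iff.1 hu
  obtain ⟨O₁, hO₁, hKO₁, hO₁s⟩ := mem_nhdsSet_iff_exists.1 hs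
  obtain ⟨r, hr, hrt⟩ := Metric.mem_nhds_iff.1 ht
  have huniq : ∀ a ∈ O₁, ∀ b ∈ ball (0 : B) r, ∀ y ∈ ball (0 : Y) r, ∀ z ∈ ball (0 : Y) r,
      N ((a, b), y) = y → N ((a, b), z) = z → y = z := by
    intro a ha b hb y hy z hz h1 h2
    refine @hst (a, b, y, z) ⟨hO₁s ha, hrt ?_⟩ h1 h2
    simp only [mem_ball_zero_iff] at *
    exact max_lt hb (max_lt hy hz)
  have hex : {p : A × B | ∃ g : A × B → Y, ContDiffAt ℝ ∞ g p ∧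
      ∀ᶠ p' in 𝓝 p, g p' ∈ ball 0 r ∧ N (p', g p') = g p'} ∈ 𝓝ˢ K ×ˢ 𝓝 0 := by
    refine hK.mem_nhdsSet_prod_of_forall fun a ha => ?_
    rw [← nhds_prod_eq]
    exact (eventually_fixedPoint (hN a ha) (h0 a ha) (hd a ha)).2 r hr
  obtain ⟨s', hs', t', ht', hst'⟩ := Filter.mem_prod_iff.1 hex
  obtain ⟨O₂, hO₂, hKO₂, hO₂s⟩ := mem_nhdsSet_iff_exists.1 hs'
  obtain ⟨ρ, hρ, hρt⟩ := Metric.mem_nhds_iff.1 ht'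
  have hO : IsOpen ((O₁ ∩ O₂) ×ˢ ball (0 : B) (min r ρ)) := (hO₁.inter hO₂).prod isOpen_ball
  have hloc : ∀ p : A × B, p ∈ (O₁ ∩ O₂) ×ˢ ball (0 : B) (min r ρ) → ∃ g : A × B → Y,
      ContDiffAt ℝ ∞ g p ∧ ∀ᶠ p' in 𝓝 p, g p' ∈ ball 0 r ∧ N (p', g p') = g p' := fun p hp =>
    @hst' p ⟨hO₂s hp.1.2, hρt (ball_subset_ball (min_le_right _ _) hp.2)⟩
  have hpt : ∀ p : A × B, ∃ y : Y, p ∈ (O₁ ∩ O₂) ×ˢ ball (0 : B) (min r ρ) →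
      y ∈ ball 0 r ∧ N (p, y) = y := by
    intro p
    by_cases hp : p ∈ (O₁ ∩ O₂) ×ˢ ball (0 : B) (min r ρ)
    · obtain ⟨g, -, hg⟩ := hloc p hp
      exact ⟨g p, fun _ => hg.self_of_nhds⟩
    · exact ⟨0, fun h => absurd h hp⟩
  -- The selection is arbitrary, but uniqueness in the ball of radius `r` makes it coincide near
  -- each point with a smooth germ.
  choose g hg using hpt
  have hun : ∀ p ∈ (O₁ ∩ O₂) ×ˢ ball (0 : B) (min r ρ), ∀ y ∈ ball (0 : Y) r, N (p, y) = y →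
      y = g p := fun p hp y hy h =>
    huniq p.1 hp.1.1 p.2 (ball_subset_ball (min_le_left _ _) hp.2) y hy _ (hg p hp).1 h
      (hg p hp).2
  refine ⟨O₁ ∩ O₂, hO₁.inter hO₂, subset_inter hKO₁ hKO₂, min r ρ, lt_min hr hρ, r, hr, g,
    fun p hp => ?_, fun p hp => ⟨(hg p hp).2, hun p hp⟩⟩
  obtain ⟨f, hf, hfN⟩ := hloc p hp
  refine (hf.congr_of_eventuallyEq ?_).contDiffWithinAt
  filter_upwards [hfN, hO.mem_nhds hp] with q hq hqO
  exact (hun q hqO _ hq.1 hq.2).symm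

/-! ### Solutions near `U^{-1/2,γ}` and the linearized equations -/

theorem AgreeOn.isSolution {U W : Pair} (h : AgreeOn U W) {μ : ℝ} (hW : IsSolution W μ) :
    IsSolution U μ := by
  have d1 : ∀ x ∈ Ioo (-1 : ℝ) 1, deriv U.1 x = deriv W.1 x := fun x hx =>
    (h.1.eventuallyEq_of_mem (isOpen_Ioo.mem_nhds hx)).deriv_eq
  have d2 : EqOn (deriv U.2) (deriv W.2) (Ioo (-1) 1) := fun x hx =>
    (h.2.eventuallyEq_of_mem (isOpen_Ioo.mem_nhds hx)).deriv_eq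
  have d3 : ∀ x ∈ Ioo (-1 : ℝ) 1, deriv (deriv U.2) x = deriv (deriv W.2) x := fun x hx =>
    (d2.eventuallyEq_of_mem (isOpen_Ioo.mem_nhds hx)).deriv_eq
  refine ⟨hW.smoothθ.congr h.1, hW.smoothφ.congr h.2, fun t ht => ?_, fun x hx => ?_,
    fun x hx => ?_⟩
  · refine (hW.integrable t ht).congr_ae ?_
    rw [EventuallyEq, ae_restrict_iff' measurableSet_uIoc]
    exact ae_uIoc_of_forall_Ioo ⟨ht.1.le, ht.2.le⟩ (by norm_num) fun s hs =>
      (swirlDensity_congr h.2 hs).symm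
  · rw [d1 x hx, h.1 hx, psi_congr h.2 ⟨hx.1.le, hx.2.le⟩, hW.eqθ x hx]
  · rw [d3 x hx, h.1 hx, d2 hx, hW.eqφ x hx]

theorem AgreeOn.symm {U W : Pair} (h : AgreeOn U W) : AgreeOn W U := ⟨h.1.symm, h.2.symm⟩

theorem hasDerivAt_Ubarθ {γ x : ℝ} (hγ : -1 < γ) (hx : x ∈ Ioo (-1 : ℝ) 1) :
    HasDerivAt (Ubarθ γ) (-(1 - 2 * (γ + 1) / den (γ + 1) x)
      - (1 - x) * ((2 * (γ + 1) / den (γ + 1) x) ^ 2 / (2 * (1 + x)))) x := by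
  have hd := den_pos (c := γ + 1) (by linarith) ⟨hx.1, hx.2.le⟩
  have h0 : 0 < 1 + x := by linarith [hx.1]
  have h := (hasDerivAt_oneSub x).mul (((hasDerivAt_const x (2 * (γ + 1))).div
    (hasDerivAt_den (γ + 1) hx.1) hd.ne').const_sub 1)
  refine (h.congr_of_eventuallyEq ?_).congr_deriv ?_
  · filter_upwards [isOpen_Ioo.mem_nhds hx] with z hz using Ubarθ_eq hγ ⟨hz.1, hz.2.le⟩
  · simp only [Pi.div_apply]
    field_simp
    ring

theorem contDiffOn_Ubarθ {γ : ℝ} (hγ : -1 < γ) : ContDiffOn ℝ 1 (Ubarθ γ) (Ioo (-1) 1) := by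
  refine contDiffOn_one_of_hasDerivAt isOpen_Ioo (fun x hx => hasDerivAt_Ubarθ hγ hx) ?_
  have hk : ContinuousOn (fun x => 2 * (γ + 1) / den (γ + 1) x) (Ioo (-1) 1) :=
    continuousOn_const.div (continuousOn_den (γ + 1)) fun x hx =>
      (den_pos (by linarith) ⟨hx.1, hx.2.le⟩).ne'
  have h1 : ContinuousOn (fun x : ℝ => 1 - x) (Ioo (-1) 1) := by fun_prop
  have h2 : ContinuousOn (fun x : ℝ => 2 * (1 + x)) (Ioo (-1) 1) := by fun_prop
  exact (continuousOn_const.sub hk).neg.sub (h1.mul ((hk.pow 2).div h2 fun x hx => by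
    have : 0 < 1 + x := by linarith [hx.1]
    positivity))

section equations

variable {ε : ℝ} {γ : ℝ} (v : X ε)

theorem Ubar_add_fst (x : ℝ) : (Ubar γ + v.pair).1 x = Ubarθ γ x + v.pair.1 x := rfl

theorem Ubar_add_snd : (Ubar γ + v.pair).2 = v.pair.2 := zero_add _

/-- The base flow solves the equation without swirl for `μ = -1/2`, so its own terms cancel.
Dividing by `(1 - x)²` and splitting off `ψ(-1) / 4` isolates a constant that does not depend on
`x`. -/
theorem eqθ_iff (hγ : -1 < γ) (μ : ℝ) {x : ℝ} (hx : x ∈ Ioo (-1 : ℝ) 1) :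
    (1 - x ^ 2) * deriv (Ubar γ + v.pair).1 x + 2 * x * (Ubar γ + v.pair).1 x
        + 1 / 2 * (Ubar γ + v.pair).1 x ^ 2 - psi (Ubar γ + v.pair).2 x = μ * (1 - x) ^ 2 ↔
      (1 + x) * (((1 - x) * deriv v.pair.1 x + v.pair.1 x) / (1 - x) ^ 2)
        = 2 * (γ + 1) / den (γ + 1) x * (v.pair.1 x / (1 - x))
          + (swirlForce v x - 1 / 2 * (v.pair.1 x / (1 - x)) ^ 2)
          + (μ + 1 / 2 + 1 / 4 * psi v.pair.2 (-1)) := by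
  have h0 : 0 < 1 + x := by linarith [hx.1]
  have h1 : 0 < 1 - x := by linarith [hx.2]
  have hderiv : deriv (Ubar γ + v.pair).1 x = _ :=
    ((hasDerivAt_Ubarθ hγ hx).add (v.mem₁.hasDerivAt hx)).deriv
  rw [hderiv, Ubar_add_fst, Ubar_add_snd, swirlForce, Ubarθ_eq hγ ⟨hx.1, hx.2.le⟩]
  set k := 2 * (γ + 1) / den (γ + 1) x
  set f := v.pair.1 x
  set f' := deriv v.pair.1 x
  rw [← sub_eq_zero, ← sub_eq_zero (b := _ + (μ + 1 / 2 + 1 / 4 * psi v.pair.2 (-1)))]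
  have key : (1 - x ^ 2) * (-(1 - k) - (1 - x) * (k ^ 2 / (2 * (1 + x))) + f')
      + 2 * x * ((1 - x) * (1 - k) + f) + 1 / 2 * ((1 - x) * (1 - k) + f) ^ 2 - psi v.pair.2 x
        - μ * (1 - x) ^ 2
      = (1 - x) ^ 2 * ((1 + x) * (((1 - x) * f' + f) / (1 - x) ^ 2)
        - (k * (f / (1 - x)) + (psi v.pair.2 x / (1 - x) ^ 2 - psi v.pair.2 (-1) / 4
          - 1 / 2 * (f / (1 - x)) ^ 2) + (μ + 1 / 2 + 1 / 4 * psi v.pair.2 (-1)))) := by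
    field_simp
    ring
  rw [key, mul_eq_zero, or_iff_right (pow_pos h1 2).ne']

/-- Division by `1 - x` turns the swirl equation into the same scalar equation as for `g`, now for
the slope `(1 + x) w'`. -/
theorem eqφ_iff (hγ : -1 < γ) {x : ℝ} (hx : x ∈ Ioo (-1 : ℝ) 1) :
    (1 - x ^ 2) * deriv (deriv (Ubar γ + v.pair).2) x
        + (Ubar γ + v.pair).1 x * deriv (Ubar γ + v.pair).2 x = 0 ↔
      deriv v.pair.2 x + (1 + x) * deriv (deriv v.pair.2) x
        = (2 * (γ + 1) / den (γ + 1) x * ((1 + x) * deriv v.pair.2 x)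
          + -(v.pair.1 x / (1 - x)) * ((1 + x) * deriv v.pair.2 x)) / (1 + x) := by
  have h0 : 0 < 1 + x := by linarith [hx.1]
  have h1 : 0 < 1 - x := by linarith [hx.2]
  rw [Ubar_add_fst, Ubar_add_snd, Ubarθ_eq hγ ⟨hx.1, hx.2.le⟩]
  set k := 2 * (γ + 1) / den (γ + 1) x
  rw [← sub_eq_zero (b := _ / (1 + x))]
  have key : (1 - x ^ 2) * deriv (deriv v.pair.2) x
      + ((1 - x) * (1 - k) + v.pair.1 x) * deriv v.pair.2 x
      = (1 - x) * (deriv v.pair.2 x + (1 + x) * deriv (deriv v.pair.2) x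
        - (k * ((1 + x) * deriv v.pair.2 x)
          + -(v.pair.1 x / (1 - x)) * ((1 + x) * deriv v.pair.2 x)) / (1 + x)) := by
    field_simp
    ring
  rw [key, mul_eq_zero, or_iff_right h1.ne']

theorem hasDerivAt_slope {x : ℝ} (hx : x ∈ Ioo (-1 : ℝ) 1) :
    HasDerivAt (fun y => (1 + y) * deriv v.pair.2 y)
      (deriv v.pair.2 x + (1 + x) * deriv (deriv v.pair.2) x) x := by
  refine ((hasDerivAt_onePlus x).mul
    (hasDerivAt_deriv_of_contDiffOn_two isOpen_Ioo v.mem₂.smooth₂ hx)).congr_deriv ?_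
  ring

/-- `v` solves the linearized system with the quadratic terms of the system at `v` as right hand
side. -/
abbrev SolvesQuad (hε : 0 < ε) (hε' : ε < 1 / 2) (γ : ℝ) (v : X ε) : Prop :=
  SolvesLinear (γ + 1) v.pair ((volLam 1).prim (quad hε hε' v).1)
    (fun x => extZero (quad hε hε' v).2 x / (1 + x) ^ ε)

theorem SolvesQuad.isSolution {hε : 0 < ε} {hε' : ε < 1 / 2} {v : X ε} (hγ : -1 < γ)
    (h : SolvesQuad hε hε' γ v) :
    IsSolution (Ubar γ + v.pair) (-1 / 2 - 1 / 4 * psi v.pair.2 (-1)) := by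
  refine ⟨(contDiffOn_Ubarθ hγ).add (v.mem₁.smooth₁.mono Ioo_subset_Ioc_self), ?_, fun t ht => ?_,
    fun x hx => ?_, fun x hx => ?_⟩
  · rw [Ubar_add_snd]
    exact v.mem₂.smooth₂
  · rw [Ubar_add_snd]
    exact swirlDensity_integrable hε hε' v ⟨ht.1, ht.2.le⟩
  · have h0 : 1 + x ≠ 0 := by linarith [hx.1]
    rw [eqθ_iff v hγ _ hx, (hasDerivAt_quot v hx).unique (h.eqθ x hx), prim_quad hε hε' v hx,
      mul_div_cancel₀ _ h0]
    ring
  · rw [eqφ_iff v hγ hx, (hasDerivAt_slope v hx).unique (h.eqφ x hx), quad_snd_apply hε hε' v hx]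

/-- In the reduced equation every term but the constant tends to `0` at `-1`, by the logarithmic
decay built into `M₁` and the continuity of `ψ` at `-1`. -/
theorem IsSolution.constant_eq (hε : 0 < ε) (hε' : ε < 1 / 2) {v : X ε} (hγ : -1 < γ) {μ : ℝ}
    (h : IsSolution (Ubar γ + v.pair) μ) : μ + 1 / 2 + 1 / 4 * psi v.pair.2 (-1) = 0 := by
  have hc : 0 < γ + 1 := by linarith
  have hN := normM₁_nonneg v.pair.1
  have t1 : Tendsto (fun x => (1 + x) * (((1 - x) * deriv v.pair.1 x + v.pair.1 x) / (1 - x) ^ 2))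
      (𝓝[>] (-1)) (𝓝 0) := by
    refine tendsto_zero_of_lam_mul_bdd (C := 77 * normM₁ v.pair.1) fun x hx => ?_
    have h1 := v.mem₁.abs_quot_deriv_le hx
    have hl := two_le_lam ⟨hx.1, hx.2.le⟩
    rw [show ∀ D : ℝ, (1 + x) * lam x ^ 2 * D = lam x * (lam x * ((1 + x) * D)) by intro D; ring,
      abs_mul, abs_of_pos (by linarith)] at h1
    refine le_trans ?_ h1
    exact le_mul_of_one_le_left (abs_nonneg _) (by linarith)
  have t2 : Tendsto (fun x => 2 * (γ + 1) / den (γ + 1) x * (v.pair.1 x / (1 - x)))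
      (𝓝[>] (-1)) (𝓝 0) := by
    refine tendsto_zero_of_lam_mul_bdd (C := (γ + 1) * (39 * normM₁ v.pair.1)) fun x hx => ?_
    have hd := two_le_den hc ⟨hx.1, hx.2.le⟩
    rw [mul_left_comm, abs_mul]
    gcongr
    · rw [abs_of_pos (by positivity), div_le_iff₀ (by linarith)]
      nlinarith
    · exact v.mem₁.abs_quot_le hx
  have t3 := ((t1.sub t2).sub (tendsto_swirlForce hε hε' v)).add
    (((tendsto_quot v).pow 2).const_mul (1 / 2))
  refine tendsto_nhds_unique (f := fun _ : ℝ => μ + 1 / 2 + 1 / 4 * psi v.pair.2 (-1))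
    (l := 𝓝[>] (-1)) tendsto_const_nhds ?_
  have e : (0 : ℝ) - 0 - 0 + 1 / 2 * 0 ^ 2 = 0 := by norm_num
  rw [e] at t3
  refine t3.congr' ?_
  filter_upwards [Ioo_mem_nhdsGT (show (-1 : ℝ) < 1 by norm_num)] with x hx
  rw [(eqθ_iff v hγ μ hx).1 (h.eqθ x hx)]
  ring

theorem IsSolution.solvesQuad (hε : 0 < ε) (hε' : ε < 1 / 2) {v : X ε} (hγ : -1 < γ) {μ : ℝ}
    (h : IsSolution (Ubar γ + v.pair) μ) : SolvesQuad hε hε' γ v := by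
  refine ⟨fun x hx => ?_, fun x hx => (v.mem₂.hasDerivAt hx).differentiableAt, fun x hx => ?_,
    v.mem₂.smooth₁.continuousOn, v.mem₂.right⟩
  · have h0 : 1 + x ≠ 0 := by linarith [hx.1]
    have h1 := (eqθ_iff v hγ μ hx).1 (h.eqθ x hx)
    rw [h.constant_eq hε hε' hγ, add_zero] at h1
    rw [prim_quad hε hε' v hx, ← h1, mul_div_cancel_left₀ _ h0]
    exact hasDerivAt_quot v hx
  · rw [quad_snd_apply hε hε' v hx, ← (eqφ_iff v hγ hx).1 (h.eqφ x hx)]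
    exact hasDerivAt_slope v hx

end equations

/-! ### The values at `0` and the projection onto `X₁` -/

section projection

variable {ε : ℝ}

theorem abs_l₁_le (v : X ε) : |l₁ ε v| ≤ 7 * ‖v‖ := by
  have h1 := v.mem₁.abs_lam_mul_le mem_zero
  have h2 := two_le_lam (x := 0) (by norm_num)
  have h3 : |l₁ ε v| = |v.pair.1 0| := rfl
  have h4 := v.normM₁_le
  rw [h3]
  nlinarith [abs_nonneg (v.pair.1 0)]

theorem abs_l₂_le (v : X ε) : |l₂ ε v| ≤ ‖v‖ := by
  have h1 := v.mem₂.abs_le mem_zero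
  have h3 : |l₂ ε v| = |v.pair.2 0| := rfl
  rw [add_zero, Real.one_rpow, one_mul] at h1
  rw [h3]
  exact h1.trans v.normM₂_le

/-- `l₁` as a continuous linear map -/
def evθ (ε : ℝ) : X ε →L[ℝ] ℝ := (l₁ ε).mkContinuous 7 abs_l₁_le

/-- `l₂` as a continuous linear map -/
def evφ (ε : ℝ) : X ε →L[ℝ] ℝ := (l₂ ε).mkContinuous 1 fun v => by
  rw [one_mul]
  exact abs_l₂_le v

theorem mem_X₁_iff {v : X ε} : v ∈ X₁ ε ↔ v.pair.1 0 = 0 ∧ v.pair.2 0 = 0 := Iff.rfl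

/-- A continuous projection onto `X₁`. -/
theorem exists_proj (ε : ℝ) (hε : 0 < ε) (hε' : ε ≤ 1) :
    ∃ π : X ε →L[ℝ] X₁ ε, ∀ v ∈ X₁ ε, (π v : X ε) = v := by
  -- The kernel elements at `γ = 0` serve as a complement of `X₁`: their values at `0` are `(1, 0)`
  -- and `(0, nonzero)`. Any `γ > -1` would do.
  let e₁ := linSol ε hε hε' ((0, EuclideanSpace.single 0 1), 0)
  let e₂ := linSol ε hε hε' ((0, EuclideanSpace.single 1 1), 0)
  have hγ : (-1 : ℝ) < 0 := by norm_num
  have a1 : e₁.pair.1 0 = 1 := by simp [e₁, linSol_fst_zero ε hε hε' _ _ hγ]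
  have a2 : e₁.pair.2 0 = 0 := by simp [e₁, linSol_snd_zero ε hε hε' _ _ hγ]
  have a3 : e₂.pair.1 0 = 0 := by simp [e₂, linSol_fst_zero ε hε hε' _ _ hγ]
  have a4 : e₂.pair.2 0 ≠ 0 := by
    have hd := den_pos (c := 0 + 1) (x := 0) (by norm_num) (by norm_num)
    have hl := Real.log_pos one_lt_two
    simp only [e₂, linSol_snd_zero ε hε hε' _ _ hγ]
    simp only [PiLp.single_apply, if_true, one_mul]
    positivity
  let L : X ε →L[ℝ] X ε := ContinuousLinearMap.id ℝ (X ε) - (evθ ε).smulRight e₁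
    - (evφ ε).smulRight ((e₂.pair.2 0)⁻¹ • e₂)
  have hL : ∀ v, L v = v - v.pair.1 0 • e₁ - v.pair.2 0 • (e₂.pair.2 0)⁻¹ • e₂ := fun v => rfl
  refine ⟨L.codRestrict (X₁ ε) fun v => ?_, fun v hv => ?_⟩
  · rw [mem_X₁_iff, hL]
    simp [a1, a2, a3, a4]
  · rw [mem_X₁_iff] at hv
    rw [ContinuousLinearMap.coe_codRestrict_apply, hL, hv.1, hv.2]
    simp

end projection

/-! ### The fixed point equation -/

section fixedPointMap

variable {ε : ℝ} (hε : 0 < ε) (hε' : ε < 1 / 2)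

/-- `linSol` for `ε < 1/2` -/
abbrev solOp (q : (ℝ × EuclideanSpace ℝ (Fin 2)) × Cb × Cb) : X ε :=
  linSol ε hε (by linarith) q

/-- The map whose fixed points are the right hand sides of the linearized system that correspond
to solutions of the full system. -/
def fixMap (q : (ℝ × EuclideanSpace ℝ (Fin 2)) × Cb × Cb) : Cb × Cb :=
  quad hε hε' (solOp hε hε' q)

theorem contDiffAt_fixMap {q : (ℝ × EuclideanSpace ℝ (Fin 2)) × Cb × Cb} (hq : -1 < q.1.1) :
    ContDiffAt ℝ ∞ (fixMap hε hε') q :=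
  (contDiff_quad hε hε').contDiffAt.comp q (contDiffAt_linSol ε hε _ hq)

theorem fixMap_zero (γ : ℝ) : fixMap hε hε' ((γ, 0), 0) = 0 := by
  rw [fixMap, solOp, linSol_zero, quad_zero]

theorem hasFDerivAt_fixMap_zero {γ : ℝ} (hγ : -1 < γ) : HasFDerivAt (fixMap hε hε')
    (0 : (ℝ × EuclideanSpace ℝ (Fin 2)) × Cb × Cb →L[ℝ] Cb × Cb) ((γ, 0), 0) := by
  have h1 : HasFDerivAt (solOp hε hε') _ ((γ, 0), 0) :=
    ((contDiffAt_linSol ε hε (by linarith) hγ).differentiableAt (by norm_num)).hasFDerivAt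
  have h2 : HasFDerivAt (quad hε hε' (ε := ε)) (0 : X ε →L[ℝ] Cb × Cb)
      (solOp hε hε' ((γ, 0), 0)) := by
    rw [solOp, linSol_zero]
    exact hasFDerivAt_quad_zero hε hε'
  exact (h2.comp _ h1).congr_fderiv (ContinuousLinearMap.zero_comp _)

theorem solvesQuad_of_fixed {γ : ℝ} (hγ : -1 < γ) {β : EuclideanSpace ℝ (Fin 2)} {y : Cb × Cb}
    (h : fixMap hε hε' ((γ, β), y) = y) : SolvesQuad hε hε' γ (solOp hε hε' ((γ, β), y)) := by
  have h1 := linSol_solves ε hε (by linarith) β y hγ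
  rw [fixMap] at h
  rw [SolvesQuad, h]
  exact h1

/-- The parameters `β` determined by the values at `0` of an element of `X`. -/
def coords (γ : ℝ) (v : X ε) : EuclideanSpace ℝ (Fin 2) :=
  !₂[v.pair.1 0, v.pair.2 0 / (den (γ + 1) 0 * Real.log 2 / 2)]

/-- The constant is `7 + 2`: since `den ≥ 2` and `ln 2 > 1/2`, the divisor in the second coordinate
is at least `1/2`. -/
theorem norm_coords_le {γ : ℝ} (hγ : -1 < γ) (v : X ε) : ‖coords γ v‖ ≤ 9 * ‖v‖ := by
  have h1 : |v.pair.1 0| ≤ 7 * ‖v‖ := abs_l₁_le v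
  have h2 : |v.pair.2 0| ≤ ‖v‖ := abs_l₂_le v
  have hd := two_le_den (c := γ + 1) (x := 0) (by linarith) (by norm_num)
  have hl := Real.log_two_gt_d9
  have hD : 1 / 2 ≤ den (γ + 1) 0 * Real.log 2 / 2 := by nlinarith
  have h3 : |v.pair.2 0 / (den (γ + 1) 0 * Real.log 2 / 2)| ≤ 2 * ‖v‖ := by
    rw [abs_div, abs_of_pos (show 0 < den (γ + 1) 0 * Real.log 2 / 2 by linarith),
      div_le_iff₀ (by linarith)]
    nlinarith [norm_nonneg v]
  refine (abs_le_of_sq_le_sq' ?_ (by positivity)).2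
  rw [EuclideanSpace.real_norm_sq_eq, Fin.sum_univ_two]
  simp only [coords]
  change v.pair.1 0 ^ 2 + (v.pair.2 0 / (den (γ + 1) 0 * Real.log 2 / 2)) ^ 2 ≤ _
  rw [← sq_abs (v.pair.1 0), ← sq_abs (_ / _)]
  nlinarith [abs_nonneg (v.pair.1 0),
    abs_nonneg (v.pair.2 0 / (den (γ + 1) 0 * Real.log 2 / 2)), norm_nonneg v]

/-- By uniqueness for the linear system, `v` is recovered from its values at `0` and its own
quadratic terms. Applying `quad` shows that these terms form a fixed point of `fixMap`. -/
theorem SolvesQuad.eq_solOp {γ : ℝ} (hγ : -1 < γ) {v : X ε} (h : SolvesQuad hε hε' γ v) :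
    solOp hε hε' ((γ, coords γ v), quad hε hε' v) = v := by
  have hd := den_pos (c := γ + 1) (x := 0) (by linarith) (by norm_num)
  have hl := Real.log_pos one_lt_two
  refine X.eq_of_agreeOn ((linSol_solves ε hε (by linarith) _ _ hγ).agreeOn (by linarith) h ?_ ?_)
  · rw [linSol_fst_zero ε hε _ _ _ hγ]
    rfl
  · rw [linSol_snd_zero ε hε _ _ _ hγ]
    change v.pair.2 0 / (den (γ + 1) 0 * Real.log 2 / 2) * _ = _
    exact div_mul_cancel₀ _ (by positivity)

/-- The values at `0` of the solution operator depend on `γ` and `β` only, not on the right hand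
sides. -/
theorem solOp_sub_mem_X₁ {γ : ℝ} (hγ : -1 < γ) (β : EuclideanSpace ℝ (Fin 2)) (y : Cb × Cb) :
    solOp hε hε' ((γ, β), y) - solOp hε hε' ((γ, β), 0) ∈ X₁ ε := by
  rw [mem_X₁_iff, map_sub, Prod.fst_sub, Prod.snd_sub, Pi.sub_apply, Pi.sub_apply,
    linSol_fst_zero ε hε _ _ _ hγ, linSol_fst_zero ε hε _ _ _ hγ, linSol_snd_zero ε hε _ _ _ hγ,
    linSol_snd_zero ε hε _ _ _ hγ, sub_self, sub_self]
  exact ⟨rfl, rfl⟩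

theorem agreeOn_family {γ : ℝ} (hγ : -1 < γ) (β : EuclideanSpace ℝ (Fin 2)) (y : Cb × Cb) :
    AgreeOn (family γ β (solOp hε hε' ((γ, β), y) - solOp hε hε' ((γ, β), 0)).pair)
      (Ubar γ + (solOp hε hε' ((γ, β), y)).pair) := by
  have h := agreeOn_linSol_kernel ε hε (by linarith) β hγ
  have e : family γ β (solOp hε hε' ((γ, β), y) - solOp hε hε' ((γ, β), 0)).pair
      = Ubar γ + (solOp hε hε' ((γ, β), y)).pair
        + ((β 0 • kerOne γ + β 1 • kerTwo γ) - (solOp hε hε' ((γ, β), 0)).pair) := by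
    rw [family, map_sub]
    abel
  rw [e]
  refine ⟨fun x hx => ?_, fun x hx => ?_⟩
  · rw [Prod.fst_add, Pi.add_apply, Prod.fst_sub, Pi.sub_apply, h.1 hx, sub_self, add_zero]
  · rw [Prod.snd_add, Pi.add_apply, Prod.snd_sub, Pi.sub_apply, h.2 hx, sub_self, add_zero]

theorem isSolution_family {γ : ℝ} (hγ : -1 < γ) {β : EuclideanSpace ℝ (Fin 2)} {y : Cb × Cb}
    (h : fixMap hε hε' ((γ, β), y) = y) {W : Pair}
    (hW : W = (solOp hε hε' ((γ, β), y) - solOp hε hε' ((γ, β), 0)).pair) :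
    IntervalIntegrable (psiInner (family γ β W).2) volume (-1) 1 ∧
      IsSolution (family γ β W) (-1 / 2 - 1 / 4 * psi (family γ β W).2 (-1)) := by
  subst hW
  have ha := agreeOn_family hε hε' hγ β y
  have h2 : EqOn (family γ β (solOp hε hε' ((γ, β), y) - solOp hε hε' ((γ, β), 0)).pair).2
      (solOp hε hε' ((γ, β), y)).pair.2 (Ioo (-1) 1) := by
    have := ha.2
    rwa [Ubar_add_snd] at this
  constructor
  · refine (psiInner_integrable hε hε' (solOp hε hε' ((γ, β), y))).congr_ae ?_
    rw [EventuallyEq, ae_restrict_iff' measurableSet_uIoc]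
    exact ae_uIoc_of_forall_Ioo (by norm_num) (by norm_num) fun s hs =>
      (psiInner_congr h2 ⟨hs.1.le, hs.2.le⟩).symm
  · rw [psi_congr h2 (by norm_num)]
    exact ha.isSolution (SolvesQuad.isSolution hγ (solvesQuad_of_fixed hε hε' hγ h))

/-- Differentiate `g = fixMap (·, g)` at a point where the derivative of `fixMap` is zero. -/
theorem hasFDerivAt_of_fixed {g : ℝ × EuclideanSpace ℝ (Fin 2) → Cb × Cb} {γ : ℝ} (hγ : -1 < γ)
    (hg : DifferentiableAt ℝ g (γ, 0)) (h0 : g (γ, 0) = 0)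
    (hfix : ∀ᶠ p in 𝓝 (γ, 0), fixMap hε hε' (p, g p) = g p) :
    HasFDerivAt g (0 : ℝ × EuclideanSpace ℝ (Fin 2) →L[ℝ] Cb × Cb) (γ, 0) := by
  have h1 : HasFDerivAt (fun p => (p, g p)) _ (γ, (0 : EuclideanSpace ℝ (Fin 2))) :=
    (hasFDerivAt_id _).prodMk hg.hasFDerivAt
  have h2 := hasFDerivAt_fixMap_zero hε hε' hγ
  rw [← h0] at h2
  refine ((HasFDerivAt.comp (γ, (0 : EuclideanSpace ℝ (Fin 2))) h2 h1).congr_fderiv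
    (ContinuousLinearMap.zero_comp _)).congr_of_eventuallyEq ?_
  filter_upwards [hfix] with p hp using hp.symm

/-- As `g` and its derivative vanish at `(γ, 0)`, both terms have the same derivative there. -/
theorem hasFDerivAt_solOp_sub {g : ℝ × EuclideanSpace ℝ (Fin 2) → Cb × Cb} {γ : ℝ} (hγ : -1 < γ)
    (hg : HasFDerivAt g (0 : ℝ × EuclideanSpace ℝ (Fin 2) →L[ℝ] Cb × Cb) (γ, 0))
    (h0 : g (γ, 0) = 0) :
    HasFDerivAt (fun p => solOp hε hε' (p, g p) - solOp hε hε' (p, 0))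
      (0 : ℝ × EuclideanSpace ℝ (Fin 2) →L[ℝ] X ε) (γ, 0) := by
  have h1 : HasFDerivAt (solOp hε hε') _ ((γ, 0), 0) :=
    ((contDiffAt_linSol ε hε (by linarith) hγ).differentiableAt (by norm_num)).hasFDerivAt
  have h2 := h1
  rw [← h0] at h2
  have c1 := HasFDerivAt.comp (γ, (0 : EuclideanSpace ℝ (Fin 2))) h2
    ((hasFDerivAt_id (𝕜 := ℝ) _).prodMk hg)
  have c2 := HasFDerivAt.comp (γ, (0 : EuclideanSpace ℝ (Fin 2))) h1
    ((hasFDerivAt_id (𝕜 := ℝ) _).prodMk (hasFDerivAt_const (0 : Cb × Cb) _))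
  refine (c1.sub c2).congr_fderiv ?_
  rw [h0]
  exact sub_self _

end fixedPointMap

end NSSwirl

end

/-! ### Proof of the theorem -/

open NSSwirl Filter Topology

theorem theorem4p2 (ε : ℝ) (hε : 0 < ε) (hε' : ε < 1 / 2) (K : Set ℝ) (hK : IsCompact K)
    (hK' : K ⊆ Set.Ioi (-1)) :
    ∃ δ > 0, ∃ V : ℝ × EuclideanSpace ℝ (Fin 2) → NSSwirl.X₁ ε,
      (∃ O : Set ℝ, IsOpen O ∧ K ⊆ O ∧
        ContDiffOn ℝ ∞ V (O ×ˢ Metric.ball (0 : EuclideanSpace ℝ (Fin 2)) δ)) ∧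
      (∀ γ ∈ K, V (γ, 0) = 0) ∧
      (∀ γ ∈ K, ∀ i : Fin 2,
        HasDerivAt (fun t : ℝ => V (γ, EuclideanSpace.single i t)) 0 0) ∧
      (∀ γ ∈ K, ∀ β ∈ Metric.ball (0 : EuclideanSpace ℝ (Fin 2)) δ,
        IntervalIntegrable
            (NSSwirl.psiInner (NSSwirl.family γ β (NSSwirl.X.pair (V (γ, β) : NSSwirl.X ε))).2)
            MeasureTheory.volume (-1) 1 ∧
          NSSwirl.IsSolution (NSSwirl.family γ β (NSSwirl.X.pair (V (γ, β) : NSSwirl.X ε)))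
            (-1 / 2 - 1 / 4 *
              NSSwirl.psi
                (NSSwirl.family γ β (NSSwirl.X.pair (V (γ, β) : NSSwirl.X ε))).2 (-1))) ∧
      ∃ δ' > 0, ∀ γ ∈ K, ∀ (U : NSSwirl.Pair) (W : NSSwirl.X ε),
        NSSwirl.AgreeOn (U - NSSwirl.Ubar γ) (NSSwirl.X.pair W) → ‖W‖ < δ' →
        (∃ μ : ℝ, NSSwirl.IsSolution U μ) →
        ∃ β ∈ Metric.ball (0 : EuclideanSpace ℝ (Fin 2)) δ,
          NSSwirl.AgreeOn U
            (NSSwirl.family γ β (NSSwirl.X.pair (V (γ, β) : NSSwirl.X ε))) := by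
  obtain ⟨O, hO, hKO, δ, hδ, r, hr, g, hg, hfix⟩ := exists_smooth_fixedPoint hK
    (N := fixMap hε hε') (fun a ha => by
      have hc : ContinuousAt (fun z : (ℝ × EuclideanSpace ℝ (Fin 2)) × Cb × Cb => z.1.1)
          ((a, 0), 0) := by fun_prop
      filter_upwards [hc (Ioi_mem_nhds (hK' ha))] with z hz using contDiffAt_fixMap hε hε' hz)
    (fun a _ => fixMap_zero hε hε' a) (fun a ha => hasFDerivAt_fixMap_zero hε hε' (hK' ha))
  -- The projection turns the correction into a map with values in the subspace `X₁` while keeping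
  -- it smooth; by `hval` it changes nothing for `γ ∈ K`.
  obtain ⟨π, hπ⟩ := exists_proj ε hε (by linarith)
  have h0δ : (0 : EuclideanSpace ℝ (Fin 2)) ∈ ball (0 : EuclideanSpace ℝ (Fin 2)) δ :=
    mem_ball_self hδ
  -- Zero is a small fixed point at `β = 0`, so uniqueness identifies it with `g (γ, 0)`.
  have hg0 : ∀ γ ∈ K, g (γ, 0) = 0 := fun γ hγ =>
    ((hfix (γ, 0) ⟨hKO hγ, h0δ⟩).2 0 (mem_ball_self hr) (fixMap_zero hε hε' γ)).symm
  have hval : ∀ γ ∈ K, ∀ β, (π (solOp hε hε' ((γ, β), g (γ, β)) - solOp hε hε' ((γ, β), 0)) : X ε)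
      = solOp hε hε' ((γ, β), g (γ, β)) - solOp hε hε' ((γ, β), 0) := fun γ hγ β =>
    hπ _ (solOp_sub_mem_X₁ hε hε' (hK' hγ) β _)
  refine ⟨δ, hδ, fun p => π (solOp hε hε' (p, g p) - solOp hε hε' (p, 0)),
    -- Smoothness of `linSol` was established only for `γ > -1`.
    ⟨O ∩ Ioi (-1), hO.inter isOpen_Ioi, subset_inter hKO hK', fun p hp => ?_⟩, fun γ hγ => ?_,
    fun γ hγ i => ?_, fun γ hγ β hβ => ?_, ?_⟩
  · have hp1 : -1 < p.1 := hp.1.2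
    have hgp : ContDiffWithinAt ℝ ∞ g ((O ∩ Ioi (-1)) ×ˢ ball 0 δ) p :=
      (hg p ⟨hp.1.1, hp.2⟩).mono (prod_mono_left inter_subset_left)
    refine π.contDiff.contDiffAt.comp_contDiffWithinAt p (ContDiffWithinAt.sub ?_ ?_)
    · exact ContDiffAt.comp_contDiffWithinAt p (f := fun p => (p, g p))
        (contDiffAt_linSol ε hε (by linarith) hp1) (contDiffWithinAt_id.prodMk hgp)
    · exact ContDiffAt.comp_contDiffWithinAt p (f := fun p => (p, (0 : Cb × Cb)))
        (contDiffAt_linSol ε hε (by linarith) hp1) (contDiffWithinAt_id.prodMk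
          contDiffWithinAt_const)
  · change π _ = 0
    rw [hg0 γ hγ, sub_self, map_zero]
  · have hnhds : O ×ˢ ball (0 : EuclideanSpace ℝ (Fin 2)) δ ∈ 𝓝 (γ, 0) :=
      (hO.prod isOpen_ball).mem_nhds ⟨hKO hγ, h0δ⟩
    have h1 := hasFDerivAt_of_fixed hε hε' (hK' hγ)
      ((hg.contDiffAt hnhds).differentiableAt (by norm_num)) (hg0 γ hγ)
      (by filter_upwards [hnhds] with p hp using (hfix p hp).1)
    have h2 := (π.hasFDerivAt.comp _ (hasFDerivAt_solOp_sub hε hε' (hK' hγ) h1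
      (hg0 γ hγ))).congr_fderiv (ContinuousLinearMap.comp_zero _)
    have e : ∀ t : ℝ, EuclideanSpace.single i t
        = t • (EuclideanSpace.single i 1 : EuclideanSpace ℝ (Fin 2)) := fun t => by
      ext j
      simp [PiLp.single_apply]
    have h3 : HasDerivAt (fun t : ℝ => (γ, (EuclideanSpace.single i t : EuclideanSpace ℝ (Fin 2))))
        (0, EuclideanSpace.single i 1) 0 := by
      refine (hasDerivAt_const _ _).prodMk ?_
      rw [funext e]
      simpa only [one_smul, id] using (hasDerivAt_id (0 : ℝ)).smul_const
        (EuclideanSpace.single i 1 : EuclideanSpace ℝ (Fin 2))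
    exact (HasFDerivAt.comp_hasDerivAt_of_eq (0 : ℝ) h2 h3 (by rw [e, zero_smul])).congr_deriv rfl
  · exact isSolution_family hε hε' (hK' hγ) (hfix (γ, β) ⟨hKO hγ, hβ⟩).1
      (congrArg X.pair (hval γ hγ β))
  · have hq : ∀ᶠ v in 𝓝 (0 : X ε), quad hε hε' v ∈ ball (0 : Cb × Cb) r := by
      have hc := (contDiff_quad hε hε').continuous.tendsto 0
      rw [quad_zero] at hc
      exact hc (ball_mem_nhds _ hr)
    obtain ⟨s, hs, hsq⟩ := Metric.eventually_nhds_iff_ball.1 hq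
    -- The radius `s` puts the quadratic terms of `W` into the ball where fixed points are unique;
    -- `δ / 9`, through `norm_coords_le`, puts `coords γ W` into the parameter ball.
    refine ⟨min s (δ / 9), lt_min hs (by positivity), fun γ hγ U W hUW hW hsol => ?_⟩
    obtain ⟨μ, hμ⟩ := hsol
    have hU : AgreeOn U (Ubar γ + W.pair) :=
      ⟨fun x hx => sub_eq_iff_eq_add'.1 (hUW.1 hx), fun x hx => sub_eq_iff_eq_add'.1 (hUW.2 hx)⟩
    have hquad := (hU.symm.isSolution hμ).solvesQuad hε hε' (hK' hγ)
    have heq := SolvesQuad.eq_solOp hε hε' (hK' hγ) hquad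
    have hβ : coords γ W ∈ ball (0 : EuclideanSpace ℝ (Fin 2)) δ := by
      rw [mem_ball_zero_iff]
      have := norm_coords_le (hK' hγ) W
      have := hW.trans_le (min_le_right _ _)
      linarith
    have hy : quad hε hε' W = g (γ, coords γ W) :=
      (hfix (γ, coords γ W) ⟨hKO hγ, hβ⟩).2 _
        (hsq W (mem_ball_zero_iff.2 (hW.trans_le (min_le_left _ _)))) (by rw [fixMap, heq])
    refine ⟨coords γ W, hβ, ?_⟩
    have hfam := agreeOn_family hε hε' (hK' hγ) (coords γ W) (g (γ, coords γ W))
    rw [← hval γ hγ] at hfam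
    rw [hy] at heq
    have hU' : AgreeOn U (Ubar γ + (solOp hε hε' ((γ, coords γ W), g (γ, coords γ W))).pair) := by
      rw [heq]
      exact hU
    exact ⟨hU'.1.trans hfam.1.symm, hU'.2.trans hfam.2.symm⟩
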